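/- Let $(\overline M,\bar g)$ be a connected smooth Riemannian manifold of dimension $n+1$, and let a compact Lie group $G$ act on it smoothly by isometries with cohomogeneity one: writing $K$ for the principal isotropy group (the points whose isotropy group is conjugate to $K$ form an open dense set $M_0\subset\overline M$, the union of the principal orbits), the principal orbits have dimension $n$. Assume that the orbit space $\overline M/G$ is not a circle. Let $\gamma$ be a unit speed geodesic, defined on an open interval $I$, which runs in $M_0$, intersects the principal orbits orthogonally and meets each of them exactly once, so that $(t,aK)\mapsto a\cdot\gamma(t)$ identifies $I\times G/K$ with $M_0$; let $t:M_0\to I$ be the resulting coordinate, $t(a\cdot\gamma(s))=s$. Let $\overline\omega$ be a smooth $1$-form on $\overline M$ and $\epsilon\in\mathbb R$ such that $(\overline M,\bar g,\overline\omega)$ is a Ricci soliton, i.e. $$\mathrm{Ric}(\bar g)+\overline\delta^*\overline\omega+\frac{\epsilon}{2}\,\bar g=0,$$ where $\overline\delta^*$ is the symmetrized covariant derivative. (1) If $\overline\omega$ is $G$-invariant and the isotropy representation of the principal orbits (the representation of the isotropy group $G_p$ on the tangent space $T_p(G\cdot p)$, $p\in M_0$) has no trivial irreducible summand, then the soliton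 is of gradient type: $\overline\omega=dU$ for some smooth function $U$ on $\overline M$. (2) If $\overline\omega=dU$ for a smooth $G$-invariant function $U$ on $\overline M$, then there is a smooth function $u:I\to\mathbb R$ such that $U=u\circ t$ and $\overline\omega=\dot u(t)\,dt$ on $M_0$, where $t$ is smooth on $M_0$. If, moreover, there is a special orbit at $t=0$, i.e. $0$ is an endpoint of $I$ and $\gamma(t)$ converges, as $t\to0$ in $I$, to a point of $\overline M$ that does not lie on a principal orbit, then $u$ is even in $t$: it is the restriction to $I$ of a smooth even function on $I\cup\{0\}\cup(-I)$. -/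

import Mathlib

open Set Filter Topology
open scoped Manifold ContDiff

noncomputable section

namespace CohomOne

/-! ### Riemannian geometry in coordinates

Manifolds are modelled on `EuclideanSpace ℝ (Fin d)`; metrics are Mathlib's smooth Riemannian
metrics on the tangent bundle.  Tensors are written in components with respect to the coordinate
frame of the chart centred at a point `c`; `y` is a point of the coordinate domain. -/

section Riemannian

variable {d : ℕ} {M : Type*} [TopologicalSpace M] [ChartedSpace (EuclideanSpace ℝ (Fin d)) M]

/-- Smooth Riemannian metrics on `M`. -/
abbrev Metric (d : ℕ) (M : Type*) [TopologicalSpace M]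
    [ChartedSpace (EuclideanSpace ℝ (Fin d)) M] [IsManifold (𝓡 d) ∞ M] :=
  Bundle.ContMDiffRiemannianMetric (𝓡 d) ∞ (EuclideanSpace ℝ (Fin d))
    (fun x : M => TangentSpace (𝓡 d) x)

/-- (Not necessarily smooth) one-forms on `M`. -/
abbrev OneForm (d : ℕ) (M : Type*) [TopologicalSpace M]
    [ChartedSpace (EuclideanSpace ℝ (Fin d)) M] :=
  (x : M) → TangentSpace (𝓡 d) x →L[ℝ] ℝ

/-- Smoothness of a one-form, as a section of the cotangent bundle. -/
def IsSmoothForm [IsManifold (𝓡 d) ∞ M] (η : OneForm d M) : Prop :=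
  ContMDiff (𝓡 d) ((𝓡 d).prod 𝓘(ℝ, EuclideanSpace ℝ (Fin d) →L[ℝ] ℝ)) ∞
    (fun x : M => Bundle.TotalSpace.mk' (EuclideanSpace ℝ (Fin d) →L[ℝ] ℝ)
      (E := fun x : M => TangentSpace (𝓡 d) x →L[ℝ] ℝ) x (η x))

/-- The partial derivative `∂ᵢ f` on coordinate space. -/
def pd (i : Fin d) (f : EuclideanSpace ℝ (Fin d) → ℝ) (y : EuclideanSpace ℝ (Fin d)) : ℝ :=
  fderiv ℝ f y (EuclideanSpace.single i 1)

/-- The coordinate vector field `∂ᵢ` of the chart centred at `c`, at the point with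
coordinates `y`. -/
def frame (c : M) (i : Fin d) (y : EuclideanSpace ℝ (Fin d)) :
    TangentSpace (𝓡 d) ((extChartAt (𝓡 d) c).symm y) :=
  mfderiv 𝓘(ℝ, EuclideanSpace ℝ (Fin d)) (𝓡 d) (extChartAt (𝓡 d) c).symm y
    (EuclideanSpace.single i (1 : ℝ) : EuclideanSpace ℝ (Fin d))

/-- The components `ηᵢ = η(∂ᵢ)` of a one-form. -/
def formCoeff (η : OneForm d M) (c : M) (i : Fin d) (y : EuclideanSpace ℝ (Fin d)) : ℝ :=
  η ((extChartAt (𝓡 d) c).symm y) (frame c i y)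

variable [IsManifold (𝓡 d) ∞ M]

/-- The components `gᵢⱼ = g(∂ᵢ, ∂ⱼ)` of the metric, as a matrix. -/
def metricMatrix (g : Metric d M) (c : M) (y : EuclideanSpace ℝ (Fin d)) :
    Matrix (Fin d) (Fin d) ℝ :=
  Matrix.of fun i j => g.inner ((extChartAt (𝓡 d) c).symm y) (frame c i y) (frame c j y)

/-- The Christoffel symbols
`Γᵏᵢⱼ = ½ ∑ₗ gᵏˡ (∂ᵢ gⱼₗ + ∂ⱼ gᵢₗ - ∂ₗ gᵢⱼ)` of the Levi-Civita connection. -/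
def christoffel (g : Metric d M) (c : M) (k i j : Fin d) (y : EuclideanSpace ℝ (Fin d)) : ℝ :=
  (1 / 2) * ∑ l, (metricMatrix g c y)⁻¹ k l *
    (pd i (fun z => metricMatrix g c z j l) y + pd j (fun z => metricMatrix g c z i l) y
      - pd l (fun z => metricMatrix g c z i j) y)

/-- The components of the Ricci tensor,
`Ricᵢⱼ = ∑ₖ (∂ₖ Γᵏᵢⱼ - ∂ⱼ Γᵏᵢₖ) + ∑ₖₗ (Γᵏₖₗ Γˡᵢⱼ - Γᵏⱼₗ Γˡᵢₖ)`. -/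
def ricci (g : Metric d M) (c : M) (i j : Fin d) (y : EuclideanSpace ℝ (Fin d)) : ℝ :=
  ∑ k, (pd k (christoffel g c k i j) y - pd j (christoffel g c k i k) y)
    + ∑ k, ∑ l, (christoffel g c k k l y * christoffel g c l i j y
      - christoffel g c k j l y * christoffel g c l i k y)

/-- The components of the symmetrized covariant derivative `δ*η`,
`(δ*η)ᵢⱼ = ½ (∂ᵢ ηⱼ + ∂ⱼ ηᵢ) - ∑ₖ Γᵏᵢⱼ ηₖ`. -/
def symCovDeriv (g : Metric d M) (η : OneForm d M) (c : M) (i j : Fin d)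
    (y : EuclideanSpace ℝ (Fin d)) : ℝ :=
  (1 / 2) * (pd i (formCoeff η c j) y + pd j (formCoeff η c i) y)
    - ∑ k, christoffel g c k i j y * formCoeff η c k y

/-- `(M, g, η)` is a Ricci soliton with constant `ε`: the one-form `η` is smooth and
`Ric(g) + δ*η + (ε/2) g = 0`. -/
structure IsRicciSoliton (g : Metric d M) (ε : ℝ) (η : OneForm d M) : Prop where
  smooth : IsSmoothForm η
  equation : ∀ (c : M), ∀ y ∈ (extChartAt (𝓡 d) c).target, ∀ i j : Fin d,
    ricci g c i j y + symCovDeriv g η c i j y + ε / 2 * metricMatrix g c y i j = 0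

/-- `U` is a potential of `η`: a smooth function on `M` with `η = dU`. -/
def IsPotential (U : M → ℝ) (η : OneForm d M) : Prop :=
  ContMDiff (𝓡 d) 𝓘(ℝ, ℝ) ∞ U ∧ ∀ x : M, η x = mvfderiv (𝓡 d) U x

/-- A Ricci soliton of gradient type: a Ricci soliton whose one-form has a potential. -/
def IsGradientRicciSoliton (g : Metric d M) (ε : ℝ) (η : OneForm d M) : Prop :=
  IsRicciSoliton g ε η ∧ ∃ U : M → ℝ, IsPotential U η

/-- The velocity `γ'(t)`. -/
def velocity (d : ℕ) {M : Type*} [TopologicalSpace M]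
    [ChartedSpace (EuclideanSpace ℝ (Fin d)) M] (γ : ℝ → M) (t : ℝ) :
    TangentSpace (𝓡 d) (γ t) :=
  mfderiv 𝓘(ℝ, ℝ) (𝓡 d) γ t (1 : ℝ)

/-- `γ` is a geodesic on the open set `J`: it is smooth there and, in coordinates,
`ẍᵏ + ∑ᵢⱼ Γᵏᵢⱼ(x) ẋⁱ ẋʲ = 0`. -/
structure IsGeodesicOn (g : Metric d M) (γ : ℝ → M) (J : Set ℝ) : Prop where
  smooth : ContMDiffOn 𝓘(ℝ, ℝ) (𝓡 d) ∞ γ J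
  equation : ∀ t ∈ J, ∀ c : M, γ t ∈ (chartAt (EuclideanSpace ℝ (Fin d)) c).source →
    ∀ k : Fin d,
      deriv (deriv fun s => extChartAt (𝓡 d) c (γ s)) t k
        + ∑ i, ∑ j, christoffel g c k i j (extChartAt (𝓡 d) c (γ t))
          * deriv (fun s => extChartAt (𝓡 d) c (γ s)) t i
          * deriv (fun s => extChartAt (𝓡 d) c (γ s)) t j = 0

end Riemannian

/-! ### Isometric actions of cohomogeneity one

`G` is a Lie group of dimension `m` acting smoothly on `M`. -/

section Action

variable {m d : ℕ}
  {G : Type*} [TopologicalSpace G] [ChartedSpace (EuclideanSpace ℝ (Fin m)) G] [Group G]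
  {M : Type*} [TopologicalSpace M] [ChartedSpace (EuclideanSpace ℝ (Fin d)) M] [MulAction G M]

/-- The differential at `p` of the diffeomorphism `x ↦ a • x` of `M`. -/
def dAct (d : ℕ) {G : Type*} [Group G] {M : Type*} [TopologicalSpace M]
    [ChartedSpace (EuclideanSpace ℝ (Fin d)) M] [MulAction G M] (a : G) (p : M) :
    TangentSpace (𝓡 d) p →L[ℝ] TangentSpace (𝓡 d) (a • p) :=
  mfderiv (𝓡 d) (𝓡 d) (fun x : M => a • x) p

/-- The tangent space at `p` of the orbit `G • p`: the image of the differential at `1` of the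
orbit map `a ↦ a • p` (recall that `1 • p = p`). -/
def orbitTangent (m d : ℕ) (G : Type*) [TopologicalSpace G]
    [ChartedSpace (EuclideanSpace ℝ (Fin m)) G] [Group G] {M : Type*} [TopologicalSpace M]
    [ChartedSpace (EuclideanSpace ℝ (Fin d)) M] [MulAction G M] (p : M) :
    Submodule ℝ (TangentSpace (𝓡 d) p) :=
  LinearMap.range
    (mfderiv (𝓡 m) (𝓡 d) (fun a : G => a • p) 1 :
      TangentSpace (𝓡 m) (1 : G) →L[ℝ] TangentSpace (𝓡 d) p).toLinearMap

/-- The action is by isometries of `g`. -/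
def IsIsometricAction [IsManifold (𝓡 d) ∞ M] (G : Type*) [Group G] [MulAction G M]
    (g : Metric d M) : Prop :=
  ∀ (a : G) (p : M) (v w : TangentSpace (𝓡 d) p),
    g.inner (a • p) (dAct d a p v) (dAct d a p w) = g.inner p v w

/-- The one-form `η` is `G`-invariant. -/
def IsInvariantForm (G : Type*) [Group G] [MulAction G M] (η : OneForm d M) : Prop :=
  ∀ (a : G) (p : M) (v : TangentSpace (𝓡 d) p), η (a • p) (dAct d a p v) = η p v

/-- The set of points whose isotropy group is conjugate to `K`. -/
def orbitType (M : Type*) {G : Type*} [Group G] [MulAction G M] (K : Subgroup G) : Set M :=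
  {p | ∃ a : G, MulAction.stabilizer G p = K.map (MulAut.conj a).toMonoidHom}

/-- `G` acts on `(M, g)` isometrically with cohomogeneity one, with principal isotropy group `K`,
and the orbit space is not a circle.  The principal orbit type is the orbit type whose points
form an open dense set `M₀ = orbitType M K`; its orbits have codimension one. -/
structure IsCohomogeneityOne (m : ℕ) {d : ℕ} {G : Type*} [TopologicalSpace G]
    [ChartedSpace (EuclideanSpace ℝ (Fin m)) G] [Group G] {M : Type*} [TopologicalSpace M]
    [ChartedSpace (EuclideanSpace ℝ (Fin d)) M] [IsManifold (𝓡 d) ∞ M] [MulAction G M]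
    (g : Metric d M) (K : Subgroup G) : Prop where
  isometric : IsIsometricAction G g
  isOpen_principal : IsOpen (orbitType M K)
  dense_principal : Dense (orbitType M K)
  codim_one : ∀ p ∈ orbitType M K, Module.finrank ℝ (orbitTangent m d G p) + 1 = d
  not_circle : ¬ Nonempty (Quotient (MulAction.orbitRel G M) ≃ₜ Circle)

/-- `γ`, defined on the open interval `J`, is a unit speed geodesic which runs through the
principal orbits, intersects them orthogonally, and meets every principal orbit exactly once. -/
structure IsNormalGeodesic (m : ℕ) {d : ℕ} {G : Type*} [TopologicalSpace G]
    [ChartedSpace (EuclideanSpace ℝ (Fin m)) G] [Group G] {M : Type*} [TopologicalSpace M]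
    [ChartedSpace (EuclideanSpace ℝ (Fin d)) M] [IsManifold (𝓡 d) ∞ M] [MulAction G M]
    (g : Metric d M) (K : Subgroup G) (γ : ℝ → M) (J : Set ℝ) : Prop where
  isOpen : IsOpen J
  ordConnected : J.OrdConnected
  geodesic : IsGeodesicOn g γ J
  unit_speed : ∀ t ∈ J, g.inner (γ t) (velocity d γ t) (velocity d γ t) = 1
  orthogonal : ∀ t ∈ J, ∀ w ∈ orbitTangent m d G (γ t), g.inner (γ t) (velocity d γ t) w = 0
  mem_principal : ∀ t ∈ J, γ t ∈ orbitType M K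
  existsUnique : ∀ p ∈ orbitType M K, ∃! t : ℝ, t ∈ J ∧ γ t ∈ MulAction.orbit G p

/-- The coordinate function `t` on `M₀`: its value at `p` is the parameter at which `γ`
meets the orbit of `p`.  Equivalently, it is the first component of the inverse of
`(t, aK) ↦ a • γ t`. -/
def orbitCoord (G : Type*) [Group G] {M : Type*} [MulAction G M] (γ : ℝ → M) (J : Set ℝ)
    (p : M) : ℝ :=
  Classical.epsilon fun t : ℝ => t ∈ J ∧ γ t ∈ MulAction.orbit G p

/-- The isotropy representation at `p` of `G_p` on the tangent space of the orbit through `p` has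
no trivial irreducible summand: only the zero vector is fixed by `G_p`.  (For `k ∈ G_p` the
differential of `k` is an endomorphism of the tangent space at `k • p = p`.) -/
def HasNoTrivialSummand (m d : ℕ) (G : Type*) [TopologicalSpace G]
    [ChartedSpace (EuclideanSpace ℝ (Fin m)) G] [Group G] {M : Type*} [TopologicalSpace M]
    [ChartedSpace (EuclideanSpace ℝ (Fin d)) M] [MulAction G M] (p : M) : Prop :=
  ∀ v ∈ orbitTangent m d G p,
    (∀ k ∈ MulAction.stabilizer G p, (dAct d k p v : TangentSpace (𝓡 d) p) = v) → v = 0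

/-- There is a special (that is, non-principal) orbit at `t = 0`: the number `0` is an endpoint of
`J`, and as `t → 0` the curve `γ` converges to a point outside the principal part. -/
def HasSpecialOrbitAtZero {G : Type*} [Group G] {M : Type*} [TopologicalSpace M] [MulAction G M]
    (K : Subgroup G) (γ : ℝ → M) (J : Set ℝ) : Prop :=
  0 ∈ closure J ∧ ∃ p : M, p ∉ orbitType M K ∧ Tendsto γ (𝓝[J] 0) (𝓝 p)

/-- A function on the open interval `J` with endpoint `0` is (smoothly) even: it is the restriction
of a smooth even function on `J ∪ {0} ∪ -J`. -/
def IsSmoothEven (u : ℝ → ℝ) (J : Set ℝ) : Prop :=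
  ∃ v : ℝ → ℝ, ContDiffOn ℝ ∞ v {t | t ∈ J ∨ t = 0 ∨ -t ∈ J} ∧ (∀ t, v (-t) = v t) ∧
    EqOn v u J

end Action

end CohomOne

end

/-! Write `t` for `orbitCoord`. By orthogonality and codimension one, `(a, s) ↦ a • γ s` is a
submersion at points `(1, s)`, so `t` is smooth near `γ` and, by invariance, on the principal part.
Splitting vectors into orbit and normal directions gives `dt(v)² ≤ g(v, v)`.

(1) At a principal point the vector representing `η` on the orbit tangent space is fixed by the
isotropy group, since the action preserves both `g` and `η`; hence it is zero. So `η = f(t) dt`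
there, with `f(s) = η(γ'(s))`, and `F ∘ t` is a potential when `F' = f`. It has to be carried across
the non-principal orbits.

Let `q` be non-principal and let `r(s)` be the chart distance from `q` to the orbit of `γ s`. Moving
radially towards `q` lowers `r` while `t` changes at a comparable rate at most
(`IsNormalGeodesic.descends`). Hence `r` has no small local minimum, and near `q` the coordinate `t`
is near an end of `J`. Consequently there are at most two non-principal orbits, each a limit of
principal ones at an end of `J`. If both ends led to the same orbit, the orbit space would be a
circle; so `t` converges at `q` to a single end (`tendsto_orbitCoord`). Near that end `f` is
bounded, by invariance and unit speed, so `F` has a limit and `F ∘ t` extends to a continuous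
function `h`.

To see that `h` is a potential of `η` (`exists_isPotential_of_dense`): `dη = 0` by density, so `η =
dV` on a coordinate ball. There `h - V` is locally constant on the principal part, and on each
remaining orbit it is locally constant as a function of the group element. It therefore takes
countably many values on a connected set, so it is constant.

(2) Invariance gives `U = u ∘ t` with `u = U ∘ γ`. For evenness at a special point `p`, the geodesic
equation has a bounded right-hand side near `p`, so `γ` has a limit velocity `w` there, a unit
vector orthogonal to the orbit. Choose principal points approaching `p` in the direction `-w` and
write them as group translates of points of `γ`. By compactness the group elements accumulate at
some `a`, which fixes `p`. A map `Y` that is constant on the orbit near `p`, with differential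
vanishing exactly on its tangent space (`exists_transversal`), shows that a combination `α w + (1 -
α) w'` is tangent to the orbit, where `w'` is the limit velocity of `a • γ`. Orthogonality and unit
length force `w' = -w`. The geodesic equation is even in the velocity, so `γ` and `a • γ` join to a
curve smooth through `p`, along which `U` is smooth and even. -/

set_option linter.unusedSectionVars false

noncomputable section

namespace CohomOne

/-! ### Ordinary differential equations and descent functions on an interval -/

section Analysis

/-- Solutions of smooth autonomous differential equations are smooth. -/
theorem contDiffOn_of_hasDerivAt_autonomous {E : Type*} [NormedAddCommGroup E] [NormedSpace ℝ E]
    {B : E → E} {Ω : Set E} (hB : ContDiffOn ℝ ∞ B Ω) {X : ℝ → E} {I : Set ℝ} (hI : IsOpen I)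
    (hXΩ : MapsTo X I Ω) (hX : ∀ t ∈ I, HasDerivAt X (B (X t)) t) : ContDiffOn ℝ ∞ X I := by
  rw [contDiffOn_infty]
  intro n
  induction n with
  | zero =>
    exact contDiffOn_zero.2 fun t ht => (hX t ht).continuousAt.continuousWithinAt
  | succ n ih =>
    push_cast
    rw [contDiffOn_succ_iff_deriv_of_isOpen hI]
    refine ⟨fun t ht => (hX t ht).differentiableAt.differentiableWithinAt, by simp, ?_⟩
    refine ((hB.of_le (by exact_mod_cast le_top)).comp ih hXΩ).congr fun t ht => ?_
    exact (hX t ht).deriv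

/-- A function that is continuous at `a` and differentiable near `a` except at `a`, with
derivative having a limit at `a`, is differentiable at `a`. -/
theorem hasDerivAt_of_eventually_ne {E : Type*} [NormedAddCommGroup E] [NormedSpace ℝ E]
    {f f' : ℝ → E} {a : ℝ} (hf : ∀ᶠ t in 𝓝[≠] a, HasDerivAt f (f' t) t) (hc : ContinuousAt f a)
    (hc' : ContinuousAt f' a) : HasDerivAt f (f' a) a := by
  have hlim : Tendsto f' (𝓝[≠] a) (𝓝 (f' a)) := hc'.mono_left nhdsWithin_le_nhds
  have hr : ∀ᶠ t in 𝓝[>] a, HasDerivAt f (f' t) t :=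
    hf.filter_mono (nhdsWithin_mono _ fun t ht => ne_of_gt ht)
  have hl : ∀ᶠ t in 𝓝[<] a, HasDerivAt f (f' t) t :=
    hf.filter_mono (nhdsWithin_mono _ fun t ht => ne_of_lt ht)
  have h1 : HasDerivWithinAt f (f' a) (Ici a) a := by
    refine hasDerivWithinAt_Ici_of_tendsto_deriv (s := {t | HasDerivAt f (f' t) t} ∩ Ioi a)
      (fun t ht => ht.1.differentiableAt.differentiableWithinAt) hc.continuousWithinAt
      (inter_mem hr self_mem_nhdsWithin) ?_
    refine Tendsto.congr' ?_ (hlim.mono_left (nhdsWithin_mono _ fun t ht => ne_of_gt ht))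
    filter_upwards [hr] with t ht using ht.deriv.symm
  have h2 : HasDerivWithinAt f (f' a) (Iic a) a := by
    refine hasDerivWithinAt_Iic_of_tendsto_deriv (s := {t | HasDerivAt f (f' t) t} ∩ Iio a)
      (fun t ht => ht.1.differentiableAt.differentiableWithinAt) hc.continuousWithinAt
      (inter_mem hl self_mem_nhdsWithin) ?_
    refine Tendsto.congr' ?_ (hlim.mono_left (nhdsWithin_mono _ fun t ht => ne_of_lt ht))
    filter_upwards [hl] with t ht using ht.deriv.symm
  simpa using h2.union h1

/-- A `C¹` curve that solves a smooth second order differential equation except at one point is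
smooth. -/
theorem contDiffOn_of_second_order_ne {E : Type*} [NormedAddCommGroup E] [NormedSpace ℝ E]
    {A : E × E → E} {Ω : Set E} (hΩ : IsOpen Ω) (hA : ContDiffOn ℝ ∞ A (Ω ×ˢ univ))
    {x x' : ℝ → E} {I : Set ℝ} (hI : IsOpen I) (hxΩ : MapsTo x I Ω) {a : ℝ}
    (hx : ∀ t ∈ I, t ≠ a → HasDerivAt x (x' t) t)
    (hx' : ∀ t ∈ I, t ≠ a → HasDerivAt x' (A (x t, x' t)) t)
    (hc : ContinuousAt x a) (hc' : ContinuousAt x' a) : ContDiffOn ℝ ∞ x I := by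
  -- On phase space the equation is autonomous of first order; continuity of the right-hand side
  -- along the curve recovers the derivative at the exceptional point.
  have hB : ContDiffOn ℝ ∞ (fun X : E × E => (X.2, A X)) (Ω ×ˢ univ) :=
    contDiff_snd.contDiffOn.prodMk hA
  have hX : ∀ t ∈ I, HasDerivAt (fun t => (x t, x' t)) (x' t, A (x t, x' t)) t := by
    intro t ht
    by_cases hta : t = a
    · subst hta
      have hXc : ContinuousAt (fun t => (x t, x' t)) t := hc.prodMk hc'
      have hAc : ContinuousAt A (x t, x' t) := (hA.continuousOn).continuousAt
        ((hΩ.prod isOpen_univ).mem_nhds ⟨hxΩ ht, trivial⟩)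
      refine hasDerivAt_of_eventually_ne (f' := fun t => (x' t, A (x t, x' t))) ?_ hXc
        (hc'.prodMk (ContinuousAt.comp (f := fun t => (x t, x' t)) hAc hXc))
      filter_upwards [self_mem_nhdsWithin, nhdsWithin_le_nhds (hI.mem_nhds ht)] with s hs hsI
      exact (hx s hsI hs).prodMk (hx' s hsI hs)
    · exact (hx t ht hta).prodMk (hx' t ht hta)
  have := contDiffOn_of_hasDerivAt_autonomous hB hI (X := fun t => (x t, x' t))
    (fun t ht => ⟨hxΩ ht, trivial⟩) hX
  exact contDiff_fst.comp_contDiffOn this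

/-- The descent property: near every parameter `s` with `r s < δ` there are parameters where `r`
is smaller at a rate of at least `1 / C`. -/
def Descends (J : Set ℝ) (r : ℝ → ℝ) (δ C : ℝ) : Prop :=
  ∀ s ∈ J, r s < δ → ∀ ρ > 0, ∃ s' ∈ J, s' ≠ s ∧ |s' - s| < ρ ∧ r s' ≤ r s - |s' - s| / C

/-- A variational argument in the style of Ekeland: penalise `r` by `|s - s₀| / (2 * C)`, at half
the guaranteed descent rate. If a large interval around `s₀` lay in `J`, the penalised function
would have a minimiser from which one can still descend. -/
theorem Descends.exists_notMem_near {J : Set ℝ} {r : ℝ → ℝ} {δ C : ℝ} (h : Descends J r δ C)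
    (hC : 0 < C) (hr : ContinuousOn r J) (hpos : ∀ s ∈ J, 0 < r s) {s₀ : ℝ} (hs₀ : s₀ ∈ J)
    (hδ : r s₀ < δ) : ∃ b, b ∉ J ∧ |s₀ - b| ≤ 3 * C * r s₀ := by
  by_contra! hcon
  have h0 := hpos s₀ hs₀
  have hL : 0 < 3 * C * r s₀ := by positivity
  have hsub : Icc (s₀ - 3 * C * r s₀) (s₀ + 3 * C * r s₀) ⊆ J := by
    intro s hs
    by_contra hsJ
    have := hcon s hsJ
    rw [lt_abs] at this
    rcases this with h | h <;> linarith [hs.1, hs.2]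
  obtain ⟨t, ht, hmin⟩ := isCompact_Icc.exists_isMinOn (f := fun s => r s + |s - s₀| / (2 * C))
    ⟨s₀, by constructor <;> linarith⟩
    ((hr.mono hsub).add (by fun_prop))
  have h1 := hmin (show s₀ ∈ Icc (s₀ - 3 * C * r s₀) (s₀ + 3 * C * r s₀) by
    constructor <;> linarith)
  simp only [mem_ofPred_eq, sub_self, abs_zero, zero_div, add_zero] at h1
  have htpos := hpos t (hsub ht)
  -- The minimiser stays within `2 * C * r s₀` of `s₀`; the remaining radius leaves room for one
  -- descent step shorter than `C * r s₀`.
  have h2 : |t - s₀| < 2 * C * r s₀ := by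
    have : |t - s₀| / (2 * C) < r s₀ := by linarith
    rw [div_lt_iff₀ (by positivity)] at this
    linarith
  have h3 : 0 ≤ |t - s₀| / (2 * C) := by positivity
  obtain ⟨s', hs'J, hne, hnear, hdes⟩ := h t (hsub ht) (by linarith) (C * r s₀) (by positivity)
  have hs' : s' ∈ Icc (s₀ - 3 * C * r s₀) (s₀ + 3 * C * r s₀) := by
    rw [abs_lt] at h2 hnear
    constructor <;> linarith
  have h4 := hmin hs'
  simp only [mem_ofPred_eq] at h4
  have h5 : |s' - s₀| ≤ |s' - t| + |t - s₀| := abs_sub_le _ _ _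
  have h6 : 0 < |s' - t| := abs_pos.2 (sub_ne_zero.2 hne)
  have h7 : |s' - s₀| / (2 * C) ≤ |s' - t| / (2 * C) + |t - s₀| / (2 * C) := by
    rw [← add_div]; gcongr
  have h8 : |s' - t| / C = 2 * (|s' - t| / (2 * C)) := by field_simp
  have h9 : 0 < |s' - t| / (2 * C) := by positivity
  linarith

/-- Descent forbids interior minima below `δ`, so `r` cannot be large, then small, then large again
on the way to `b`. Small values arbitrarily near `b` therefore make `r` small everywhere near `b`.
-/
theorem Descends.eventually_lt {J : Set ℝ} (hJ : J.OrdConnected) {r : ℝ → ℝ} {δ C : ℝ}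
    (h : Descends J r δ C) (hC : 0 < C) (hδ : 0 < δ) (hr : ContinuousOn r J) {b : ℝ} (hb : b ∉ J)
    (hcl : ∀ ρ > 0, ∃ s ∈ J, |s - b| < ρ ∧ r s < ρ) {ρ : ℝ} (hρ : 0 < ρ) :
    ∀ᶠ s in 𝓝[J] b, r s < ρ := by
  wlog hρδ : ρ ≤ δ generalizing ρ
  · filter_upwards [this hδ le_rfl] with s hs
    exact hs.trans (not_le.1 hρδ)
  by_contra hcon
  have hfr : ∃ᶠ s in 𝓝[J] b, ρ ≤ r s := by
    simpa only [not_lt] using Filter.not_eventually.1 hcon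
  have hget : ∀ ρ' > 0, ∃ s ∈ J, |s - b| < ρ' ∧ ρ ≤ r s := by
    intro ρ' hρ'
    have : ∀ᶠ s in 𝓝[J] b, |s - b| < ρ' :=
      nhdsWithin_le_nhds (Metric.ball_mem_nhds b hρ')
    obtain ⟨s, hs, hs', hsJ⟩ := (hfr.and_eventually (this.and self_mem_nhdsWithin)).exists
    exact ⟨s, hsJ, hs', hs⟩
  have hdist : ∀ s ∈ J, 0 < |s - b| := fun s hs =>
    abs_pos.2 (sub_ne_zero.2 fun h => hb (h ▸ hs))
  -- Three parameters ever closer to `b`, with `r` large, small, large. They lie on one side of `b`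
  -- since `b ∉ J`, so `u` is between `s₁` and `s₂`.
  obtain ⟨s₁, hs₁, -, hr₁⟩ := hget 1 one_pos
  obtain ⟨u, hu, hub, hru⟩ := hcl (min |s₁ - b| ρ) (lt_min (hdist s₁ hs₁) hρ)
  obtain ⟨s₂, hs₂, hsb, hr₂⟩ := hget |u - b| (hdist u hu)
  have hub' := hub.trans_le (min_le_left _ _)
  have hru' := hru.trans_le (min_le_right _ _)
  have hside : ∀ x ∈ J, ∀ y ∈ J, x < b → b < y → False := fun x hx y hy hxb hby =>
    hb (hJ.out hx hy ⟨hxb.le, hby.le⟩)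
  have hne : ∀ x ∈ J, x < b ∨ b < x := fun x hx =>
    lt_or_gt_of_ne fun h => hb (h ▸ hx)
  have hbetween : u ∈ uIcc s₁ s₂ := by
    rcases hne u hu with hu' | hu'
    · have h1 : s₁ < b := (hne s₁ hs₁).resolve_right fun h => hside u hu s₁ hs₁ hu' h
      have h2 : s₂ < b := (hne s₂ hs₂).resolve_right fun h => hside u hu s₂ hs₂ hu' h
      rw [abs_of_neg (by linarith), abs_of_neg (by linarith)] at hub' hsb
      rw [uIcc_of_le (by linarith)]
      constructor <;> linarith
    · have h1 : b < s₁ := (hne s₁ hs₁).resolve_left fun h => hside s₁ hs₁ u hu h hu'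
      have h2 : b < s₂ := (hne s₂ hs₂).resolve_left fun h => hside s₂ hs₂ u hu h hu'
      rw [abs_of_pos (by linarith), abs_of_pos (by linarith)] at hub' hsb
      rw [uIcc_of_ge (by linarith)]
      constructor <;> linarith
  have hsub : uIcc s₁ s₂ ⊆ J := hJ.uIcc_subset hs₁ hs₂
  obtain ⟨t, ht, hmin⟩ := isCompact_uIcc.exists_isMinOn ⟨u, hbetween⟩ (hr.mono hsub)
  have htu : r t ≤ r u := hmin hbetween
  have ht' : t ∈ Ioo (min s₁ s₂) (max s₁ s₂) := by
    have ht1 : t ≠ s₁ := by rintro rfl; linarith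
    have ht2 : t ≠ s₂ := by rintro rfl; linarith
    rw [uIcc, mem_Icc] at ht
    refine ⟨lt_of_le_of_ne ht.1 fun h => ?_, lt_of_le_of_ne ht.2 fun h => ?_⟩
    · rcases min_choice s₁ s₂ with h' | h' <;> rw [h'] at h <;> simp_all
    · rcases max_choice s₁ s₂ with h' | h' <;> rw [h'] at h <;> simp_all
  obtain ⟨ρ', hρ', hball⟩ := Metric.isOpen_iff.1 isOpen_Ioo t ht'
  obtain ⟨s', hs'J, hne', hnear, hdes⟩ := h t (hsub ht) (by linarith) ρ' hρ'
  have hs' : s' ∈ uIcc s₁ s₂ := Ioo_subset_Icc_self (hball hnear)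
  have h1 : r t ≤ r s' := hmin hs'
  have h2 : 0 < |s' - t| / C := div_pos (abs_pos.2 (sub_ne_zero.2 hne')) hC
  linarith

end Analysis

/-! ### Local sections of submersions -/

section LocalSection

/-- A smooth map with surjective differential at a point has a smooth local right inverse. -/
theorem ContDiffAt.exists_local_rightInverse {E F : Type*} [NormedAddCommGroup E]
    [NormedSpace ℝ E] [NormedAddCommGroup F] [NormedSpace ℝ F] [FiniteDimensional ℝ F]
    {f : E → F} {x : E} (hf : ContDiffAt ℝ ∞ f x)
    (hsurj : Function.Surjective (fderiv ℝ f x)) :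
    ∃ σ : F → E, ContDiffAt ℝ ∞ σ (f x) ∧ σ (f x) = x ∧ ∀ᶠ y in 𝓝 (f x), f (σ y) = y := by
  have : CompleteSpace F := FiniteDimensional.complete ℝ F
  obtain ⟨L, hL⟩ := (fderiv ℝ f x).toLinearMap.exists_rightInverse_of_surjective
    (LinearMap.range_eq_top.2 hsurj)
  set L' : F →L[ℝ] E := L.toContinuousLinearMap
  have hLv : ∀ v, fderiv ℝ f x (L' v) = v := fun v => LinearMap.congr_fun hL v
  have hbase : x + L' 0 = x := by simp
  -- On the affine slice through `x` spanned by a linear right inverse the differential becomes the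
  -- identity, so the inverse function theorem applies.
  have hg : ContDiffAt ℝ ∞ (fun v => f (x + L' v)) 0 := by
    refine ContDiffAt.comp 0 (g := f) (by rwa [hbase]) ?_
    exact contDiffAt_const.add L'.contDiff.contDiffAt
  have hg' : HasFDerivAt (fun v => f (x + L' v))
      ((ContinuousLinearEquiv.refl ℝ F : F ≃L[ℝ] F) : F →L[ℝ] F) 0 := by
    have h1 : HasFDerivAt f (fderiv ℝ f x) (x + L' 0) := by
      rw [hbase]; exact (hf.differentiableAt (by simp)).hasFDerivAt
    have h2 : HasFDerivAt (fun v => x + L' v) L' 0 := L'.hasFDerivAt.const_add x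
    convert! h1.comp 0 h2 using 1
    ext v; simp [hLv]
  have hn : (∞ : ℕ∞ω) ≠ 0 := by simp
  refine ⟨fun y => x + L' (hg.localInverse hg' hn y), ?_, ?_, ?_⟩
  · have := hg.to_localInverse hg' hn
    simp only [hbase] at this
    exact contDiffAt_const.add (L'.contDiff.contDiffAt.comp _ this)
  · have := hg.localInverse_apply_image hg' hn
    simp only [hbase] at this
    simp [this]
  · have := (hg.hasStrictFDerivAt' hg' hn).eventually_right_inverse
    simp only [hbase] at this
    exact this

variable {E F : Type*} [NormedAddCommGroup E] [NormedSpace ℝ E] [NormedAddCommGroup F]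
  [NormedSpace ℝ F] [FiniteDimensional ℝ F]
  {H H' : Type*} [TopologicalSpace H] [TopologicalSpace H']
  {I : ModelWithCorners ℝ E H} {I' : ModelWithCorners ℝ F H'} [I.Boundaryless] [I'.Boundaryless]
  {N M : Type*} [TopologicalSpace N] [ChartedSpace H N] [TopologicalSpace M] [ChartedSpace H' M]
  [IsManifold I ∞ N] [IsManifold I' ∞ M]

/-- A smooth map between manifolds with surjective differential at a point has a smooth local
right inverse. -/
theorem ContMDiffAt.exists_local_rightInverse {f : N → M} {x : N}
    (hf : ContMDiffAt I I' ∞ f x) (hsurj : Function.Surjective (mfderiv I I' f x)) :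
    ∃ σ : M → N, ContMDiffAt I' I ∞ σ (f x) ∧ σ (f x) = x ∧ ∀ᶠ y in 𝓝 (f x), f (σ y) = y := by
  have hd := hf.mdifferentiableAt (by simp : (∞ : ℕ∞ω) ≠ 0)
  rw [hd.mfderiv, I.range_eq_univ, fderivWithin_univ] at hsurj
  have hcd := (contMDiffAt_iff.1 hf).2
  rw [I.range_eq_univ, contDiffWithinAt_univ] at hcd
  obtain ⟨σ, hσ, hσx, hσr⟩ := ContDiffAt.exists_local_rightInverse hcd hsurj
  have hfx : (extChartAt I' (f x) ∘ f ∘ (extChartAt I x).symm) (extChartAt I x x)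
      = extChartAt I' (f x) (f x) := by simp
  rw [hfx] at hσ hσx hσr
  have hκ : ContMDiffAt I' 𝓘(ℝ, F) ∞ (extChartAt I' (f x)) (f x) := contMDiffAt_extChartAt
  have hχ : ContMDiffAt 𝓘(ℝ, E) I ∞ (extChartAt I x).symm (extChartAt I x x) :=
    (contMDiffOn_extChartAt_symm x).contMDiffAt (extChartAt_target_mem_nhds x)
  have hσκ : ContMDiffAt I' 𝓘(ℝ, E) ∞ (σ ∘ extChartAt I' (f x)) (f x) :=
    ContMDiffAt.comp (f x) hσ.contMDiffAt hκ
  have hval : (σ ∘ extChartAt I' (f x)) (f x) = extChartAt I x x := hσx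
  have hσ' : ContMDiffAt I' I ∞ ((extChartAt I x).symm ∘ σ ∘ extChartAt I' (f x)) (f x) :=
    ContMDiffAt.comp (f x) (by rwa [hval]) hσκ
  refine ⟨(extChartAt I x).symm ∘ σ ∘ extChartAt I' (f x), hσ', ?_, ?_⟩
  · rw [Function.comp_apply, hval, extChartAt_to_inv]
  · have hval' : ((extChartAt I x).symm ∘ σ ∘ extChartAt I' (f x)) (f x) = x := by
      rw [Function.comp_apply, hval, extChartAt_to_inv]
    -- The right-inverse identity is known only after the target chart is applied; membership in its
    -- source lets the chart be cancelled.
    have h1 : ∀ᶠ y in 𝓝 (f x), f (((extChartAt I x).symm ∘ σ ∘ extChartAt I' (f x)) y)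
        ∈ (extChartAt I' (f x)).source := by
      refine ContinuousAt.eventually_mem (f := fun y =>
        f (((extChartAt I x).symm ∘ σ ∘ extChartAt I' (f x)) y)) ?_ ?_
      · exact ContinuousAt.comp (by rw [hval']; exact hf.continuousAt) hσ'.continuousAt
      · rw [hval']; exact extChartAt_source_mem_nhds (f x)
    have h2 := (continuousAt_extChartAt (I := I') (f x)).eventually hσr
    filter_upwards [h1, h2, extChartAt_source_mem_nhds (I := I') (f x)] with y hy1 hy2 hy3
    exact (extChartAt I' (f x)).injOn hy1 hy3 hy2

end LocalSection

/-! ### The chain rule over an equation of base points -/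

section Composition

variable {E E' E'' : Type*} [NormedAddCommGroup E] [NormedSpace ℝ E] [NormedAddCommGroup E']
  [NormedSpace ℝ E'] [NormedAddCommGroup E''] [NormedSpace ℝ E'']
  {H H' H'' : Type*} [TopologicalSpace H] [TopologicalSpace H'] [TopologicalSpace H'']
  {I : ModelWithCorners ℝ E H} {I' : ModelWithCorners ℝ E' H'} {I'' : ModelWithCorners ℝ E'' H''}
  {N N' N'' : Type*} [TopologicalSpace N] [ChartedSpace H N] [TopologicalSpace N']
  [ChartedSpace H' N'] [TopologicalSpace N''] [ChartedSpace H'' N'']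

/-- The chain rule at a point `x` with `f x = y`, tangent spaces being identified with the model
space. -/
theorem mfderiv_comp_apply_of_base_eq {g : N' → N''} {f : N → N'} {x : N} {y : N'}
    (hg : MDifferentiableAt I' I'' g y) (hf : MDifferentiableAt I I' f x) (hy : f x = y)
    (v : E) : (mfderiv I I'' (g ∘ f) x v : E'') = mfderiv I' I'' g y (mfderiv I I' f x v : E') := by
  subst hy
  exact mfderiv_comp_apply x hg hf v

end Composition

/-! ### Differentials of the action and orbit tangent spaces -/

section Action

variable {m d : ℕ}
  {G : Type*} [TopologicalSpace G] [ChartedSpace (EuclideanSpace ℝ (Fin m)) G] [Group G]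
  [LieGroup (𝓡 m) ∞ G]
  {M : Type*} [TopologicalSpace M] [ChartedSpace (EuclideanSpace ℝ (Fin d)) M]
  [IsManifold (𝓡 d) ∞ M] [MulAction G M] [ContMDiffSMul (𝓡 m) (𝓡 d) ∞ G M]

theorem contMDiff_smul_left (m : ℕ) {d : ℕ} {G : Type*} [TopologicalSpace G]
    [ChartedSpace (EuclideanSpace ℝ (Fin m)) G] [Group G] {M : Type*} [TopologicalSpace M]
    [ChartedSpace (EuclideanSpace ℝ (Fin d)) M] [MulAction G M]
    [ContMDiffSMul (𝓡 m) (𝓡 d) ∞ G M] (a : G) :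
    ContMDiff (𝓡 d) (𝓡 d) ∞ (fun x : M => a • x) :=
  ContMDiffSMul.contMDiff_const_smul (I := 𝓡 m) a

theorem contMDiff_orbitMap (p : M) : ContMDiff (𝓡 m) (𝓡 d) ∞ (fun a : G => a • p) :=
  contMDiff_id.smul contMDiff_const

/-- The action of a group element as a diffeomorphism. -/
def smulDiffeo (m : ℕ) {d : ℕ} {G : Type*} [TopologicalSpace G]
    [ChartedSpace (EuclideanSpace ℝ (Fin m)) G] [Group G] {M : Type*} [TopologicalSpace M]
    [ChartedSpace (EuclideanSpace ℝ (Fin d)) M] [MulAction G M]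
    [ContMDiffSMul (𝓡 m) (𝓡 d) ∞ G M] (a : G) : M ≃ₘ^∞⟮𝓡 d, 𝓡 d⟯ M where
  toEquiv := MulAction.toPerm a
  contMDiff_toFun := contMDiff_smul_left m a
  contMDiff_invFun := contMDiff_smul_left m a⁻¹

/-- The differential of the action of a group element as a linear equivalence. -/
def dActEquiv (m : ℕ) {d : ℕ} {G : Type*} [TopologicalSpace G]
    [ChartedSpace (EuclideanSpace ℝ (Fin m)) G] [Group G] {M : Type*} [TopologicalSpace M]
    [ChartedSpace (EuclideanSpace ℝ (Fin d)) M] [MulAction G M]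
    [ContMDiffSMul (𝓡 m) (𝓡 d) ∞ G M] (a : G) (p : M) :
    TangentSpace (𝓡 d) p ≃L[ℝ] TangentSpace (𝓡 d) (a • p) :=
  (smulDiffeo m a).mfderivToContinuousLinearEquiv (by simp) p

theorem dActEquiv_apply (a : G) (p : M) (v : TangentSpace (𝓡 d) p) :
    dActEquiv m a p v = dAct d a p v := rfl

/-- Differentiate `a • (b • p) = (a * b * a⁻¹) • (a • p)` with respect to `b` at `1`. -/
theorem map_dAct_orbitTangent_le (a : G) (p : M) :
    (orbitTangent m d G p).map (dAct d a p).toLinearMap ≤ orbitTangent m d G (a • p) := by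
  rintro _ ⟨_, ⟨X, rfl⟩, rfl⟩
  have hconj : ContMDiff (𝓡 m) (𝓡 m) ∞ (fun b : G => a * b * a⁻¹) :=
    (contMDiff_const.mul contMDiff_id).mul contMDiff_const
  have h1 : a * 1 * a⁻¹ = 1 := by simp
  have hfun : (fun x : M => a • x) ∘ (fun b : G => b • p)
      = (fun b : G => b • (a • p)) ∘ (fun b : G => a * b * a⁻¹) := by
    ext b; simp [smul_smul]
  have hL := mfderiv_comp_apply_of_base_eq (I := 𝓡 m) (I' := 𝓡 d) (I'' := 𝓡 d) (x := (1 : G))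
    (y := p) (f := fun b : G => b • p) (g := fun x : M => a • x)
    ((contMDiff_smul_left m a).mdifferentiable (by simp) _)
    ((contMDiff_orbitMap p).mdifferentiable (by simp) _) (one_smul G p) X
  have hR := mfderiv_comp_apply_of_base_eq (I := 𝓡 m) (I' := 𝓡 m) (I'' := 𝓡 d) (x := (1 : G))
    (y := (1 : G)) (f := fun b : G => a * b * a⁻¹) (g := fun b : G => b • (a • p))
    ((contMDiff_orbitMap (a • p)).mdifferentiable (by simp) _)
    (hconj.mdifferentiable (by simp) _) h1 X
  exact ⟨mfderiv (𝓡 m) (𝓡 m) (fun b : G => a * b * a⁻¹) 1 X, by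
    rw [hfun] at hL; exact hR.symm.trans hL⟩

theorem finrank_orbitTangent_smul (a : G) (p : M) :
    Module.finrank ℝ (orbitTangent m d G (a • p)) = Module.finrank ℝ (orbitTangent m d G p) := by
  have key : ∀ (a : G) (p : M), Module.finrank ℝ (orbitTangent m d G p) ≤
      Module.finrank ℝ (orbitTangent m d G (a • p)) := by
    intro a p
    have : FiniteDimensional ℝ (TangentSpace (𝓡 d) (a • p)) :=
      inferInstanceAs (FiniteDimensional ℝ (EuclideanSpace ℝ (Fin d)))
    have h1 := Submodule.finrank_mono (map_dAct_orbitTangent_le (m := m) (d := d) a p)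
    rwa [(LinearEquiv.finrank_eq (Submodule.equivMapOfInjective _ ?_ _)).symm] at h1
    exact (dActEquiv m a p).injective
  refine le_antisymm ?_ (key a p)
  have h := key a⁻¹ (a • p)
  rwa [inv_smul_smul] at h

end Action

/-! ### The orbit coordinate on the principal part -/

section Coordinate

variable {n m : ℕ}
  {M : Type*} [TopologicalSpace M]
  [ChartedSpace (EuclideanSpace ℝ (Fin (n + 1))) M] [IsManifold (𝓡 (n + 1)) ∞ M]
  {G : Type*} [TopologicalSpace G]
  [ChartedSpace (EuclideanSpace ℝ (Fin m)) G] [Group G] [LieGroup (𝓡 m) ∞ G]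
  [MulAction G M] [ContMDiffSMul (𝓡 m) (𝓡 (n + 1)) ∞ G M]
  {g : Metric (n + 1) M} {K : Subgroup G} {γ : ℝ → M} {J : Set ℝ}

theorem smul_mem_orbitType {M G : Type*} [Group G] [MulAction G M] {K : Subgroup G} {p : M}
    (hp : p ∈ orbitType M K) (a : G) : a • p ∈ orbitType M K := by
  obtain ⟨b, hb⟩ := hp
  refine ⟨a * b, ?_⟩
  rw [MulAction.stabilizer_smul_eq_stabilizer_map_conj, hb, Subgroup.map_map]
  congr 1
  ext x
  simp

namespace IsNormalGeodesic

variable (hγ : IsNormalGeodesic m g K γ J)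
include hγ

theorem orbitCoord_mem {p : M} (hp : p ∈ orbitType M K) : orbitCoord G γ J p ∈ J :=
  (Classical.epsilon_spec (hγ.existsUnique p hp).exists).1

theorem curve_orbitCoord_mem {p : M} (hp : p ∈ orbitType M K) :
    γ (orbitCoord G γ J p) ∈ MulAction.orbit G p :=
  (Classical.epsilon_spec (hγ.existsUnique p hp).exists).2

theorem orbitCoord_smul_curve {s : ℝ} (hs : s ∈ J) (a : G) :
    orbitCoord G γ J (a • γ s) = s := by
  have hp : a • γ s ∈ orbitType M K := smul_mem_orbitType (hγ.mem_principal s hs) a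
  refine (hγ.existsUnique _ hp).unique ⟨hγ.orbitCoord_mem hp, hγ.curve_orbitCoord_mem hp⟩
    ⟨hs, a⁻¹, by simp⟩

theorem orbitCoord_curve {s : ℝ} (hs : s ∈ J) : orbitCoord G γ J (γ s) = s := by
  simpa using hγ.orbitCoord_smul_curve hs 1

theorem exists_smul_curve {p : M} (hp : p ∈ orbitType M K) :
    ∃ a : G, a • γ (orbitCoord G γ J p) = p := by
  obtain ⟨a, ha⟩ := hγ.curve_orbitCoord_mem hp
  exact ⟨a⁻¹, by rw [← ha]; simp⟩

omit hγ in
theorem orbitCoord_smul (a : G) (p : M) : orbitCoord G γ J (a • p) = orbitCoord G γ J p := by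
  simp only [orbitCoord, MulAction.orbit_eq_iff.2 (MulAction.mem_orbit p a)]

theorem contMDiffAt_curve {s : ℝ} (hs : s ∈ J) : ContMDiffAt 𝓘(ℝ, ℝ) (𝓡 (n + 1)) ∞ γ s :=
  hγ.geodesic.smooth.contMDiffAt (hγ.isOpen.mem_nhds hs)

theorem mdifferentiableAt_curve {s : ℝ} (hs : s ∈ J) :
    MDifferentiableAt 𝓘(ℝ, ℝ) (𝓡 (n + 1)) γ s :=
  (hγ.contMDiffAt_curve hs).mdifferentiableAt (by simp)

theorem velocity_notMem_orbitTangent {s : ℝ} (hs : s ∈ J) :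
    velocity (n + 1) γ s ∉ orbitTangent m (n + 1) G (γ s) := by
  intro h
  have h1 := hγ.unit_speed s hs
  rw [hγ.orthogonal s hs _ h] at h1
  exact zero_ne_one h1

/-- A unit vector orthogonal to the orbit lies outside its tangent space, which has codimension one.
-/
theorem orbitTangent_sup_span (hG : IsCohomogeneityOne m g K) {s : ℝ} (hs : s ∈ J) :
    orbitTangent m (n + 1) G (γ s) ⊔ ℝ ∙ (velocity (n + 1) γ s) = ⊤ := by
  have : FiniteDimensional ℝ (TangentSpace (𝓡 (n + 1)) (γ s)) :=
    inferInstanceAs (FiniteDimensional ℝ (EuclideanSpace ℝ (Fin (n + 1))))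
  have hlt : orbitTangent m (n + 1) G (γ s) <
      orbitTangent m (n + 1) G (γ s) ⊔ ℝ ∙ (velocity (n + 1) γ s) := by
    refine lt_of_le_of_ne le_sup_left fun h => hγ.velocity_notMem_orbitTangent hs ?_
    rw [h]
    exact Submodule.mem_sup_right (Submodule.mem_span_singleton_self _)
  have h1 := Submodule.finrank_lt_finrank_of_lt hlt
  have h2 := hG.codim_one _ (hγ.mem_principal s hs)
  apply Submodule.eq_top_of_finrank_eq
  refine le_antisymm (Submodule.finrank_le _) ?_
  have h3 : Module.finrank ℝ (TangentSpace (𝓡 (n + 1)) (γ s)) = n + 1 :=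
    (finrank_euclideanSpace_fin : Module.finrank ℝ (EuclideanSpace ℝ (Fin (n + 1))) = n + 1)
  omega

theorem exists_decomposition (hG : IsCohomogeneityOne m g K) {s : ℝ} (hs : s ∈ J)
    (v : TangentSpace (𝓡 (n + 1)) (γ s)) :
    ∃ w ∈ orbitTangent m (n + 1) G (γ s), ∃ c : ℝ, v = w + c • velocity (n + 1) γ s := by
  have hv : v ∈ orbitTangent m (n + 1) G (γ s) ⊔ ℝ ∙ (velocity (n + 1) γ s) := by
    rw [hγ.orbitTangent_sup_span hG hs]; trivial
  obtain ⟨w, hw, z, hz, rfl⟩ := Submodule.mem_sup.1 hv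
  obtain ⟨c, rfl⟩ := Submodule.mem_span_singleton.1 hz
  exact ⟨w, hw, c, rfl⟩

theorem contMDiffAt_smul_curve (a : G) {s : ℝ} (hs : s ∈ J) :
    ContMDiffAt ((𝓡 m).prod 𝓘(ℝ, ℝ)) (𝓡 (n + 1)) ∞ (fun x : G × ℝ => x.1 • γ x.2) (a, s) :=
  contMDiffAt_fst.smul (ContMDiffAt.comp (a, s) (hγ.contMDiffAt_curve hs) contMDiffAt_snd)

/-- Orbit directions come from the group factor and the normal direction from the parameter. The
resulting local sections are what make the orbit coordinate smooth. -/
theorem surjective_mfderiv_smul_curve (hG : IsCohomogeneityOne m g K) {s : ℝ} (hs : s ∈ J) :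
    Function.Surjective (mfderiv ((𝓡 m).prod 𝓘(ℝ, ℝ)) (𝓡 (n + 1))
      (fun x : G × ℝ => x.1 • γ x.2) (1, s)) := by
  set ψ : G × ℝ → M := fun x => x.1 • γ x.2
  have hψ : MDifferentiableAt ((𝓡 m).prod 𝓘(ℝ, ℝ)) (𝓡 (n + 1)) ψ (1, s) :=
    (hγ.contMDiffAt_smul_curve 1 hs).mdifferentiableAt (by simp)
  have h1 : ∀ X : EuclideanSpace ℝ (Fin m), (mfderiv (𝓡 m) (𝓡 (n + 1)) (fun a : G => a • γ s) 1 X :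
      EuclideanSpace ℝ (Fin (n + 1))) = mfderiv ((𝓡 m).prod 𝓘(ℝ, ℝ)) (𝓡 (n + 1)) ψ (1, s)
        (mfderiv (𝓡 m) ((𝓡 m).prod 𝓘(ℝ, ℝ)) (fun a : G => (a, s)) 1 X) := fun X =>
    mfderiv_comp_apply_of_base_eq (f := fun a : G => (a, s)) hψ
      ((contMDiff_id.prodMk contMDiff_const : ContMDiff (𝓡 m) ((𝓡 m).prod 𝓘(ℝ, ℝ)) ∞
        (fun a : G => (a, s))).mdifferentiable (by simp) 1) rfl X
  have h2 : ∀ c : ℝ, (mfderiv 𝓘(ℝ, ℝ) (𝓡 (n + 1)) γ s c : EuclideanSpace ℝ (Fin (n + 1)))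
      = mfderiv ((𝓡 m).prod 𝓘(ℝ, ℝ)) (𝓡 (n + 1)) ψ (1, s)
        (mfderiv 𝓘(ℝ, ℝ) ((𝓡 m).prod 𝓘(ℝ, ℝ)) (fun τ : ℝ => ((1 : G), τ)) s c) := by
    intro c
    have hfun : γ = ψ ∘ (fun τ : ℝ => ((1 : G), τ)) := by ext τ; simp [ψ]
    have := mfderiv_comp_apply_of_base_eq (f := fun τ : ℝ => ((1 : G), τ)) (x := s) hψ
      ((contMDiff_const.prodMk contMDiff_id : ContMDiff 𝓘(ℝ, ℝ) ((𝓡 m).prod 𝓘(ℝ, ℝ)) ∞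
        (fun τ : ℝ => ((1 : G), τ))).mdifferentiable (by simp) s) rfl c
    rwa [← hfun] at this
  intro v
  obtain ⟨w, ⟨X, rfl⟩, c, hv⟩ := hγ.exists_decomposition hG hs v
  refine ⟨mfderiv (𝓡 m) ((𝓡 m).prod 𝓘(ℝ, ℝ)) (fun a : G => (a, s)) 1 X +
    mfderiv 𝓘(ℝ, ℝ) ((𝓡 m).prod 𝓘(ℝ, ℝ)) (fun τ : ℝ => ((1 : G), τ)) s c, ?_⟩
  have h3 : (mfderiv 𝓘(ℝ, ℝ) (𝓡 (n + 1)) γ s c : EuclideanSpace ℝ (Fin (n + 1)))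
      = c • velocity (n + 1) γ s :=
    (congrArg (mfderiv 𝓘(ℝ, ℝ) (𝓡 (n + 1)) γ s) (mul_one c).symm).trans
      ((mfderiv 𝓘(ℝ, ℝ) (𝓡 (n + 1)) γ s).map_smul c (1 : ℝ))
  refine (map_add _ _ _).trans ?_
  exact (congrArg₂ (fun x y : EuclideanSpace ℝ (Fin (n + 1)) => x + y) (h1 X).symm
    ((h2 c).symm.trans h3)).trans hv.symm

/-- The orbit coordinate is the second component of a local section of `(a, τ) ↦ a • γ τ`. -/
theorem contMDiffAt_orbitCoord_curve (hG : IsCohomogeneityOne m g K) {s : ℝ} (hs : s ∈ J) :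
    ContMDiffAt (𝓡 (n + 1)) 𝓘(ℝ, ℝ) ∞ (orbitCoord G γ J) (γ s) := by
  obtain ⟨σ, hσ, hσx, hσr⟩ := ContMDiffAt.exists_local_rightInverse
    (hγ.contMDiffAt_smul_curve (1 : G) hs) (hγ.surjective_mfderiv_smul_curve hG hs)
  simp only [one_smul] at hσ hσx hσr
  have h2 : ContMDiffAt (𝓡 (n + 1)) 𝓘(ℝ, ℝ) ∞ (fun y => (σ y).2) (γ s) := hσ.snd
  refine h2.congr_of_eventuallyEq ?_
  have hJ : ∀ᶠ y in 𝓝 (γ s), (σ y).2 ∈ J :=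
    h2.continuousAt.eventually_mem (hγ.isOpen.mem_nhds (by rw [hσx]; exact hs))
  filter_upwards [hσr, hJ] with y hy hyJ
  conv_lhs => rw [← hy]
  exact hγ.orbitCoord_smul_curve hyJ _

theorem contMDiffAt_orbitCoord (hG : IsCohomogeneityOne m g K) {p : M}
    (hp : p ∈ orbitType M K) : ContMDiffAt (𝓡 (n + 1)) 𝓘(ℝ, ℝ) ∞ (orbitCoord G γ J) p := by
  obtain ⟨a, ha⟩ := hγ.exists_smul_curve hp
  have ha' : a⁻¹ • p = γ (orbitCoord G γ J p) := by rw [eq_comm, eq_inv_smul_iff]; exact ha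
  have hfun : orbitCoord G γ J = orbitCoord G γ J ∘ (fun x : M => a⁻¹ • x) := by
    ext x; exact (orbitCoord_smul _ _).symm
  rw [hfun]
  refine ContMDiffAt.comp p ?_ (contMDiff_smul_left m a⁻¹ p)
  rw [ha']
  exact hγ.contMDiffAt_orbitCoord_curve hG (hγ.orbitCoord_mem hp)

theorem mdifferentiableAt_orbitCoord (hG : IsCohomogeneityOne m g K) {p : M}
    (hp : p ∈ orbitType M K) :
    MDifferentiableAt (𝓡 (n + 1)) 𝓘(ℝ, ℝ) (orbitCoord G γ J) p :=
  (hγ.contMDiffAt_orbitCoord hG hp).mdifferentiableAt (by simp)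

theorem mvfderiv_orbitCoord_smul (hG : IsCohomogeneityOne m g K) {p : M}
    (hp : p ∈ orbitType M K) (a : G) (v : TangentSpace (𝓡 (n + 1)) p) :
    mvfderiv (𝓡 (n + 1)) (orbitCoord G γ J) (a • p) (dAct (n + 1) a p v)
      = mvfderiv (𝓡 (n + 1)) (orbitCoord G γ J) p v := by
  have hfun : orbitCoord G γ J ∘ (fun x : M => a • x) = orbitCoord G γ J := by
    ext x; exact orbitCoord_smul _ _
  have := mfderiv_comp_apply_of_base_eq (x := p)
    (hγ.mdifferentiableAt_orbitCoord hG (smul_mem_orbitType hp a))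
    ((contMDiff_smul_left m a).mdifferentiable (by simp) p) rfl v
  rw [hfun] at this
  exact this.symm

theorem mvfderiv_orbitCoord_orbitTangent (hG : IsCohomogeneityOne m g K) {p : M}
    (hp : p ∈ orbitType M K) {w : TangentSpace (𝓡 (n + 1)) p}
    (hw : w ∈ orbitTangent m (n + 1) G p) :
    mvfderiv (𝓡 (n + 1)) (orbitCoord G γ J) p w = 0 := by
  obtain ⟨X, rfl⟩ := hw
  have hfun : orbitCoord G γ J ∘ (fun a : G => a • p) = fun _ => orbitCoord G γ J p := by
    ext x; exact orbitCoord_smul _ _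
  have := mfderiv_comp_apply_of_base_eq (x := (1 : G)) (hγ.mdifferentiableAt_orbitCoord hG hp)
    ((contMDiff_orbitMap p).mdifferentiable (I := 𝓡 m) (by simp) 1) (one_smul G p) X
  rw [hfun, mfderiv_const] at this
  exact this.symm

theorem mvfderiv_orbitCoord_velocity (hG : IsCohomogeneityOne m g K) {s : ℝ} (hs : s ∈ J) :
    mvfderiv (𝓡 (n + 1)) (orbitCoord G γ J) (γ s) (velocity (n + 1) γ s) = 1 := by
  have := mfderiv_comp_apply_of_base_eq (x := s)
    (hγ.mdifferentiableAt_orbitCoord hG (hγ.mem_principal s hs)) (hγ.mdifferentiableAt_curve hs)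
    rfl (1 : ℝ)
  have hfun : orbitCoord G γ J ∘ γ =ᶠ[𝓝 s] id := by
    filter_upwards [hγ.isOpen.mem_nhds hs] with τ hτ using hγ.orbitCoord_curve hτ
  rw [hfun.mfderiv_eq, mfderiv_id] at this
  exact this.symm

/-- After translation to `γ s`, the orthogonal splitting `v = w + c γ'` gives `c ^ 2` on the left
and `g(w, w) + c ^ 2` on the right. This bound lets changes of the orbit coordinate be compared with
lengths in a chart. -/
theorem mvfderiv_orbitCoord_sq_le (hG : IsCohomogeneityOne m g K) {p : M}
    (hp : p ∈ orbitType M K) (v : TangentSpace (𝓡 (n + 1)) p) :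
    (mvfderiv (𝓡 (n + 1)) (orbitCoord G γ J) p v) ^ 2 ≤ g.inner p v v := by
  obtain ⟨a, ha⟩ := hγ.exists_smul_curve hp
  have hs := hγ.orbitCoord_mem hp
  generalize orbitCoord G γ J p = s at ha hs
  subst ha
  obtain ⟨v, rfl⟩ := (dActEquiv m a (γ s)).surjective v
  rw [dActEquiv_apply, hG.isometric, hγ.mvfderiv_orbitCoord_smul hG (hγ.mem_principal s hs)]
  obtain ⟨w, hw, c, rfl⟩ := hγ.exists_decomposition hG hs v
  have h1 := hγ.mvfderiv_orbitCoord_velocity hG hs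
  have h2 := hγ.mvfderiv_orbitCoord_orbitTangent hG (hγ.mem_principal s hs) hw
  have h3 := hγ.unit_speed s hs
  have h4 := hγ.orthogonal s hs w hw
  have h5 : g.inner (γ s) w (velocity (n + 1) γ s) = 0 := by rw [g.symm]; exact h4
  have h6 : 0 ≤ g.inner (γ s) w w := by
    by_cases h0 : w = 0
    · simp [h0]
    · exact (g.pos _ _ h0).le
  simp only [map_add, map_smul, h1, h2, add_apply,
    smul_apply, h3, h4, h5, smul_eq_mul]
  nlinarith

end IsNormalGeodesic

end Coordinate

/-! ### Metrics and one-forms as functions on coordinate space -/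

section ChartTensors

variable {d : ℕ} {M : Type*} [TopologicalSpace M] [ChartedSpace (EuclideanSpace ℝ (Fin d)) M]

/-- The differential at `y` of the inverse of the chart centred at `c`. -/
def chartFrame (c : M) (y : EuclideanSpace ℝ (Fin d)) :
    EuclideanSpace ℝ (Fin d) →L[ℝ] EuclideanSpace ℝ (Fin d) :=
  mfderiv 𝓘(ℝ, EuclideanSpace ℝ (Fin d)) (𝓡 d) (extChartAt (𝓡 d) c).symm y

/-- A one-form in the chart centred at `c`. -/
def chartForm (η : OneForm d M) (c : M) (y : EuclideanSpace ℝ (Fin d)) :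
    EuclideanSpace ℝ (Fin d) →L[ℝ] ℝ :=
  (show EuclideanSpace ℝ (Fin d) →L[ℝ] ℝ from η ((extChartAt (𝓡 d) c).symm y)).comp
    (chartFrame c y)

variable [IsManifold (𝓡 d) ∞ M]

/-- A metric in the chart centred at `c`. -/
def chartMetric (g : Metric d M) (c : M) (y : EuclideanSpace ℝ (Fin d)) :
    EuclideanSpace ℝ (Fin d) →L[ℝ] EuclideanSpace ℝ (Fin d) →L[ℝ] ℝ :=
  (show EuclideanSpace ℝ (Fin d) →L[ℝ] EuclideanSpace ℝ (Fin d) →L[ℝ] ℝ from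
    g.inner ((extChartAt (𝓡 d) c).symm y)).bilinearComp (chartFrame c y) (chartFrame c y)

theorem chartMetric_apply (g : Metric d M) (c : M) (y u v : EuclideanSpace ℝ (Fin d)) :
    chartMetric g c y u v = g.inner ((extChartAt (𝓡 d) c).symm y)
      (chartFrame c y u : EuclideanSpace ℝ (Fin d))
      (chartFrame c y v : EuclideanSpace ℝ (Fin d)) := rfl

theorem contMDiffOn_mfderiv_apply {E' : Type*} [NormedAddCommGroup E'] [NormedSpace ℝ E']
    {f : E' → M} {s : Set E'} (hs : IsOpen s) (hf : ContMDiffOn 𝓘(ℝ, E') (𝓡 d) ∞ f s) (v : E') :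
    ContMDiffOn 𝓘(ℝ, E') (𝓡 d).tangent ∞
      (fun y => (Bundle.TotalSpace.mk' (EuclideanSpace ℝ (Fin d)) (f y)
        (mfderiv 𝓘(ℝ, E') (𝓡 d) f y v) : TangentBundle (𝓡 d) M)) s := by
  have h1 := hf.contMDiffOn_tangentMapWithin (m := ∞) (by simp) hs.uniqueMDiffOn
  have h2 : ContMDiff 𝓘(ℝ, E') 𝓘(ℝ, E').tangent ∞
      (fun y => (Bundle.TotalSpace.mk' E' y v : TangentBundle 𝓘(ℝ, E') E')) :=
    contMDiff_vectorSpace_iff_contDiff.2 contDiff_const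
  have h4 := h1.comp (s := s) h2.contMDiffOn (fun y hy => hy)
  refine h4.congr fun y hy => ?_
  simp only [Function.comp_apply, tangentMapWithin]
  rw [mfderivWithin_of_isOpen hs hy]

theorem contMDiffOn_chartFrame (c : M) (v : EuclideanSpace ℝ (Fin d)) :
    ContMDiffOn 𝓘(ℝ, EuclideanSpace ℝ (Fin d)) (𝓡 d).tangent ∞
      (fun y => (Bundle.TotalSpace.mk' (EuclideanSpace ℝ (Fin d))
        ((extChartAt (𝓡 d) c).symm y) (chartFrame c y v) : TangentBundle (𝓡 d) M))
      (extChartAt (𝓡 d) c).target :=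
  contMDiffOn_mfderiv_apply (isOpen_extChartAt_target c) (contMDiffOn_extChartAt_symm c) v

theorem contDiffOn_chartMetric (g : Metric d M) (c : M) :
    ContDiffOn ℝ ∞ (chartMetric g c) (extChartAt (𝓡 d) c).target := by
  refine contDiffOn_clm_apply.2 fun u => contDiffOn_clm_apply.2 fun v => ?_
  intro y hy
  have hb : ContMDiffWithinAt 𝓘(ℝ, EuclideanSpace ℝ (Fin d)) (𝓡 d) ∞
      (extChartAt (𝓡 d) c).symm (extChartAt (𝓡 d) c).target y :=
    contMDiffOn_extChartAt_symm c y hy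
  have : ContMDiffWithinAt 𝓘(ℝ, EuclideanSpace ℝ (Fin d)) ((𝓡 d).prod 𝓘(ℝ, ℝ)) ∞
      (fun y => Bundle.TotalSpace.mk' ℝ (E := Bundle.Trivial M ℝ) ((extChartAt (𝓡 d) c).symm y)
        (chartMetric g c y u v)) (extChartAt (𝓡 d) c).target y := by
    exact ContMDiffWithinAt.clm_bundle_apply₂ (F₁ := EuclideanSpace ℝ (Fin d))
      (F₂ := EuclideanSpace ℝ (Fin d)) (F₃ := ℝ) (IB := 𝓡 d)
      (E₁ := fun x : M => TangentSpace (𝓡 d) x) (E₂ := fun x : M => TangentSpace (𝓡 d) x)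
      (E₃ := Bundle.Trivial M ℝ) (b := (extChartAt (𝓡 d) c).symm)
      (ψ := fun y => g.inner ((extChartAt (𝓡 d) c).symm y))
      (v := fun y => chartFrame c y u) (w := fun y => chartFrame c y v)
      (g.contMDiff.contMDiffAt.comp_contMDiffWithinAt y hb)
      (contMDiffOn_chartFrame c u y hy) (contMDiffOn_chartFrame c v y hy)
  simp only [Bundle.contMDiffWithinAt_totalSpace] at this
  exact this.2.contDiffWithinAt

theorem contDiffOn_chartForm {η : OneForm d M} (hη : IsSmoothForm η) (c : M) :
    ContDiffOn ℝ ∞ (chartForm η c) (extChartAt (𝓡 d) c).target := by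
  refine contDiffOn_clm_apply.2 fun u => ?_
  intro y hy
  have hb : ContMDiffWithinAt 𝓘(ℝ, EuclideanSpace ℝ (Fin d)) (𝓡 d) ∞
      (extChartAt (𝓡 d) c).symm (extChartAt (𝓡 d) c).target y :=
    contMDiffOn_extChartAt_symm c y hy
  have : ContMDiffWithinAt 𝓘(ℝ, EuclideanSpace ℝ (Fin d)) ((𝓡 d).prod 𝓘(ℝ, ℝ)) ∞
      (fun y => Bundle.TotalSpace.mk' ℝ (E := Bundle.Trivial M ℝ) ((extChartAt (𝓡 d) c).symm y)
        (chartForm η c y u)) (extChartAt (𝓡 d) c).target y := by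
    exact ContMDiffWithinAt.clm_bundle_apply (F₁ := EuclideanSpace ℝ (Fin d))
      (F₂ := ℝ) (IB := 𝓡 d) (E₁ := fun x : M => TangentSpace (𝓡 d) x)
      (E₂ := Bundle.Trivial M ℝ) (b := (extChartAt (𝓡 d) c).symm)
      (ϕ := fun y => η ((extChartAt (𝓡 d) c).symm y)) (v := fun y => chartFrame c y u)
      (hη.contMDiffAt.comp_contMDiffWithinAt y hb) (contMDiffOn_chartFrame c u y hy)
  simp only [Bundle.contMDiffWithinAt_totalSpace] at this
  exact this.2.contDiffWithinAt

theorem chartFrame_bijective (c : M) {y : EuclideanSpace ℝ (Fin d)}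
    (hy : y ∈ (extChartAt (𝓡 d) c).target) : Function.Bijective (chartFrame c y) := by
  have h := (isInvertible_mfderivWithin_extChartAt_symm (I := 𝓡 d) hy)
  rw [(𝓡 d).range_eq_univ, mfderivWithin_univ] at h
  exact h.bijective

theorem chartMetric_symm (g : Metric d M) (c : M) (y u v : EuclideanSpace ℝ (Fin d)) :
    chartMetric g c y u v = chartMetric g c y v u := g.symm _ _ _

theorem chartMetric_pos (g : Metric d M) (c : M) {y v : EuclideanSpace ℝ (Fin d)}
    (hy : y ∈ (extChartAt (𝓡 d) c).target) (hv : v ≠ 0) : 0 < chartMetric g c y v v := by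
  refine g.pos _ _ fun h => hv ?_
  exact (chartFrame_bijective c hy).1 (h.trans (map_zero _).symm)

/-- Functions in a chart: the derivative is the pull-back of the manifold derivative. -/
theorem hasFDerivAt_comp_extChartAt_symm {f : M → ℝ} (c : M) {y : EuclideanSpace ℝ (Fin d)}
    (hy : y ∈ (extChartAt (𝓡 d) c).target)
    (hf : MDifferentiableAt (𝓡 d) 𝓘(ℝ, ℝ) f ((extChartAt (𝓡 d) c).symm y)) :
    HasFDerivAt (fun z => f ((extChartAt (𝓡 d) c).symm z)) (chartForm (mvfderiv (𝓡 d) f) c y) y := by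
  have h1 : MDifferentiableAt 𝓘(ℝ, EuclideanSpace ℝ (Fin d)) (𝓡 d) (extChartAt (𝓡 d) c).symm y :=
    ((contMDiffOn_extChartAt_symm (n := ∞) c).contMDiffAt
      ((isOpen_extChartAt_target c).mem_nhds hy)).mdifferentiableAt (by simp)
  have h2 := hf.hasMFDerivAt.comp y h1.hasMFDerivAt
  exact h2.hasFDerivAt

end ChartTensors

/-! ### Truncated chart distance from an orbit to a point -/

section OrbitDistance

variable {d m : ℕ} {M : Type*} [TopologicalSpace M] [T2Space M]
  [ChartedSpace (EuclideanSpace ℝ (Fin d)) M]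
  {G : Type*} [TopologicalSpace G] [CompactSpace G]
  [ChartedSpace (EuclideanSpace ℝ (Fin m)) G] [Group G]
  [MulAction G M] [ContMDiffSMul (𝓡 m) (𝓡 d) ∞ G M]

open Classical in
/-- The distance to `q` in the chart centred at `q`, truncated at `δ`. -/
def chartDist (d : ℕ) {M : Type*} [TopologicalSpace M] [ChartedSpace (EuclideanSpace ℝ (Fin d)) M]
    (q : M) (δ : ℝ) (x : M) : ℝ :=
  if x ∈ (extChartAt (𝓡 d) q).source then
    min ‖extChartAt (𝓡 d) q x - extChartAt (𝓡 d) q q‖ δ else δ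

omit [T2Space M] in
theorem chartDist_nonneg {q : M} {δ : ℝ} (hδ : 0 < δ) (x : M) : 0 ≤ chartDist d q δ x := by
  unfold chartDist
  split_ifs
  · exact le_min (norm_nonneg _) hδ.le
  · exact hδ.le

/-- The image of the closed ball of radius `δ` is compact, hence closed. A point outside the chart
avoids it, and off this image the function is the constant `δ`. -/
theorem continuous_chartDist {q : M} {δ : ℝ}
    (hball : Metric.closedBall (extChartAt (𝓡 d) q q) δ ⊆ (extChartAt (𝓡 d) q).target) :
    Continuous (chartDist d q δ) := by
  set κ := extChartAt (𝓡 d) q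
  have hK : IsCompact (κ.symm '' Metric.closedBall (κ q) δ) :=
    (isCompact_closedBall _ _).image_of_continuousOn
      ((continuousOn_extChartAt_symm q).mono hball)
  rw [continuous_iff_continuousAt]
  intro x
  by_cases hx : x ∈ κ.source
  · have h1 : ∀ᶠ y in 𝓝 x, chartDist d q δ y = min ‖κ y - κ q‖ δ := by
      filter_upwards [(isOpen_extChartAt_source q).mem_nhds hx] with y hy
      exact if_pos hy
    refine ContinuousAt.congr ?_ (h1.mono fun y hy => hy.symm)
    have h2 : ContinuousAt κ x := (continuousOn_extChartAt q).continuousAt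
      ((isOpen_extChartAt_source q).mem_nhds hx)
    exact (h2.sub continuousAt_const).norm.min continuousAt_const
  · have hxK : x ∉ κ.symm '' Metric.closedBall (κ q) δ := by
      rintro ⟨z, hz, rfl⟩
      exact hx (κ.map_target (hball hz))
    refine (continuousAt_const (y := δ)).congr ?_
    filter_upwards [hK.isClosed.isOpen_compl.mem_nhds hxK] with y hy
    unfold chartDist
    split_ifs with hys
    · refine (min_eq_right ?_).symm
      by_contra! hlt
      exact hy ⟨κ y, by rw [Metric.mem_closedBall, dist_eq_norm]; exact hlt.le, κ.left_inv hys⟩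
    · rfl

/-- The distance of the orbit of `x` to `q` in the chart centred at `q`, truncated at `δ`. -/
def orbitDist (d : ℕ) (G : Type*) [Group G] {M : Type*} [TopologicalSpace M]
    [ChartedSpace (EuclideanSpace ℝ (Fin d)) M] [MulAction G M] (q : M) (δ : ℝ) (x : M) : ℝ :=
  sInf ((fun a : G => chartDist d q δ (a • x)) '' univ)

theorem continuous_orbitDist (m : ℕ) {d : ℕ} {M : Type*} [TopologicalSpace M] [T2Space M]
    [ChartedSpace (EuclideanSpace ℝ (Fin d)) M] {G : Type*} [TopologicalSpace G] [CompactSpace G]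
    [ChartedSpace (EuclideanSpace ℝ (Fin m)) G] [Group G] [MulAction G M]
    [ContMDiffSMul (𝓡 m) (𝓡 d) ∞ G M] {q : M} {δ : ℝ}
    (hball : Metric.closedBall (extChartAt (𝓡 d) q q) δ ⊆ (extChartAt (𝓡 d) q).target) :
    Continuous (orbitDist d G q δ) := by
  have : ContinuousSMul G M := ContMDiffSMul.continuousSMul (I := 𝓡 m) (I' := 𝓡 d) ∞
  refine isCompact_univ.continuous_sInf (f := fun (x : M) (a : G) => chartDist d q δ (a • x)) ?_
  exact (continuous_chartDist hball).comp (continuous_snd.smul continuous_fst)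

omit [T2Space M] [TopologicalSpace G] [CompactSpace G]
  [ChartedSpace (EuclideanSpace ℝ (Fin m)) G] [ContMDiffSMul (𝓡 m) (𝓡 d) ∞ G M] in
theorem orbitDist_le {q : M} {δ : ℝ} (hδ : 0 < δ) (x : M) (a : G) :
    orbitDist d G q δ x ≤ chartDist d q δ (a • x) :=
  csInf_le ⟨0, by rintro _ ⟨b, -, rfl⟩; exact chartDist_nonneg hδ _⟩ ⟨a, trivial, rfl⟩

omit [T2Space M] [TopologicalSpace G] [CompactSpace G]
  [ChartedSpace (EuclideanSpace ℝ (Fin m)) G] [ContMDiffSMul (𝓡 m) (𝓡 d) ∞ G M] in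
theorem orbitDist_smul {q : M} {δ : ℝ} (x : M) (a : G) :
    orbitDist d G q δ (a • x) = orbitDist d G q δ x := by
  unfold orbitDist
  congr 1
  ext r
  simp only [image_univ, mem_range, smul_smul]
  exact ⟨fun ⟨b, hb⟩ => ⟨b * a, hb⟩, fun ⟨b, hb⟩ => ⟨b * a⁻¹, by simpa using hb⟩⟩

/-- Compactness of `G` makes the infimum a minimum, and a value below `δ` cannot come from the
truncation. -/
theorem exists_orbitDist_eq (m : ℕ) {d : ℕ} {M : Type*} [TopologicalSpace M] [T2Space M]
    [ChartedSpace (EuclideanSpace ℝ (Fin d)) M] {G : Type*} [TopologicalSpace G] [CompactSpace G]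
    [ChartedSpace (EuclideanSpace ℝ (Fin m)) G] [Group G] [MulAction G M]
    [ContMDiffSMul (𝓡 m) (𝓡 d) ∞ G M] {q : M} {δ : ℝ}
    (hball : Metric.closedBall (extChartAt (𝓡 d) q q) δ ⊆ (extChartAt (𝓡 d) q).target)
    {x : M} (hx : orbitDist d G q δ x < δ) :
    ∃ a : G, a • x ∈ (extChartAt (𝓡 d) q).source ∧
      ‖extChartAt (𝓡 d) q (a • x) - extChartAt (𝓡 d) q q‖ = orbitDist d G q δ x := by
  have : ContinuousSMul G M := ContMDiffSMul.continuousSMul (I := 𝓡 m) (I' := 𝓡 d) ∞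
  have hc : Continuous (fun a : G => chartDist d q δ (a • x)) :=
    (continuous_chartDist hball).comp (continuous_id.smul continuous_const)
  obtain ⟨a, -, ha, -⟩ := isCompact_univ.exists_sInf_image_eq_and_le univ_nonempty
    hc.continuousOn
  have ha' : orbitDist d G q δ x = chartDist d q δ (a • x) := ha
  refine ⟨a, ?_⟩
  rw [ha'] at hx ⊢
  unfold chartDist at hx ⊢
  split_ifs at hx ⊢ with h
  · refine ⟨h, ?_⟩
    rcases min_lt_iff.1 hx with h' | h'
    · exact (min_eq_left h'.le).symm
    · exact absurd h' (lt_irrefl _)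
  · exact absurd hx (lt_irrefl _)

theorem orbitDist_self {q : M} {δ : ℝ} (hδ : 0 < δ) : orbitDist d G q δ q = 0 := by
  refine le_antisymm ?_ (Real.sInf_nonneg ?_)
  · have h := orbitDist_le (d := d) hδ (q := q) q (1 : G)
    simpa [chartDist, mem_extChartAt_source, hδ.le] using h
  · rintro _ ⟨b, -, rfl⟩
    exact chartDist_nonneg hδ _

theorem orbitDist_nonneg {q : M} {δ : ℝ} (hδ : 0 < δ) (x : M) : 0 ≤ orbitDist d G q δ x := by
  refine Real.sInf_nonneg ?_
  rintro _ ⟨b, -, rfl⟩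
  exact chartDist_nonneg hδ _

end OrbitDistance

/-! ### The descent property near a non-principal point -/

section Descent

variable {n m : ℕ}
  {M : Type*} [TopologicalSpace M] [T2Space M]
  [ChartedSpace (EuclideanSpace ℝ (Fin (n + 1))) M] [IsManifold (𝓡 (n + 1)) ∞ M]
  {G : Type*} [TopologicalSpace G] [CompactSpace G]
  [ChartedSpace (EuclideanSpace ℝ (Fin m)) G] [Group G] [LieGroup (𝓡 m) ∞ G]
  [MulAction G M] [ContMDiffSMul (𝓡 m) (𝓡 (n + 1)) ∞ G M]
  {g : Metric (n + 1) M} {K : Subgroup G} {γ : ℝ → M} {J : Set ℝ}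

/-- A coordinate ball on which the metric is bounded. -/
theorem exists_closedBall_metric_le {d : ℕ} {M : Type*} [TopologicalSpace M]
    [ChartedSpace (EuclideanSpace ℝ (Fin d)) M] [IsManifold (𝓡 d) ∞ M]
    (g : Metric d M) (q : M) :
    ∃ δ > 0, ∃ C > 0, Metric.closedBall (extChartAt (𝓡 d) q q) δ ⊆ (extChartAt (𝓡 d) q).target ∧
      ∀ y ∈ Metric.closedBall (extChartAt (𝓡 d) q q) δ, ∀ v,
        chartMetric g q y v v ≤ C ^ 2 * ‖v‖ ^ 2 := by
  set κ := extChartAt (𝓡 d) q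
  have ht : κ.target ∈ 𝓝 (κ q) := extChartAt_target_mem_nhds q
  have hc : ContinuousAt (chartMetric g q) (κ q) :=
    (contDiffOn_chartMetric g q).continuousOn.continuousAt ht
  have hcn : ContinuousAt (fun y => ‖chartMetric g q y‖) (κ q) :=
    ContinuousAt.comp (g := fun L : EuclideanSpace ℝ (Fin d) →L[ℝ] EuclideanSpace ℝ (Fin d) →L[ℝ] ℝ
      => ‖L‖) (continuous_norm (E := EuclideanSpace ℝ (Fin d) →L[ℝ]
        EuclideanSpace ℝ (Fin d) →L[ℝ] ℝ)).continuousAt hc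
  have hb : ∀ᶠ y in 𝓝 (κ q), ‖chartMetric g q y‖ < ‖chartMetric g q (κ q)‖ + 1 :=
    hcn.eventually (Iio_mem_nhds (lt_add_one _))
  obtain ⟨δ, hδ, hsub⟩ := Metric.nhds_basis_closedBall.mem_iff.1 (inter_mem ht hb)
  refine ⟨δ, hδ, ‖chartMetric g q (κ q)‖ + 1, by positivity, fun y hy => (hsub hy).1, ?_⟩
  intro y hy v
  have h1 := (hsub hy).2
  have h2 : chartMetric g q y v v ≤ ‖chartMetric g q y‖ * ‖v‖ * ‖v‖ :=
    (le_abs_self _).trans ((chartMetric g q y).le_opNorm₂ v v)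
  have h3 : 0 ≤ ‖chartMetric g q (κ q)‖ := by positivity
  -- The constant is at least one, hence at most its square; the squared form suits the bound on the
  -- square of `dt`.
  have h4 : ‖chartMetric g q y‖ ≤ (‖chartMetric g q (κ q)‖ + 1) ^ 2 := by
    have : ‖chartMetric g q y‖ < ‖chartMetric g q (κ q)‖ + 1 := h1
    nlinarith
  calc _ ≤ _ := h2
    _ = ‖chartMetric g q y‖ * ‖v‖ ^ 2 := by ring
    _ ≤ _ := by gcongr

/-- If the distance were zero, the attained minimum would put `q` on the orbit of `x`. -/
theorem orbitDist_pos (m : ℕ) {n : ℕ} {M : Type*} [TopologicalSpace M] [T2Space M]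
    [ChartedSpace (EuclideanSpace ℝ (Fin (n + 1))) M] {G : Type*} [TopologicalSpace G]
    [CompactSpace G] [ChartedSpace (EuclideanSpace ℝ (Fin m)) G] [Group G] [MulAction G M]
    [ContMDiffSMul (𝓡 m) (𝓡 (n + 1)) ∞ G M] {K : Subgroup G} {q : M}
    (hq : q ∉ orbitType M K) {δ : ℝ} (hδ : 0 < δ)
    (hball : Metric.closedBall (extChartAt (𝓡 (n + 1)) q q) δ ⊆ (extChartAt (𝓡 (n + 1)) q).target)
    {x : M} (hx : x ∈ orbitType M K) : 0 < orbitDist (n + 1) G q δ x := by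
  refine lt_of_le_of_ne (orbitDist_nonneg hδ x) fun h => ?_
  obtain ⟨a, ha, ha'⟩ := exists_orbitDist_eq m hball (x := x) (G := G) (by rw [← h]; exact hδ)
  rw [← h, norm_sub_eq_zero_iff] at ha'
  have : a • x = q := (extChartAt (𝓡 (n + 1)) q).injOn ha (mem_extChartAt_source q) ha'
  exact hq (this ▸ smul_mem_orbitType hx a)

/-- Moving radially towards `q` in the chart centred at `q` decreases the distance to `q`, at a
rate comparable to the change of the orbit coordinate. -/
theorem IsNormalGeodesic.descends (hγ : IsNormalGeodesic m g K γ J)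
    (hG : IsCohomogeneityOne m g K) {q : M} (hq : q ∉ orbitType M K) {δ C : ℝ} (hδ : 0 < δ)
    (hC : 0 < C)
    (hball : Metric.closedBall (extChartAt (𝓡 (n + 1)) q q) δ ⊆ (extChartAt (𝓡 (n + 1)) q).target)
    (hmet : ∀ y ∈ Metric.closedBall (extChartAt (𝓡 (n + 1)) q q) δ, ∀ v,
        chartMetric g q y v v ≤ C ^ 2 * ‖v‖ ^ 2) :
    Descends J (fun s => orbitDist (n + 1) G q δ (γ s)) δ (C + 1) := by
  intro s hs hsδ ρ hρ
  set κ := extChartAt (𝓡 (n + 1)) q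
  obtain ⟨a, ha, hdist⟩ := exists_orbitDist_eq m hball hsδ
  have hx : a • γ s ∈ orbitType M K := smul_mem_orbitType (hγ.mem_principal s hs) a
  have hr : 0 < orbitDist (n + 1) G q δ (γ s) :=
    orbitDist_pos m hq hδ hball (hγ.mem_principal s hs)
  set r := orbitDist (n + 1) G q δ (γ s)
  set z := κ (a • γ s)
  have hzsymm : κ.symm z = a • γ s := κ.left_inv ha
  have hzball : z ∈ Metric.closedBall (κ q) δ := by
    rw [Metric.mem_closedBall, dist_eq_norm]
    exact (hdist.trans_lt hsδ).le
  have hz : z ∈ κ.target := hball hzball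
  set L := chartForm (mvfderiv (𝓡 (n + 1)) (orbitCoord G γ J)) q z
  have hL : HasFDerivAt (fun y => orbitCoord G γ J (κ.symm y)) L z :=
    hasFDerivAt_comp_extChartAt_symm q hz (by
      rw [hzsymm]; exact hγ.mdifferentiableAt_orbitCoord hG hx)
  -- The radial vector has chart length `r`, and `dt` is bounded by the metric, which is at most `C
  -- ^ 2` times the square of the chart norm.
  have hLbound : |L (κ q - z)| ≤ C * r := by
    have h1 : (L (κ q - z)) ^ 2 ≤ chartMetric g q z (κ q - z) (κ q - z) := by
      refine hγ.mvfderiv_orbitCoord_sq_le hG ?_ _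
      rw [hzsymm]; exact hx
    have h2 := h1.trans (hmet z hzball (κ q - z))
    rw [norm_sub_rev, hdist, ← mul_pow] at h2
    exact abs_le_of_sq_le_sq h2 (by positivity)
  have hline : HasDerivAt (fun σ : ℝ => z + σ • (κ q - z)) (κ q - z) 0 := by
    simpa using ((hasDerivAt_id (0 : ℝ)).smul_const (κ q - z)).const_add z
  have hτ : HasDerivAt (fun σ : ℝ => orbitCoord G γ J (κ.symm (z + σ • (κ q - z))))
      (L (κ q - z)) 0 := by
    have hL' : HasFDerivAt (fun y => orbitCoord G γ J (κ.symm y)) L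
        (z + (0 : ℝ) • (κ q - z)) := by simpa using hL
    exact hL'.comp_hasDerivAt 0 hline
  set τ := fun σ : ℝ => orbitCoord G γ J (κ.symm (z + σ • (κ q - z)))
  have hτ0 : τ 0 = s := by
    simp only [τ, zero_smul, add_zero, hzsymm]
    exact hγ.orbitCoord_smul_curve hs a
  have h0 : Tendsto (fun σ : ℝ => z + σ • (κ q - z)) (𝓝 0) (𝓝 z) := by
    simpa using hline.continuousAt.tendsto
  have e1 : ∀ᶠ σ in 𝓝 (0 : ℝ), κ.symm (z + σ • (κ q - z)) ∈ orbitType M K := by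
    have hc : ContinuousAt κ.symm z := (continuousOn_extChartAt_symm q).continuousAt
      ((isOpen_extChartAt_target q).mem_nhds hz)
    exact h0.eventually (hc.eventually_mem (hG.isOpen_principal.mem_nhds (by rwa [hzsymm])))
  have e2 : ∀ᶠ σ in 𝓝 (0 : ℝ), |τ σ - s| < ρ := by
    have := hτ.continuousAt.eventually (Metric.ball_mem_nhds _ hρ)
    filter_upwards [this] with σ hσ
    rwa [hτ0] at hσ
  -- Allowing an error of `r * ‖σ‖` in the first-order expansion is what turns `C` into `C + 1`.
  have e3 : ∀ᶠ σ in 𝓝 (0 : ℝ), ‖τ σ - τ 0 - (σ - 0) • L (κ q - z)‖ ≤ r * ‖σ - 0‖ :=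
    (hasDerivAt_iff_isLittleO.1 hτ).bound hr
  have e5 : ∀ᶠ σ in 𝓝 (0 : ℝ), z + σ • (κ q - z) ∈ κ.target :=
    h0.eventually ((isOpen_extChartAt_target q).mem_nhds hz)
  have e4 : ∀ᶠ σ in 𝓝[>] (0 : ℝ), σ < 1 := nhdsWithin_le_nhds (Iio_mem_nhds one_pos)
  obtain ⟨σ, ⟨⟨h1, h2, h3, h5⟩, h4⟩, hσ⟩ :=
    ((((e1.and (e2.and (e3.and e5))).filter_mono nhdsWithin_le_nhds).and e4).and
      (self_mem_nhdsWithin (a := (0 : ℝ)) (s := Ioi 0))).exists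
  replace hσ : 0 < σ := hσ
  rw [hτ0, sub_zero, smul_eq_mul, Real.norm_eq_abs, Real.norm_eq_abs, abs_of_pos hσ] at h3
  have hτσ : |τ σ - s| ≤ (C + 1) * (σ * r) := by
    have h6 : |τ σ - s| ≤ |τ σ - s - σ * L (κ q - z)| + |σ * L (κ q - z)| := by
      have := abs_add_le (τ σ - s - σ * L (κ q - z)) (σ * L (κ q - z))
      rwa [sub_add_cancel] at this
    rw [abs_mul, abs_of_pos hσ] at h6
    nlinarith [mul_le_mul_of_nonneg_left hLbound hσ.le]
  -- On the segment towards `κ q` the chart distance shrinks by the factor `1 - σ`, and the orbit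
  -- distance is no larger.
  have hval : orbitDist (n + 1) G q δ (γ (τ σ)) ≤ r - σ * r := by
    obtain ⟨b, hb⟩ := hγ.exists_smul_curve h1
    have h7 : orbitDist (n + 1) G q δ (γ (τ σ))
        = orbitDist (n + 1) G q δ (κ.symm (z + σ • (κ q - z))) := by
      rw [← hb, orbitDist_smul]
    rw [h7]
    refine (orbitDist_le hδ _ (1 : G)).trans ?_
    rw [one_smul]
    unfold chartDist
    rw [if_pos (κ.map_target h5), κ.right_inv h5]
    refine (min_le_left _ _).trans (le_of_eq ?_)
    have : z + σ • (κ q - z) - κ q = (1 - σ) • (z - κ q) := by module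
    rw [this, norm_smul, hdist, Real.norm_eq_abs, abs_of_pos (by linarith)]
    ring
  refine ⟨τ σ, hγ.orbitCoord_mem h1, ?_, h2, ?_⟩
  · intro h
    rw [h] at hval
    have : 0 < σ * r := by positivity
    linarith
  · refine hval.trans ?_
    have : |τ σ - s| / (C + 1) ≤ σ * r := by
      rw [div_le_iff₀ (by positivity)]
      linarith
    linarith

end Descent

/-! ### The orbit space -/

section QuotientSpace

/-- Continuous actions of compact groups on Hausdorff spaces are proper. -/
theorem properSMul_of_compactSpace (G M : Type*) [Group G] [TopologicalSpace G] [CompactSpace G]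
    [TopologicalSpace M] [T2Space M] [MulAction G M] [ContinuousSMul G M] : ProperSMul G M := by
  rw [properSMul_iff_continuousSMul_ultrafilter_tendsto_t2]
  refine ⟨inferInstance, fun 𝒰 _ _ _ => ?_⟩
  obtain ⟨a, -, ha⟩ := isCompact_univ.ultrafilter_le_nhds (𝒰.map Prod.fst) (by simp)
  exact ⟨a, ha⟩

/-- The projection to the orbit space. -/
abbrev toQuotient (G : Type*) {M : Type*} [Group G] [MulAction G M] (x : M) :
    Quotient (MulAction.orbitRel G M) := Quotient.mk _ x

theorem toQuotient_eq_iff {G M : Type*} [Group G] [MulAction G M] {x y : M} :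
    toQuotient G x = toQuotient G y ↔ ∃ a : G, a • y = x := by
  rw [Quotient.eq, MulAction.orbitRel_apply]; rfl

theorem toQuotient_smul {G M : Type*} [Group G] [MulAction G M] (a : G) (x : M) :
    toQuotient G (a • x) = toQuotient G x := toQuotient_eq_iff.2 ⟨a, rfl⟩

end QuotientSpace

/-! ### Non-principal orbits as limits at the ends of `J` -/

section Ends

variable {n m : ℕ}
  {M : Type*} [TopologicalSpace M] [T2Space M]
  [ChartedSpace (EuclideanSpace ℝ (Fin (n + 1))) M] [IsManifold (𝓡 (n + 1)) ∞ M]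
  {G : Type*} [TopologicalSpace G] [CompactSpace G]
  [ChartedSpace (EuclideanSpace ℝ (Fin m)) G] [Group G] [LieGroup (𝓡 m) ∞ G]
  [MulAction G M] [ContMDiffSMul (𝓡 m) (𝓡 (n + 1)) ∞ G M]
  {g : Metric (n + 1) M} {K : Subgroup G} {γ : ℝ → M} {J : Set ℝ}

/-- As `s` tends to the endpoint `b` of `J`, the orbit of `γ s` tends to the orbit of `q`. -/
def IsEnd (G : Type*) {M : Type*} [Group G] [TopologicalSpace M] [MulAction G M] (γ : ℝ → M)
    (J : Set ℝ) (q : M) (b : ℝ) : Prop :=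
  b ∉ J ∧ b ∈ closure J ∧ Tendsto (fun s => toQuotient G (γ s)) (𝓝[J] b) (𝓝 (toQuotient G q))

/-- Points outside an open order-connected set are separated from it by an endpoint. -/
theorem exists_endpoint_near {J : Set ℝ} (hJ : IsOpen J) (hJ' : J.OrdConnected) {s b : ℝ}
    (hs : s ∈ J) (hb : b ∉ J) :
    ∃ b' ∈ ({sInf J, sSup J} : Set ℝ), b' ∉ J ∧ |s - b'| ≤ |s - b| := by
  -- On the side of `s` where `b` lies, `J` is bounded, so the infimum or supremum chosen is genuine
  -- and not the default value for an unbounded set.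
  rcases lt_or_gt_of_ne (fun h => hb (h ▸ hs) : b ≠ s) with h | h
  · have hlow : b ∈ lowerBounds J := by
      intro x hx
      by_contra! hxb
      exact hb (hJ'.out hx hs ⟨hxb.le, h.le⟩)
    have h1 : b ≤ sInf J := le_csInf ⟨s, hs⟩ hlow
    have h2 : sInf J ≤ s := csInf_le ⟨b, hlow⟩ hs
    refine ⟨sInf J, by simp, fun hmem => ?_, ?_⟩
    · obtain ⟨ρ, hρ, hsub⟩ := Metric.isOpen_iff.1 hJ _ hmem
      have h3 : sInf J - ρ / 2 ∈ J := hsub (by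
        rw [Metric.mem_ball, Real.dist_eq, abs_of_neg] <;> linarith)
      linarith [csInf_le ⟨b, hlow⟩ h3]
    · rw [abs_of_nonneg (by linarith), abs_of_nonneg (by linarith)]; linarith
  · have hup : b ∈ upperBounds J := by
      intro x hx
      by_contra! hxb
      exact hb (hJ'.out hs hx ⟨h.le, hxb.le⟩)
    have h1 : sSup J ≤ b := csSup_le ⟨s, hs⟩ hup
    have h2 : s ≤ sSup J := le_csSup ⟨b, hup⟩ hs
    refine ⟨sSup J, by simp, fun hmem => ?_, ?_⟩
    · obtain ⟨ρ, hρ, hsub⟩ := Metric.isOpen_iff.1 hJ _ hmem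
      have h3 : sSup J + ρ / 2 ∈ J := hsub (by
        rw [Metric.mem_ball, Real.dist_eq, abs_of_pos] <;> linarith)
      linarith [le_csSup ⟨b, hup⟩ h3]
    · rw [abs_of_nonpos (by linarith), abs_of_nonpos (by linarith)]; linarith

namespace IsNormalGeodesic

variable (hγ : IsNormalGeodesic m g K γ J) (hG : IsCohomogeneityOne m g K)
include hγ hG

theorem continuousOn_curve : ContinuousOn γ J := hγ.geodesic.smooth.continuousOn

theorem orbitDist_curve_orbitCoord {q x : M} {δ : ℝ} (hx : x ∈ orbitType M K) :
    orbitDist (n + 1) G q δ (γ (orbitCoord G γ J x)) = orbitDist (n + 1) G q δ x := by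
  obtain ⟨a, ha⟩ := hγ.exists_smul_curve hx
  rw [← orbitDist_smul _ a, ha]

/-- Near `q` the orbit distance is small, and descent then places a missing parameter of `J` within
a fixed multiple of that distance. -/
theorem eventually_near_endpoint {q : M} (hq : q ∉ orbitType M K) {ρ : ℝ} (hρ : 0 < ρ) :
    ∀ᶠ x in 𝓝[orbitType M K] q, ∃ b ∈ ({sInf J, sSup J} : Set ℝ), b ∉ J ∧
      |orbitCoord G γ J x - b| ≤ ρ := by
  obtain ⟨δ, hδ, C, hC, hball, hmet⟩ := exists_closedBall_metric_le g q
  have hdes := hγ.descends hG hq hδ hC hball hmet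
  have hcont := continuous_orbitDist m (G := G) hball
  have hev : ∀ᶠ x in 𝓝 q, orbitDist (n + 1) G q δ x < min δ (ρ / (3 * (C + 1))) := by
    refine hcont.continuousAt.eventually (Iio_mem_nhds ?_)
    rw [orbitDist_self hδ]
    positivity
  filter_upwards [nhdsWithin_le_nhds hev, self_mem_nhdsWithin] with x hx hxM
  have hJx := hγ.orbitCoord_mem hxM
  obtain ⟨b, hb, hb'⟩ := hdes.exists_notMem_near (by positivity)
    (hcont.comp_continuousOn (hγ.continuousOn_curve hG))
    (fun s hs => orbitDist_pos m hq hδ hball (hγ.mem_principal s hs)) hJx (by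
      simp only [hγ.orbitDist_curve_orbitCoord hG hxM]
      exact hx.trans_le (min_le_left _ _))
  obtain ⟨b', hb'mem, hb'J, hb'le⟩ := exists_endpoint_near hγ.isOpen hγ.ordConnected hJx hb
  refine ⟨b', hb'mem, hb'J, hb'le.trans (hb'.trans ?_)⟩
  simp only [hγ.orbitDist_curve_orbitCoord hG hxM]
  have h1 := hx.trans_le (min_le_right _ _)
  rw [lt_div_iff₀ (by positivity)] at h1
  linarith

/-- The hypothesis yields parameters near `b` with small orbit distance, and descent extends this to
all parameters near `b`. A small orbit distance means that a translate of `γ s` is close to `q`,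
which is convergence in the orbit space. -/
theorem isEnd_of_frequently {q : M} (hq : q ∉ orbitType M K) {b : ℝ} (hb : b ∉ J)
    (hfr : ∀ ρ > 0, ∃ᶠ x in 𝓝[orbitType M K] q, |orbitCoord G γ J x - b| < ρ) :
    IsEnd G γ J q b := by
  obtain ⟨δ, hδ, C, hC, hball, hmet⟩ := exists_closedBall_metric_le g q
  have hdes := hγ.descends hG hq hδ hC hball hmet
  have hcont := continuous_orbitDist m (G := G) hball
  have hcl : ∀ ρ > 0, ∃ s ∈ J, |s - b| < ρ ∧ orbitDist (n + 1) G q δ (γ s) < ρ := by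
    intro ρ hρ
    have hev : ∀ᶠ x in 𝓝 q, orbitDist (n + 1) G q δ x < ρ := by
      refine hcont.continuousAt.eventually (Iio_mem_nhds ?_)
      rwa [orbitDist_self hδ]
    obtain ⟨x, h1, h2, h3⟩ := ((hfr ρ hρ).and_eventually
      ((hev.filter_mono nhdsWithin_le_nhds).and self_mem_nhdsWithin)).exists
    exact ⟨_, hγ.orbitCoord_mem h3, h1, by rwa [hγ.orbitDist_curve_orbitCoord hG h3]⟩
  have hev := fun {ρ : ℝ} (hρ : 0 < ρ) => hdes.eventually_lt hγ.ordConnected (by positivity) hδ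
    (hcont.comp_continuousOn (hγ.continuousOn_curve hG)) hb hcl hρ
  refine ⟨hb, Metric.mem_closure_iff.2 fun ρ hρ => ?_, ?_⟩
  · obtain ⟨s, hs, hs', -⟩ := hcl ρ hρ
    exact ⟨s, hs, by rwa [dist_comm, Real.dist_eq]⟩
  · have hcs : ContinuousSMul G M := ContMDiffSMul.continuousSMul (I := 𝓡 m) (I' := 𝓡 (n + 1)) ∞
    intro W hW
    have hW' : toQuotient G ⁻¹' W ∈ 𝓝 q :=
      (MulAction.isOpenQuotientMap_quotientMk (Γ := G) (T := M)).continuous.continuousAt hW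
    set κ := extChartAt (𝓡 (n + 1)) q
    have hpre : κ.symm ⁻¹' (toQuotient G ⁻¹' W) ∈ 𝓝 (κ q) :=
      (continuousAt_extChartAt_symm q).preimage_mem_nhds (by rwa [extChartAt_to_inv])
    obtain ⟨ρ, hρ, hsub⟩ := Metric.mem_nhds_iff.1 hpre
    rw [mem_map]
    filter_upwards [hev (lt_min hρ hδ)] with s hs
    obtain ⟨a, ha, ha'⟩ := exists_orbitDist_eq m hball (G := G) (hs.trans_le (min_le_right _ _))
    have h1 : κ (a • γ s) ∈ Metric.ball (κ q) ρ := by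
      rw [Metric.mem_ball, dist_eq_norm, ha']
      exact hs.trans_le (min_le_left _ _)
    have h2 := hsub h1
    rw [mem_preimage, κ.left_inv ha, mem_preimage, toQuotient_smul] at h2
    exact h2

/-- Principal points accumulate at `q`, and near `q` their coordinate is close to one of two
endpoints; so one fixed endpoint is approached frequently. -/
theorem exists_isEnd {q : M} (hq : q ∉ orbitType M K) :
    ∃ b ∈ ({sInf J, sSup J} : Set ℝ), IsEnd G γ J q b := by
  by_contra! hcon
  have hne : (𝓝[orbitType M K] q).NeBot :=
    mem_closure_iff_nhdsWithin_neBot.1 (hG.dense_principal q)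
  have key : ∀ b ∈ ({sInf J, sSup J} : Set ℝ), ∃ ρ > 0, b ∉ J →
      ∀ᶠ x in 𝓝[orbitType M K] q, ρ ≤ |orbitCoord G γ J x - b| := by
    intro b hb
    -- This happens only for the default value `0` of an unbounded set, of which nothing is
    -- required.
    by_cases hbJ : b ∈ J
    · exact ⟨1, one_pos, fun h => absurd hbJ h⟩
    · have : ¬ ∀ ρ > 0, ∃ᶠ x in 𝓝[orbitType M K] q, |orbitCoord G γ J x - b| < ρ :=
        fun h => hcon b hb (hγ.isEnd_of_frequently hG hq hbJ h)
      push Not at this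
      obtain ⟨ρ, hρ, h⟩ := this
      exact ⟨ρ, hρ, fun _ => by simpa only [not_lt] using h⟩
  obtain ⟨ρ₁, hρ₁, h₁⟩ := key (sInf J) (by simp)
  obtain ⟨ρ₂, hρ₂, h₂⟩ := key (sSup J) (by simp)
  have hlt : min ρ₁ ρ₂ / 2 < min ρ₁ ρ₂ := half_lt_self (lt_min hρ₁ hρ₂)
  have hev := hγ.eventually_near_endpoint hG hq (half_pos (lt_min hρ₁ hρ₂))
  have hev₁ : ∀ᶠ x in 𝓝[orbitType M K] q, sInf J ∉ J → ρ₁ ≤ |orbitCoord G γ J x - sInf J| :=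
    eventually_imp_distrib_left.2 h₁
  have hev₂ : ∀ᶠ x in 𝓝[orbitType M K] q, sSup J ∉ J → ρ₂ ≤ |orbitCoord G γ J x - sSup J| :=
    eventually_imp_distrib_left.2 h₂
  obtain ⟨x, ⟨b, hb, hbJ, hbx⟩, hx₁, hx₂⟩ := (hev.and (hev₁.and hev₂)).exists
  have hm₁ := min_le_left ρ₁ ρ₂
  have hm₂ := min_le_right ρ₁ ρ₂
  rcases hb with rfl | rfl
  · linarith [hx₁ hbJ]
  · linarith [hx₂ hbJ]

theorem t2Space_quotient : T2Space (Quotient (MulAction.orbitRel G M)) := by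
  have : ContinuousSMul G M := ContMDiffSMul.continuousSMul (I := 𝓡 m) (I' := 𝓡 (n + 1)) ∞
  have : ProperSMul G M := properSMul_of_compactSpace G M
  infer_instance

theorem toQuotient_eq_of_isEnd {q q' : M} {b : ℝ} (h : IsEnd G γ J q b) (h' : IsEnd G γ J q' b) :
    toQuotient G q = toQuotient G q' := by
  have := hγ.t2Space_quotient hG
  have : (𝓝[J] b).NeBot := mem_closure_iff_nhdsWithin_neBot.1 h.2.1
  exact tendsto_nhds_unique h.2.2 h'.2.2

/-- Both ends cannot converge to the same non-principal orbit, since the orbit space would be a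
circle. -/
theorem not_isEnd_of_lt {q : M} (hq : q ∉ orbitType M K) {b b' : ℝ} (hbb' : b < b')
    (h : IsEnd G γ J q b) : ¬ IsEnd G γ J q b' := by
  intro h'
  have hT2 := hγ.t2Space_quotient hG
  have hcs : ContinuousSMul G M := ContMDiffSMul.continuousSMul (I := 𝓡 m) (I' := 𝓡 (n + 1)) ∞
  have hJ : J = Ioo b b' := by
    ext s
    constructor
    · intro hs
      have hsb : s ≠ b := fun e => h.1 (e ▸ hs)
      have hsb' : s ≠ b' := fun e => h'.1 (e ▸ hs)
      constructor
      · by_contra! hle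
        obtain ⟨x, hx, hxb⟩ := Metric.mem_closure_iff.1 h'.2.1 (b' - b) (by linarith)
        rw [Real.dist_eq, abs_lt] at hxb
        exact h.1 (hγ.ordConnected.out hs hx ⟨hle, by linarith⟩)
      · by_contra! hle
        obtain ⟨x, hx, hxb⟩ := Metric.mem_closure_iff.1 h.2.1 (b' - b) (by linarith)
        rw [Real.dist_eq, abs_lt] at hxb
        exact h'.1 (hγ.ordConnected.out hx hs ⟨by linarith, hle⟩)
    · rintro ⟨hs, hs'⟩
      obtain ⟨x, hx, hxb⟩ := Metric.mem_closure_iff.1 h.2.1 (s - b) (by linarith)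
      obtain ⟨y, hy, hyb⟩ := Metric.mem_closure_iff.1 h'.2.1 (b' - s) (by linarith)
      rw [Real.dist_eq, abs_lt] at hxb hyb
      exact hγ.ordConnected.out hx hy ⟨by linarith, by linarith⟩
  subst hJ
  classical
  -- The projected geodesic, closed up at both ends by the orbit of `q`, is a loop in the orbit
  -- space; it is shown to be a bijective image of a circle.
  set f : ℝ → Quotient (MulAction.orbitRel G M) := fun s =>
    if s ∈ Ioo b b' then toQuotient G (γ s) else toQuotient G q
  have hf : ∀ s ∈ Ioo b b', f s = toQuotient G (γ s) := fun s hs => if_pos hs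
  have hfb : f b = toQuotient G q := if_neg (by simp)
  have hfb' : f b' = toQuotient G q := if_neg (by simp)
  have hπ : Continuous (toQuotient G : M → _) :=
    (MulAction.isOpenQuotientMap_quotientMk (Γ := G) (T := M)).continuous
  have hfJ : ContinuousOn f (Ioo b b') :=
    (hπ.comp_continuousOn (hγ.continuousOn_curve hG)).congr hf
  have hIcc : Icc b b' = insert b (insert b' (Ioo b b')) := by
    rw [Ioo_insert_right hbb', Ioc_insert_left hbb'.le]
  have hcont : ContinuousOn f (Icc b b') := by
    intro s hs
    rw [hIcc]
    rcases eq_endpoints_or_mem_Ioo_of_mem_Icc hs with rfl | rfl | hs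
    · rw [continuousWithinAt_insert_self, ContinuousWithinAt, nhdsWithin_insert_of_ne hbb'.ne, hfb]
      exact h.2.2.congr' (eventually_mem_nhdsWithin.mono fun s hs => (hf s hs).symm)
    · rw [insert_comm, continuousWithinAt_insert_self, ContinuousWithinAt,
        nhdsWithin_insert_of_ne hbb'.ne', hfb']
      exact h'.2.2.congr' (eventually_mem_nhdsWithin.mono fun s hs => (hf s hs).symm)
    · exact (hfJ.continuousAt (isOpen_Ioo.mem_nhds hs)).continuousWithinAt
  have hp : Fact (0 < b' - b) := ⟨by linarith⟩
  have hbp : b + (b' - b) = b' := by ring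
  have hF : Continuous (AddCircle.liftIco (b' - b) b f) :=
    AddCircle.liftIco_continuous (by rw [hbp, hfb, hfb']) (by rwa [hbp])
  have hcurve : ∀ s ∈ Ioo b b', ∀ x, toQuotient G (γ s) = toQuotient G x → x ∈ orbitType M K ∧
      orbitCoord G γ (Ioo b b') x = s := by
    intro s hs x hx
    obtain ⟨a, ha⟩ := toQuotient_eq_iff.1 hx.symm
    exact ⟨ha ▸ smul_mem_orbitType (hγ.mem_principal s hs) a,
      ha ▸ hγ.orbitCoord_smul_curve hs a⟩
  have hbij : Function.Bijective (AddCircle.liftIco (b' - b) b f) := by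
    constructor
    · intro x y hxy
      obtain ⟨s, hs, rfl⟩ := (AddCircle.coe_image_Ico_eq (b' - b) b).symm ▸ mem_univ x
      obtain ⟨s', hs', rfl⟩ := (AddCircle.coe_image_Ico_eq (b' - b) b).symm ▸ mem_univ y
      rw [AddCircle.liftIco_coe_apply hs, AddCircle.liftIco_coe_apply hs'] at hxy
      rw [hbp] at hs hs'
      rcases eq_left_or_mem_Ioo_of_mem_Ico hs with rfl | hs <;>
        rcases eq_left_or_mem_Ioo_of_mem_Ico hs' with rfl | hs'
      · rfl
      · rw [hfb, hf _ hs'] at hxy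
        exact absurd (hcurve _ hs' _ hxy.symm).1 hq
      · rw [hfb, hf _ hs] at hxy
        exact absurd (hcurve _ hs _ hxy).1 hq
      · rw [hf _ hs, hf _ hs'] at hxy
        rw [← (hcurve _ hs _ hxy).2, hγ.orbitCoord_curve hs']
    · intro y
      obtain ⟨x, rfl⟩ := Quotient.exists_rep y
      by_cases hx : x ∈ orbitType M K
      · have hs := hγ.orbitCoord_mem hx
        obtain ⟨a, ha⟩ := hγ.exists_smul_curve hx
        refine ⟨(orbitCoord G γ (Ioo b b') x : ℝ), ?_⟩
        rw [AddCircle.liftIco_coe_apply (by rw [hbp]; exact Ioo_subset_Ico_self hs), hf _ hs]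
        exact toQuotient_eq_iff.2 ⟨a⁻¹, by rw [inv_smul_eq_iff, ha]⟩
      -- Any non-principal orbit is reached at an end of `J`, hence coincides with the orbit of `q`
      -- by uniqueness of limits.
      · obtain ⟨b'', -, hb''⟩ := hγ.exists_isEnd hG hx
        refine ⟨(b : ℝ), ?_⟩
        rw [AddCircle.liftIco_coe_apply (by rw [hbp]; exact left_mem_Ico.2 hbb'), hfb]
        have hmem : b'' ∈ Icc b b' := by
          rw [← closure_Ioo hbb'.ne]; exact hb''.2.1
        rcases eq_endpoints_or_mem_Ioo_of_mem_Icc hmem with rfl | rfl | hmem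
        · exact hγ.toQuotient_eq_of_isEnd hG h hb''
        · exact hγ.toQuotient_eq_of_isEnd hG h' hb''
        · exact absurd hmem hb''.1
  have hcpt : CompactSpace (AddCircle (b' - b)) := inferInstance
  let e : AddCircle (b' - b) ≃ₜ Quotient (MulAction.orbitRel G M) :=
    Continuous.homeoOfEquivCompactToT2 (f := Equiv.ofBijective _ hbij) hF
  exact hG.not_circle ⟨e.symm.trans (AddCircle.homeomorphCircle (by linarith))⟩

theorem isEnd_unique {q : M} (hq : q ∉ orbitType M K) {b b' : ℝ} (h : IsEnd G γ J q b)
    (h' : IsEnd G γ J q b') : b = b' := by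
  rcases lt_trichotomy b b' with hlt | heq | hlt
  · exact absurd h' (hγ.not_isEnd_of_lt hG hq hlt h)
  · exact heq
  · exact absurd h (hγ.not_isEnd_of_lt hG hq hlt h')

/-- If the coordinate accumulated at another endpoint, that endpoint would also be an end for `q`,
against `isEnd_unique`. This is where excluding a circular orbit space matters: with two ends
leading to `q`, there would be no limit. -/
theorem tendsto_orbitCoord {q : M} (hq : q ∉ orbitType M K) {b : ℝ} (h : IsEnd G γ J q b) :
    Tendsto (orbitCoord G γ J) (𝓝[orbitType M K] q) (𝓝[J] b) := by
  have hmemJ : ∀ᶠ x in 𝓝[orbitType M K] q, orbitCoord G γ J x ∈ J :=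
    eventually_mem_nhdsWithin.mono fun x hx => hγ.orbitCoord_mem hx
  refine tendsto_nhdsWithin_iff.2 ⟨Metric.tendsto_nhds.2 fun ρ hρ => ?_, hmemJ⟩
  have key : ∀ b' : ℝ, ∃ ρ' > 0, b' ∉ J → b' ≠ b →
      ∀ᶠ x in 𝓝[orbitType M K] q, ρ' ≤ |orbitCoord G γ J x - b'| := by
    intro b'
    by_cases hbJ : b' ∉ J ∧ b' ≠ b
    · have : ¬ ∀ ρ > 0, ∃ᶠ x in 𝓝[orbitType M K] q, |orbitCoord G γ J x - b'| < ρ :=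
        fun hfr => hbJ.2 (hγ.isEnd_unique hG hq (hγ.isEnd_of_frequently hG hq hbJ.1 hfr) h)
      push Not at this
      obtain ⟨ρ, hρ, h⟩ := this
      exact ⟨ρ, hρ, fun _ _ => by simpa only [not_lt] using h⟩
    · exact ⟨1, one_pos, fun h1 h2 => absurd ⟨h1, h2⟩ hbJ⟩
  obtain ⟨ρ₁, hρ₁, h₁⟩ := key (sInf J)
  obtain ⟨ρ₂, hρ₂, h₂⟩ := key (sSup J)
  have hpos : 0 < min ρ (min ρ₁ ρ₂) := lt_min hρ (lt_min hρ₁ hρ₂)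
  have hlt := half_lt_self hpos
  have hm : min ρ (min ρ₁ ρ₂) ≤ ρ := min_le_left _ _
  have hm₁ : min ρ (min ρ₁ ρ₂) ≤ ρ₁ := (min_le_right _ _).trans (min_le_left _ _)
  have hm₂ : min ρ (min ρ₁ ρ₂) ≤ ρ₂ := (min_le_right _ _).trans (min_le_right _ _)
  have hev₁ : ∀ᶠ x in 𝓝[orbitType M K] q, sInf J ∉ J ∧ sInf J ≠ b →
      ρ₁ ≤ |orbitCoord G γ J x - sInf J| :=
    eventually_imp_distrib_left.2 fun hh => h₁ hh.1 hh.2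
  have hev₂ : ∀ᶠ x in 𝓝[orbitType M K] q, sSup J ∉ J ∧ sSup J ≠ b →
      ρ₂ ≤ |orbitCoord G γ J x - sSup J| :=
    eventually_imp_distrib_left.2 fun hh => h₂ hh.1 hh.2
  filter_upwards [hγ.eventually_near_endpoint hG hq (half_pos hpos), hev₁, hev₂]
    with x ⟨b', hb', hbJ, hbx⟩ hx₁ hx₂
  rw [Real.dist_eq]
  by_cases hbb : b' = b
  · subst hbb; linarith
  · exfalso
    rcases hb' with rfl | rfl
    · linarith [hx₁ ⟨hbJ, hbb⟩]
    · linarith [hx₂ ⟨hbJ, hbb⟩]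

end IsNormalGeodesic

end Ends

/-! ### Positive definite forms -/

section Linear

/-- Functionals on a subspace are represented by a positive definite form. -/
theorem exists_representing_vector {E : Type*} [AddCommGroup E] [Module ℝ E]
    [FiniteDimensional ℝ E] (B : E →ₗ[ℝ] E →ₗ[ℝ] ℝ) (hB : ∀ v, v ≠ 0 → 0 < B v v)
    (W : Submodule ℝ E) (l : E →ₗ[ℝ] ℝ) : ∃ v ∈ W, ∀ w ∈ W, B v w = l w := by
  set T : W →ₗ[ℝ] Module.Dual ℝ W := (B.domRestrict₁₂ W W)
  have hinj : Function.Injective T := by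
    refine (injective_iff_map_eq_zero T).2 fun w hw => ?_
    by_contra h
    have h1 := hB w (fun h0 => h (Subtype.ext h0))
    have h2 : T w w = 0 := by rw [hw]; rfl
    exact h1.ne' h2
  have hsurj := (LinearMap.injective_iff_surjective_of_finrank_eq_finrank
    (Subspace.dual_finrank_eq (K := ℝ) (V := W)).symm).1 hinj
  obtain ⟨v, hv⟩ := hsurj (l.domRestrict W)
  refine ⟨v, v.2, fun w hw => ?_⟩
  exact congrArg (fun φ => φ ⟨w, hw⟩) hv

theorem ContinuousAt.eventually_norm_sub_lt {X F : Type*} [TopologicalSpace X]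
    [SeminormedAddCommGroup F] {f : X → F} {x : X} (hf : ContinuousAt f x) {c : ℝ} (hc : 0 < c) :
    ∀ᶠ y in 𝓝 x, ‖f y - f x‖ < c := by
  simpa only [dist_eq_norm] using Metric.tendsto_nhds.1 hf c hc

/-- The minimum over the unit sphere gives a constant at `x`; half of it absorbs the variation of
`A`. -/
theorem eventually_coercive {X E : Type*} [TopologicalSpace X] [NormedAddCommGroup E]
    [NormedSpace ℝ E] [FiniteDimensional ℝ E] {A : X → E →L[ℝ] E →L[ℝ] ℝ} {x : X}
    (hA : ContinuousAt A x) (hpos : ∀ v, v ≠ 0 → 0 < A x v v) :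
    ∃ C > 0, ∀ᶠ y in 𝓝 x, ∀ v, C * ‖v‖ ^ 2 ≤ A y v v := by
  have : ProperSpace E := FiniteDimensional.proper ℝ E
  obtain ⟨C, hC, hle⟩ : ∃ C > 0, ∀ v, C * ‖v‖ ^ 2 ≤ A x v v := by
    rcases (Metric.sphere (0 : E) 1).eq_empty_or_nonempty with he | hne
    · refine ⟨1, one_pos, fun v => ?_⟩
      by_cases hv : v = 0
      · simp [hv]
      · have : ‖v‖⁻¹ • v ∈ Metric.sphere (0 : E) 1 := by simp [norm_smul, hv]
        rw [he] at this; exact absurd this (by simp)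
    · have hcont : Continuous fun v => A x v v :=
        (A x).continuous₂.comp (continuous_id.prodMk continuous_id)
      obtain ⟨v₀, hv₀, hmin⟩ := (isCompact_sphere _ _).exists_isMinOn hne hcont.continuousOn
      have hv₀0 : v₀ ≠ 0 := by rintro rfl; simp at hv₀
      refine ⟨A x v₀ v₀, hpos v₀ hv₀0, fun v => ?_⟩
      by_cases hv : v = 0
      · simp [hv]
      · have h1 : ‖v‖⁻¹ • v ∈ Metric.sphere (0 : E) 1 := by simp [norm_smul, hv]
        have h2 : A x v₀ v₀ ≤ A x (‖v‖⁻¹ • v) (‖v‖⁻¹ • v) := hmin h1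
        simp only [map_smul, smul_apply, smul_eq_mul] at h2
        have h3 : 0 < ‖v‖ := norm_pos_iff.2 hv
        calc A x v₀ v₀ * ‖v‖ ^ 2 ≤ (‖v‖⁻¹ * (‖v‖⁻¹ * A x v v)) * ‖v‖ ^ 2 := by gcongr
          _ = A x v v := by field_simp
  refine ⟨C / 2, by positivity, ?_⟩
  have hev : ∀ᶠ y in 𝓝 x, ‖A y - A x‖ < C / 2 :=
    ContinuousAt.eventually_norm_sub_lt (F := E →L[ℝ] E →L[ℝ] ℝ) hA (by positivity)
  filter_upwards [hev] with y h1 v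
  have h2 : |(A y - A x) v v| ≤ ‖A y - A x‖ * ‖v‖ * ‖v‖ := (A y - A x).le_opNorm₂ v v
  have h3 : ‖A y - A x‖ * ‖v‖ * ‖v‖ ≤ C / 2 * ‖v‖ * ‖v‖ := by gcongr
  have h4 : (A y - A x) v v = A y v v - A x v v := rfl
  have h5 := (abs_le.1 (h2.trans h3)).1
  rw [h4] at h5
  nlinarith [hle v]

end Linear

/-! ### Lower bounds for the metric in a chart -/

section ChartBounds

variable {d : ℕ} {M : Type*} [TopologicalSpace M] [ChartedSpace (EuclideanSpace ℝ (Fin d)) M]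
  [IsManifold (𝓡 d) ∞ M]

/-- Every tangent vector has components in a chart around its base point. -/
theorem exists_chart_components (c : M) {x : M} (hx : x ∈ (extChartAt (𝓡 d) c).source)
    (v : TangentSpace (𝓡 d) x) :
    ∃ e : EuclideanSpace ℝ (Fin d),
      (∀ η : OneForm d M, chartForm η c (extChartAt (𝓡 d) c x) e = η x v) ∧
      ∀ g : Metric d M, chartMetric g c (extChartAt (𝓡 d) c x) e e = g.inner x v v := by
  have hy := (extChartAt (𝓡 d) c).map_source hx
  have hxy := (extChartAt (𝓡 d) c).left_inv hx
  generalize extChartAt (𝓡 d) c x = y at hy hxy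
  subst hxy
  obtain ⟨e, rfl⟩ := (chartFrame_bijective c hy).2 v
  exact ⟨e, fun _ => rfl, fun _ => rfl⟩

theorem exists_closedBall_metric_ge (g : Metric d M) (q : M) :
    ∃ δ > 0, ∃ C > 0, Metric.closedBall (extChartAt (𝓡 d) q q) δ ⊆ (extChartAt (𝓡 d) q).target ∧
      ∀ y ∈ Metric.closedBall (extChartAt (𝓡 d) q q) δ, ∀ v,
        C * ‖v‖ ^ 2 ≤ chartMetric g q y v v := by
  have ht : (extChartAt (𝓡 d) q).target ∈ 𝓝 (extChartAt (𝓡 d) q q) :=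
    extChartAt_target_mem_nhds q
  obtain ⟨C, hC, h⟩ := eventually_coercive
    ((contDiffOn_chartMetric g q).continuousOn.continuousAt ht)
    (fun v hv => chartMetric_pos g q (mem_extChartAt_target q) hv)
  obtain ⟨δ, hδ, hsub⟩ := Metric.nhds_basis_closedBall.mem_iff.1 (inter_mem ht h)
  exact ⟨δ, hδ, C, hC, fun y hy => (hsub hy).1, fun y hy => (hsub hy).2⟩

end ChartBounds

/-! ### Invariant one-forms on the principal part -/

section InvariantForms

variable {n m : ℕ}
  {M : Type*} [TopologicalSpace M]
  [ChartedSpace (EuclideanSpace ℝ (Fin (n + 1))) M] [IsManifold (𝓡 (n + 1)) ∞ M]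
  {G : Type*} [TopologicalSpace G]
  [ChartedSpace (EuclideanSpace ℝ (Fin m)) G] [Group G] [LieGroup (𝓡 m) ∞ G]
  [MulAction G M] [ContMDiffSMul (𝓡 m) (𝓡 (n + 1)) ∞ G M]
  {g : Metric (n + 1) M} {K : Subgroup G} {γ : ℝ → M} {J : Set ℝ}

/-- An invariant one-form vanishes on orbits whose isotropy representation has no trivial
summand. -/
theorem IsInvariantForm.eq_zero_of_hasNoTrivialSummand {η : OneForm (n + 1) M}
    (hη : IsInvariantForm G η) (hg : IsIsometricAction G g) {p : M}
    (hp : HasNoTrivialSummand m (n + 1) G p) {w : TangentSpace (𝓡 (n + 1)) p}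
    (hw : w ∈ orbitTangent m (n + 1) G p) : η p w = 0 := by
  have : FiniteDimensional ℝ (TangentSpace (𝓡 (n + 1)) p) :=
    inferInstanceAs (FiniteDimensional ℝ (EuclideanSpace ℝ (Fin (n + 1))))
  let B : EuclideanSpace ℝ (Fin (n + 1)) →L[ℝ] EuclideanSpace ℝ (Fin (n + 1)) →L[ℝ] ℝ := g.inner p
  let l : EuclideanSpace ℝ (Fin (n + 1)) →L[ℝ] ℝ := η p
  let W : Submodule ℝ (EuclideanSpace ℝ (Fin (n + 1))) := orbitTangent m (n + 1) G p
  have hpos : ∀ v, v ≠ 0 → 0 < B v v := fun v hv => g.pos p v hv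
  obtain ⟨v, hv, hrep⟩ := exists_representing_vector
    ((ContinuousLinearMap.coeLM ℝ).comp B.toLinearMap) hpos W l.toLinearMap
  replace hrep : ∀ w ∈ W, B v w = l w := hrep
  suffices hv0 : v = 0 by
    have := hrep w hw
    rw [hv0] at this
    exact this.symm.trans (by rw [map_zero]; rfl)
  refine hp v hv fun k hk => ?_
  have hkp : k • p = p := hk
  let φ : EuclideanSpace ℝ (Fin (n + 1)) →L[ℝ] EuclideanSpace ℝ (Fin (n + 1)) :=
    dAct (n + 1) k p
  have hφW : φ v ∈ W := by
    have h1 := map_dAct_orbitTangent_le (m := m) (d := n + 1) k p ⟨v, hv, rfl⟩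
    -- The points `k • p` and `p` agree only propositionally; the statement is generalised over the
    -- point and read in the model space.
    have h2 : ∀ p' : M, p' = p → ∀ x : EuclideanSpace ℝ (Fin (n + 1)),
        x ∈ (orbitTangent m (n + 1) G p' : Submodule ℝ (EuclideanSpace ℝ (Fin (n + 1)))) → x ∈ W := by
      rintro _ rfl x hx; exact hx
    exact h2 _ hkp _ h1
  have hφB : ∀ x y, B (φ x) (φ y) = B x y := by
    have h2 : ∀ p' : M, p' = p → ∀ x y : EuclideanSpace ℝ (Fin (n + 1)),
        (g.inner p' : EuclideanSpace ℝ (Fin (n + 1)) →L[ℝ] EuclideanSpace ℝ (Fin (n + 1)) →L[ℝ] ℝ)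
          x y = B x y := by
      rintro _ rfl x y; rfl
    exact fun x y => (h2 _ hkp _ _).symm.trans (hg k p x y)
  have hφl : ∀ x, l (φ x) = l x := by
    have h2 : ∀ p' : M, p' = p → ∀ x : EuclideanSpace ℝ (Fin (n + 1)),
        (η p' : EuclideanSpace ℝ (Fin (n + 1)) →L[ℝ] ℝ) x = l x := by
      rintro _ rfl x; rfl
    exact fun x => (h2 _ hkp _).symm.trans (hη k p x)
  -- Expanding by invariance of `B` and the representing property leaves `l v - 2 * l (φ v) + l v`,
  -- which vanishes because `l` is invariant.
  have h0 : B (φ v - v) (φ v - v) = 0 := by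
    have hs : B (φ v) v = B v (φ v) := g.symm p _ _
    simp only [map_sub, sub_apply, hφB, hs, hrep v hv, hrep _ hφW, hφl]
    ring
  by_contra hne
  exact (hpos _ (sub_ne_zero.2 hne)).ne' h0

namespace IsNormalGeodesic

variable (hγ : IsNormalGeodesic m g K γ J) (hG : IsCohomogeneityOne m g K)
include hγ hG

/-- Translate to the geodesic and split the vector: the orbit part contributes nothing, and the
other part is a multiple of the velocity given by `dt`. -/
theorem invariantForm_apply {η : OneForm (n + 1) M} (hη : IsInvariantForm G η)
    (hT : ∀ p ∈ orbitType M K, HasNoTrivialSummand m (n + 1) G p) {p : M} (hp : p ∈ orbitType M K)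
    (v : TangentSpace (𝓡 (n + 1)) p) :
    η p v = η (γ (orbitCoord G γ J p)) (velocity (n + 1) γ (orbitCoord G γ J p)) *
      mvfderiv (𝓡 (n + 1)) (orbitCoord G γ J) p v := by
  obtain ⟨a, ha⟩ := hγ.exists_smul_curve hp
  have hs := hγ.orbitCoord_mem hp
  generalize orbitCoord G γ J p = s at ha hs ⊢
  subst ha
  obtain ⟨v, rfl⟩ := (dActEquiv m a (γ s)).surjective v
  have hγs := hγ.mem_principal s hs
  rw [dActEquiv_apply, hη, hγ.mvfderiv_orbitCoord_smul hG hγs]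
  obtain ⟨w, hw, c, rfl⟩ := hγ.exists_decomposition hG hs v
  have h1 := hγ.mvfderiv_orbitCoord_velocity hG hs
  have h2 := hγ.mvfderiv_orbitCoord_orbitTangent hG hγs hw
  have h3 := hη.eq_zero_of_hasNoTrivialSummand hG.isometric (hT _ hγs) hw
  simp only [map_add, map_smul, h1, h2, h3, smul_eq_mul]
  ring

omit hG in
theorem contDiffOn_form_velocity {η : OneForm (n + 1) M} (hη : IsSmoothForm η) :
    ContDiffOn ℝ ∞ (fun s => η (γ s) (velocity (n + 1) γ s)) J := by
  intro s hs
  have hb : ContMDiffWithinAt 𝓘(ℝ, ℝ) (𝓡 (n + 1)) ∞ γ J s := hγ.geodesic.smooth s hs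
  have : ContMDiffWithinAt 𝓘(ℝ, ℝ) ((𝓡 (n + 1)).prod 𝓘(ℝ, ℝ)) ∞
      (fun s => Bundle.TotalSpace.mk' ℝ (E := Bundle.Trivial M ℝ) (γ s)
        (η (γ s) (velocity (n + 1) γ s))) J s := by
    exact ContMDiffWithinAt.clm_bundle_apply (F₁ := EuclideanSpace ℝ (Fin (n + 1)))
      (F₂ := ℝ) (IB := 𝓡 (n + 1)) (E₁ := fun x : M => TangentSpace (𝓡 (n + 1)) x)
      (E₂ := Bundle.Trivial M ℝ) (b := γ)
      (ϕ := fun s => η (γ s)) (v := fun s => velocity (n + 1) γ s)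
      (hη.contMDiffAt.comp_contMDiffWithinAt s hb)
      (contMDiffOn_mfderiv_apply hγ.isOpen hγ.geodesic.smooth (1 : ℝ) s hs)
  simp only [Bundle.contMDiffWithinAt_totalSpace] at this
  exact this.2.contDiffWithinAt

end IsNormalGeodesic

end InvariantForms

/-! ### Constancy from countably many values -/

section CountableImages

/-- By the Lindelöf property, countably many neighbourhoods on which `f` is constant cover `S`. -/
theorem countable_image_of_eventually_eq {X Y : Type*} [TopologicalSpace X]
    [SecondCountableTopology X] {f : X → Y} {S : Set X}
    (h : ∀ x ∈ S, ∀ᶠ y in 𝓝[S] x, f y = f x) : (f '' S).Countable := by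
  obtain ⟨T, -, hT, hST⟩ := TopologicalSpace.countable_cover_nhdsWithin
    (f := fun x => {y | f y = f x}) h
  refine (hT.image f).mono ?_
  rintro _ ⟨x, hx, rfl⟩
  obtain ⟨y, hy, hxy⟩ := mem_iUnion₂.1 (hST hx)
  exact ⟨y, hy, hxy.symm⟩

/-- A continuous function on a connected open set `D` with countably many values on a dense open
invariant set is constant, provided the complement consists of finitely many orbits. -/
theorem eq_of_countable_image_of_finite_orbits {X G : Type*} [TopologicalSpace X]
    [TopologicalSpace G] [SecondCountableTopology G] [LocallyConnectedSpace G] [Group G]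
    [ContinuousMul G] [MulAction G X] [ContinuousSMul G X] {P D : Set X} {w : X → ℝ}
    (hdense : Dense P) (hinv : ∀ (a : G), ∀ x ∈ P, a • x ∈ P)
    {S : Set X} (hS : S.Finite) (hPS : ∀ x ∉ P, ∃ q ∈ S, ∃ a : G, a • q = x)
    (hDo : IsOpen D) (hD : IsPreconnected D) (hw : ContinuousOn w D)
    (hc : (w '' (D ∩ P)).Countable) {x y : X} (hx : x ∈ D) (hy : y ∈ D) : w x = w y := by
  have horb : ∀ q : X, ((fun a : G => w (a • q)) '' {a | a • q ∈ D}).Countable := by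
    intro q
    refine countable_image_of_eventually_eq fun a₀ ha₀ => mem_nhdsWithin_of_mem_nhds ?_
    have hcont : ContinuousAt (fun p : G × X => p.1 • p.2) (1, a₀ • q) :=
      continuous_smul.continuousAt
    have hev : ∀ᶠ p : G × X in 𝓝 (1, a₀ • q), p.1 • p.2 ∈ D :=
      hcont.eventually_mem (hDo.mem_nhds (by simpa using ha₀))
    obtain ⟨A, hA, W, hW, hAW⟩ := mem_nhds_prod_iff.1 hev
    obtain ⟨A', ⟨hA'o, h1A', hA'c⟩, hA'A⟩ :=
      (LocallyConnectedSpace.open_connected_basis (1 : G)).mem_iff.1 hA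
    -- For a principal `x`, the connected set `A'` moves `x` within `D ∩ P`, where `w` has countably
    -- many values; a connected subset of a countable set of reals is a point.
    have hconst : ∀ a ∈ A', ∀ x ∈ W ∩ P, w (a • x) = w x := by
      intro a ha x hx
      have hmaps : ∀ b ∈ A', b • x ∈ D := fun b hb =>
        hAW (show (b, x) ∈ A ×ˢ W from ⟨hA'A hb, hx.1⟩)
      have h1 : IsPreconnected ((fun b : G => w (b • x)) '' A') :=
        hA'c.isPreconnected.image _ (hw.comp (by fun_prop) hmaps)
      have h2 : (fun b : G => w (b • x)) '' A' ⊆ w '' (D ∩ P) := by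
        rintro _ ⟨b, hb, rfl⟩
        exact ⟨_, ⟨hmaps b hb, hinv b x hx.2⟩, rfl⟩
      have h3 := hc.isTotallyDisconnected _ h2 h1 ⟨a, ha, rfl⟩ ⟨1, h1A', rfl⟩
      simpa using h3
    -- Density of `P` carries the invariance to the limit point `a₀ • q`, so `w` is locally constant
    -- in the group element along the orbit of `q`.
    have hconst' : ∀ a ∈ A', w (a • a₀ • q) = w (a₀ • q) := by
      intro a ha
      have hmem : a • a₀ • q ∈ D :=
        hAW (show (a, a₀ • q) ∈ A ×ˢ W from ⟨hA'A ha, mem_of_mem_nhds hW⟩)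
      have hne : (𝓝[P] (a₀ • q)).NeBot := mem_closure_iff_nhdsWithin_neBot.1 (hdense _)
      have t1 : Tendsto w (𝓝[P] (a₀ • q)) (𝓝 (w (a₀ • q))) :=
        (hw.continuousAt (hDo.mem_nhds ha₀)).tendsto.mono_left nhdsWithin_le_nhds
      have t2 : Tendsto (fun x => w (a • x)) (𝓝[P] (a₀ • q)) (𝓝 (w (a • a₀ • q))) :=
        (ContinuousAt.comp (f := fun x => a • x) (hw.continuousAt (hDo.mem_nhds hmem))
          (continuous_const_smul a).continuousAt).tendsto.mono_left nhdsWithin_le_nhds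
      refine tendsto_nhds_unique (t2.congr' ?_) t1
      filter_upwards [mem_nhdsWithin_of_mem_nhds hW, self_mem_nhdsWithin] with x hxW hxP
      exact hconst a ha x ⟨hxW, hxP⟩
    have hnb : ∀ᶠ a in 𝓝 a₀, a * a₀⁻¹ ∈ A' :=
      (continuous_mul_const a₀⁻¹).continuousAt.eventually_mem
        (hA'o.mem_nhds (by simpa using h1A'))
    filter_upwards [hnb] with a ha
    simpa [smul_smul] using hconst' _ ha
  have hcount : (w '' D).Countable := by
    refine (hc.union (hS.countable.biUnion fun q _ => horb q)).mono ?_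
    rintro _ ⟨x, hx, rfl⟩
    by_cases hxP : x ∈ P
    · exact Or.inl ⟨x, ⟨hx, hxP⟩, rfl⟩
    · obtain ⟨q, hq, a, rfl⟩ := hPS x hxP
      exact Or.inr (mem_biUnion hq ⟨a, hx, rfl⟩)
  exact hcount.isTotallyDisconnected _ Subset.rfl (hD.image w hw) ⟨x, hx, rfl⟩ ⟨y, hy, rfl⟩

end CountableImages

/-! ### Potentials across the complement of a dense open set -/

section Potentials

/-- Where a potential exists this is the symmetry of second derivatives; continuity of `fderiv ℝ β`
and density extend it. -/
theorem fderiv_symmetric_of_dense_potential {E : Type*} [NormedAddCommGroup E] [NormedSpace ℝ E]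
    {β : E → E →L[ℝ] ℝ} {Ω P : Set E} (hΩ : IsOpen Ω) (hβ : ContDiffOn ℝ ∞ β Ω) (hP : IsOpen P)
    (hdense : Ω ⊆ closure (Ω ∩ P)) {Φ : E → ℝ} (hΦ : ∀ y ∈ Ω ∩ P, HasFDerivAt Φ (β y) y)
    {y : E} (hy : y ∈ Ω) (u v : E) : fderiv ℝ β y u v = fderiv ℝ β y v u := by
  have hcont : ∀ u v, ContinuousOn (fun y => fderiv ℝ β y u v) Ω := fun u v =>
    ((hβ.continuousOn_fderiv_of_isOpen hΩ (by simp)).clm_apply continuousOn_const).clm_apply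
      continuousOn_const
  have hne : (𝓝[Ω ∩ P] y).NeBot := mem_closure_iff_nhdsWithin_neBot.1 (hdense hy)
  have ht : ∀ u v, Tendsto (fun y => fderiv ℝ β y u v) (𝓝[Ω ∩ P] y) (𝓝 (fderiv ℝ β y u v)) :=
    fun u v => (hcont u v y hy).mono inter_subset_left
  refine tendsto_nhds_unique (ht u v) ((ht v u).congr' ?_)
  filter_upwards [self_mem_nhdsWithin] with z hz
  have hzΩ : Ω ∩ P ∈ 𝓝 z := (hΩ.inter hP).mem_nhds hz
  exact second_derivative_symmetric_of_eventually_of_real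
    (eventually_of_mem hzΩ hΦ)
    ((hβ.differentiableOn (by simp)).differentiableAt (hΩ.mem_nhds hz.1)).hasFDerivAt v u

/-- A smooth one-form which is exact on a dense open invariant set, with a potential that has
limits everywhere, is exact if the complement of this set consists of finitely many orbits. -/
theorem exists_isPotential_of_dense (m : ℕ) {d : ℕ}
    {M : Type*} [TopologicalSpace M] [T2Space M]
    [ChartedSpace (EuclideanSpace ℝ (Fin d)) M] [IsManifold (𝓡 d) ∞ M]
    (G : Type*) [TopologicalSpace G] [CompactSpace G]
    [ChartedSpace (EuclideanSpace ℝ (Fin m)) G] [Group G] [LieGroup (𝓡 m) ∞ G]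
    [MulAction G M] [ContMDiffSMul (𝓡 m) (𝓡 d) ∞ G M]
    {η : OneForm d M} (hη : IsSmoothForm η) {P : Set M}
    (hP : IsOpen P) (hdense : Dense P) (hinv : ∀ (a : G), ∀ x ∈ P, a • x ∈ P) {S : Set M}
    (hS : S.Finite) (hPS : ∀ x ∉ P, ∃ q ∈ S, ∃ a : G, a • q = x) {Φ : M → ℝ}
    (hΦ : ∀ p ∈ P, MDifferentiableAt (𝓡 d) 𝓘(ℝ, ℝ) Φ p ∧ mvfderiv (𝓡 d) Φ p = η p)
    (hlim : ∀ q, ∃ l, Tendsto Φ (𝓝[P] q) (𝓝 l)) : ∃ U : M → ℝ, IsPotential U η := by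
  have : SecondCountableTopology G :=
    ChartedSpace.secondCountable_of_sigmaCompact (EuclideanSpace ℝ (Fin m)) G
  have : LocallyConnectedSpace G :=
    ChartedSpace.locallyConnectedSpace (EuclideanSpace ℝ (Fin m)) G
  have : ContinuousMul G := (IsTopologicalGroup.toContinuousMul (G := G) (self := topologicalGroup_of_lieGroup (𝓡 m) ∞))
  have : ContinuousSMul G M := ContMDiffSMul.continuousSMul (I := 𝓡 m) (I' := 𝓡 d) (n := ∞)
  set h := extendFrom P Φ
  have hcont : Continuous h := continuous_extendFrom hdense hlim
  have hext : ∀ x ∈ P, h x = Φ x := extendFrom_extends fun x hx =>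
    (hΦ x hx).1.continuousAt.continuousWithinAt
  suffices key : ∀ q, ContMDiffAt (𝓡 d) 𝓘(ℝ, ℝ) ∞ h q ∧ η q = mvfderiv (𝓡 d) h q from
    ⟨h, fun q => (key q).1, fun q => (key q).2⟩
  intro q
  set κ := extChartAt (𝓡 d) q with hκ
  have hto : IsOpen κ.target := isOpen_extChartAt_target q
  have hso : IsOpen κ.source := isOpen_extChartAt_source q
  have hsymm : ContinuousOn κ.symm κ.target := continuousOn_extChartAt_symm q
  have hβ : ContDiffOn ℝ ∞ (chartForm η q) κ.target := contDiffOn_chartForm hη q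
  obtain ⟨P', hP'o, hP'⟩ := (continuousOn_iff'.1 hsymm) P hP
  have hmemP : ∀ y ∈ κ.target, (y ∈ P' ↔ κ.symm y ∈ P) := fun y hy =>
    ⟨fun h => (hP'.superset ⟨h, hy⟩).1, fun h => (hP'.subset ⟨h, hy⟩).1⟩
  have hderiv : ∀ y ∈ κ.target ∩ P', HasFDerivAt (fun z => h (κ.symm z)) (chartForm η q y) y := by
    rintro y ⟨hy, hyP⟩
    have hyP' := (hmemP y hy).1 hyP
    obtain ⟨h1, h2⟩ := hΦ _ hyP'
    have h3 := hasFDerivAt_comp_extChartAt_symm q hy h1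
    have h4 : chartForm (mvfderiv (𝓡 d) Φ) q y = chartForm η q y := by
      ext v
      exact congrArg (fun L => L (chartFrame q y v)) h2
    rw [h4] at h3
    refine h3.congr_of_eventuallyEq ?_
    filter_upwards [(hto.inter hP'o).mem_nhds ⟨hy, hyP⟩] with z hz
    exact hext _ ((hmemP z hz.1).1 hz.2)
  have hdense' : κ.target ⊆ closure (κ.target ∩ P') := by
    intro y hy
    rw [mem_closure_iff]
    intro O hO hyO
    have h1 : IsOpen (κ.source ∩ κ ⁻¹' O) :=
      (continuousOn_extChartAt q).isOpen_inter_preimage hso hO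
    obtain ⟨x, ⟨hx, hxO⟩, hxP⟩ := hdense.inter_open_nonempty _ h1
      ⟨κ.symm y, κ.map_target hy, by rwa [mem_preimage, κ.right_inv hy]⟩
    exact ⟨κ x, hxO, κ.map_source hx, (hmemP _ (κ.map_source hx)).2 (by rwa [κ.left_inv hx])⟩
  obtain ⟨r, hr, hball⟩ := Metric.isOpen_iff.1 hto (κ q) (mem_extChartAt_target q)
  set B := Metric.ball (κ q) r
  -- The Poincaré lemma on a coordinate ball provides a primitive independent of the extended
  -- function `h`.
  obtain ⟨V, hV⟩ := (convex_ball (κ q) r).exists_forall_hasFDerivAt_of_fderiv_symmetric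
    Metric.isOpen_ball ((hβ.differentiableOn (by simp)).mono hball)
    (fun y hy u v => fderiv_symmetric_of_dense_potential hto hβ hP'o hdense' hderiv (hball hy) u v)
  set D : Set M := κ.source ∩ κ ⁻¹' B
  have hDo : IsOpen D := (continuousOn_extChartAt q).isOpen_inter_preimage hso Metric.isOpen_ball
  have hDB : D = κ.symm '' B := by
    ext x; constructor
    · rintro ⟨hx, hxB⟩; exact ⟨κ x, hxB, κ.left_inv hx⟩
    · rintro ⟨y, hy, rfl⟩
      exact ⟨κ.map_target (hball hy), by
        change κ (κ.symm y) ∈ B; rw [κ.right_inv (hball hy)]; exact hy⟩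
  have hD : IsPreconnected D := by
    rw [hDB]
    exact (convex_ball (κ q) r).isPreconnected.image _ (hsymm.mono hball)
  have hVc : ContinuousOn V B := fun y hy => (hV y hy).continuousAt.continuousWithinAt
  have hw : ContinuousOn (fun x => h x - V (κ x)) D :=
    hcont.continuousOn.sub (hVc.comp ((continuousOn_extChartAt q).mono inter_subset_left)
      fun x hx => hx.2)
  -- The principal part of the ball may be disconnected, so the difference is only locally constant
  -- there; countability of its values is what can be retained.
  have hc : ((fun x => h x - V (κ x)) '' (D ∩ P)).Countable := by
    have h1 : ((fun y => h (κ.symm y) - V y) '' (B ∩ P')).Countable := by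
      refine countable_image_of_eventually_eq fun y hy => mem_nhdsWithin_of_mem_nhds ?_
      obtain ⟨ρ, hρ, hsub⟩ := Metric.isOpen_iff.1 (Metric.isOpen_ball.inter hP'o) y hy
      have h0 : ∀ z ∈ Metric.ball y ρ, HasFDerivAt (fun y => h (κ.symm y) - V y)
          (0 : EuclideanSpace ℝ (Fin d) →L[ℝ] ℝ) z := fun z hz => by
        have h2 := (hderiv z ⟨hball (hsub hz).1, (hsub hz).2⟩).sub (hV z (hsub hz).1)
        rwa [sub_self] at h2
      filter_upwards [Metric.ball_mem_nhds y hρ] with z hz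
      exact Metric.isOpen_ball.is_const_of_fderiv_eq_zero (𝕜 := ℝ)
        (convex_ball y ρ).isPreconnected
        (fun z hz => (h0 z hz).differentiableAt.differentiableWithinAt)
        (fun z hz => (h0 z hz).fderiv) hz (Metric.mem_ball_self hρ)
    refine h1.mono ?_
    rintro _ ⟨x, ⟨⟨hx, hxB⟩, hxP⟩, rfl⟩
    refine ⟨κ x, ⟨hxB, (hmemP _ (hball hxB)).2 (by rwa [κ.left_inv hx])⟩, ?_⟩
    simp only [κ.left_inv hx]
  have hqD : q ∈ D := ⟨mem_extChartAt_source q, Metric.mem_ball_self hr⟩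
  have hconst : ∀ x ∈ D, h x = V (κ x) + (h q - V (κ q)) := fun x hx => by
    have := eq_of_countable_image_of_finite_orbits (G := G) hdense hinv hS hPS hDo hD hw hc hx hqD
    linarith
  have hVs : ContDiffOn ℝ ∞ V B := by
    refine (contDiffOn_infty_iff_fderiv_of_isOpen Metric.isOpen_ball).2
      ⟨fun y hy => (hV y hy).differentiableAt.differentiableWithinAt,
        (hβ.mono hball).congr fun y hy => (hV y hy).fderiv⟩
  have hsm : ContMDiffAt (𝓡 d) 𝓘(ℝ, ℝ) ∞ h q := by
    have h1 : ContMDiffAt (𝓡 d) 𝓘(ℝ, ℝ) ∞ (fun x => V (κ x) + (h q - V (κ q))) q := by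
      have h2 : ContMDiffAt 𝓘(ℝ, EuclideanSpace ℝ (Fin d)) 𝓘(ℝ, ℝ) ∞ V (κ q) :=
        (hVs.contDiffAt (Metric.ball_mem_nhds _ hr)).contMDiffAt
      exact (h2.comp q contMDiffAt_extChartAt).add contMDiffAt_const
    exact h1.congr_of_eventuallyEq (eventually_of_mem (hDo.mem_nhds hqD) hconst)
  refine ⟨hsm, ?_⟩
  have hqt : κ q ∈ κ.target := mem_extChartAt_target q
  have h1 : HasFDerivAt (fun z => h (κ.symm z)) (chartForm (mvfderiv (𝓡 d) h) q (κ q)) (κ q) := by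
    refine hasFDerivAt_comp_extChartAt_symm q hqt ?_
    rw [extChartAt_to_inv]
    exact hsm.mdifferentiableAt (by simp)
  have h2 : HasFDerivAt (fun z => h (κ.symm z)) (chartForm η q (κ q)) (κ q) := by
    refine ((hV _ (Metric.mem_ball_self hr)).add_const (h q - V (κ q))).congr_of_eventuallyEq ?_
    filter_upwards [Metric.ball_mem_nhds (κ q) hr] with y hy
    have hyD : κ.symm y ∈ D := hDB ▸ ⟨y, hy, rfl⟩
    rw [hconst _ hyD, κ.right_inv (hball hy)]
  ext v
  obtain ⟨e, he, -⟩ := exists_chart_components q (mem_extChartAt_source q) v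
  rw [← he η, ← he (mvfderiv (𝓡 d) h), ← hκ, h1.unique h2]

end Potentials

/-! ### Limits of functions with bounded derivative -/

section Limits

/-- Near `b` the function is Lipschitz on a convex set, so it maps the Cauchy filter at `b` to a
Cauchy filter. -/
theorem exists_tendsto_of_deriv_bounded {E : Type*} [NormedAddCommGroup E] [NormedSpace ℝ E]
    [CompleteSpace E] {J : Set ℝ} (hJ : J.OrdConnected) {F f : ℝ → E} {b : ℝ}
    (hF : ∀ s ∈ J, HasDerivWithinAt F (f s) J s) (hf : ∃ C, ∀ᶠ s in 𝓝[J] b, ‖f s‖ ≤ C) :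
    ∃ l, Tendsto F (𝓝[J] b) (𝓝 l) := by
  obtain ⟨C, hC⟩ := hf
  obtain ⟨ρ, hρ, hsub⟩ := Metric.mem_nhdsWithin_iff.1 hC
  have hlip : LipschitzOnWith C.toNNReal F (Metric.ball b ρ ∩ J) := by
    refine Convex.lipschitzOnWith_of_nnnorm_hasDerivWithin_le (f' := f)
      ((convex_ball b ρ).inter hJ.convex) (fun s hs => (hF s hs.2).mono inter_subset_right)
      fun s hs => ?_
    rw [← NNReal.coe_le_coe, coe_nnnorm]
    exact (hsub hs : ‖f s‖ ≤ C).trans (Real.le_coe_toNNReal C)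
  rcases (𝓝[J] b).eq_or_neBot with hbot | hne
  · exact ⟨0, by rw [hbot]; exact tendsto_bot⟩
  · refine cauchy_map_iff_exists_tendsto.1 ?_
    refine Cauchy.map_of_le (cauchy_nhds.mono nhdsWithin_le_nhds) hlip.uniformContinuousOn ?_
    exact le_principal_iff.2 (inter_mem (mem_nhdsWithin_of_mem_nhds (Metric.ball_mem_nhds b hρ))
      self_mem_nhdsWithin)

end Limits

/-! ### The potential of an invariant form -/

section GradientType

variable {n m : ℕ}
  {M : Type*} [TopologicalSpace M] [T2Space M]
  [ChartedSpace (EuclideanSpace ℝ (Fin (n + 1))) M] [IsManifold (𝓡 (n + 1)) ∞ M]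
  {G : Type*} [TopologicalSpace G] [CompactSpace G]
  [ChartedSpace (EuclideanSpace ℝ (Fin m)) G] [Group G] [LieGroup (𝓡 m) ∞ G]
  [MulAction G M] [ContMDiffSMul (𝓡 m) (𝓡 (n + 1)) ∞ G M]
  {g : Metric (n + 1) M} {K : Subgroup G} {γ : ℝ → M} {J : Set ℝ}

/-- The projection to the orbit space is open, so convergence of orbits provides group elements
moving `γ s` near `q`, although `γ` itself need not converge. -/
theorem IsEnd.eventually_smul_mem (m : ℕ) {d : ℕ} {M : Type*} [TopologicalSpace M]
    [ChartedSpace (EuclideanSpace ℝ (Fin d)) M]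
    {G : Type*} [TopologicalSpace G] [ChartedSpace (EuclideanSpace ℝ (Fin m)) G] [Group G]
    [MulAction G M] [ContMDiffSMul (𝓡 m) (𝓡 d) ∞ G M] {γ : ℝ → M} {J : Set ℝ} {q : M} {b : ℝ}
    (h : IsEnd G γ J q b) {W : Set M} (hW : W ∈ 𝓝 q) : ∀ᶠ s in 𝓝[J] b, ∃ a : G, a • γ s ∈ W := by
  have : ContinuousSMul G M := ContMDiffSMul.continuousSMul (I := 𝓡 m) (I' := 𝓡 d) (n := ∞)
  have h1 : (toQuotient G '' W) ∈ 𝓝 (toQuotient G q) :=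
    (isOpenMap_quotient_mk'_mul (Γ := G) (T := M)).image_mem_nhds hW
  filter_upwards [h.2.2 h1] with s hs
  obtain ⟨x, hx, hxs⟩ := hs
  obtain ⟨a, rfl⟩ := toQuotient_eq_iff.1 hxs
  exact ⟨a, hx⟩

namespace IsNormalGeodesic

variable (hγ : IsNormalGeodesic m g K γ J) (hG : IsCohomogeneityOne m g K)
include hγ hG

/-- Translating `γ s` into a fixed chart ball at `q` changes neither the value of `η` nor the unit
length of the velocity. There the metric is bounded below and the form is bounded above. -/
theorem invariantForm_velocity_bounded {η : OneForm (n + 1) M} (hη : IsSmoothForm η)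
    (hηG : IsInvariantForm G η) {q : M} {b : ℝ} (h : IsEnd G γ J q b) :
    ∃ C, ∀ᶠ s in 𝓝[J] b, |η (γ s) (velocity (n + 1) γ s)| ≤ C := by
  obtain ⟨δ, hδ, c, hc, hball, hmet⟩ := exists_closedBall_metric_ge g q
  set κ := extChartAt (𝓡 (n + 1)) q with hκ
  have hcont : ContinuousAt (fun y => ‖chartForm η q y‖) (κ q) :=
    ((contDiffOn_chartForm hη q).continuousOn.continuousAt (extChartAt_target_mem_nhds q)).norm
  have hb : ∀ᶠ y in 𝓝 (κ q), ‖chartForm η q y‖ < ‖chartForm η q (κ q)‖ + 1 :=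
    hcont.eventually (Iio_mem_nhds (lt_add_one _))
  have hκc : ContinuousAt κ q := continuousAt_extChartAt q
  have hW : κ.source ∩ κ ⁻¹' (Metric.closedBall (κ q) δ ∩
      {y | ‖chartForm η q y‖ < ‖chartForm η q (κ q)‖ + 1}) ∈ 𝓝 q :=
    inter_mem (extChartAt_source_mem_nhds q)
      (hκc (inter_mem (Metric.closedBall_mem_nhds _ hδ) hb))
  refine ⟨(‖chartForm η q (κ q)‖ + 1) * Real.sqrt (1 / c), ?_⟩
  filter_upwards [h.eventually_smul_mem m (d := n + 1) hW, self_mem_nhdsWithin] with s ⟨a, has, hB, hN⟩ hs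
  obtain ⟨e, he, heg⟩ := exists_chart_components q has (dAct (n + 1) a (γ s) (velocity (n + 1) γ s))
  have h1 : chartMetric g q (κ (a • γ s)) e e = 1 := by
    rw [heg, hG.isometric, hγ.unit_speed s hs]
  have h2 : c * ‖e‖ ^ 2 ≤ 1 := h1 ▸ hmet _ hB e
  have h3 : ‖e‖ ≤ Real.sqrt (1 / c) := by
    refine Real.le_sqrt_of_sq_le ?_
    rw [le_div_iff₀ hc]; linarith
  rw [← hηG a, ← he η, ← Real.norm_eq_abs]
  calc _ ≤ ‖chartForm η q (κ (a • γ s))‖ * ‖e‖ := (chartForm η q _).le_opNorm e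
    _ ≤ _ := by
      gcongr
      exact hN.le

/-- Each non-principal orbit is the limit at one of two endpoints, and an endpoint determines its
limit orbit. -/
theorem finite_nonprincipal_orbits : ∃ S : Set M, S.Finite ∧
    ∀ x ∉ orbitType M K, ∃ q ∈ S, ∃ a : G, a • q = x := by
  classical
  let R : ℝ → Set M := fun b => {q | q ∉ orbitType M K ∧ IsEnd G γ J q b}
  let rep : ℝ → Set M := fun b => if h : (R b).Nonempty then {h.some} else ∅
  have hrep : ∀ b, (rep b).Finite := fun b => by
    by_cases h : (R b).Nonempty <;> simp [rep, h]
  refine ⟨rep (sInf J) ∪ rep (sSup J), (hrep _).union (hrep _), fun x hx => ?_⟩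
  obtain ⟨b, hb, hend⟩ := hγ.exists_isEnd hG hx
  have hne : (R b).Nonempty := ⟨x, hx, hend⟩
  have hmem : hne.some ∈ rep b := by simp [rep, hne]
  obtain ⟨a, ha⟩ := toQuotient_eq_iff.1 (hγ.toQuotient_eq_of_isEnd hG hend hne.some_mem.2)
  refine ⟨hne.some, ?_, a, ha⟩
  rcases hb with rfl | rfl
  · exact Or.inl hmem
  · exact Or.inr hmem

/-- On the principal part `F ∘ orbitCoord` is a potential, with `F` a primitive of `η(γ')`.
Boundedness of `η(γ')` at the ends and convergence of the coordinate give it limits at the other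
points. -/
theorem exists_isPotential {η : OneForm (n + 1) M} (hη : IsSmoothForm η)
    (hηG : IsInvariantForm G η)
    (hT : ∀ p ∈ orbitType M K, HasNoTrivialSummand m (n + 1) G p) :
    ∃ U : M → ℝ, IsPotential U η := by
  set f : ℝ → ℝ := fun s => η (γ s) (velocity (n + 1) γ s)
  obtain ⟨F, hF⟩ := hγ.ordConnected.convex.exists_forall_hasDerivWithinAt
    ((hγ.contDiffOn_form_velocity hη).differentiableOn (by simp))
  have hF' : ∀ s ∈ J, HasDerivAt F (f s) s := fun s hs =>
    (hF s hs).hasDerivAt (hγ.isOpen.mem_nhds hs)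
  have hΦ : ∀ p ∈ orbitType M K,
      MDifferentiableAt (𝓡 (n + 1)) 𝓘(ℝ, ℝ) (F ∘ orbitCoord G γ J) p ∧
        mvfderiv (𝓡 (n + 1)) (F ∘ orbitCoord G γ J) p = η p := by
    intro p hp
    have ht := hγ.mdifferentiableAt_orbitCoord hG hp
    have hFp := (hF' _ (hγ.orbitCoord_mem hp))
    have hFm : MDifferentiableAt 𝓘(ℝ, ℝ) 𝓘(ℝ, ℝ) F (orbitCoord G γ J p) :=
      hFp.differentiableAt.mdifferentiableAt
    refine ⟨hFm.comp p ht, ?_⟩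
    ext v
    rw [hγ.invariantForm_apply hG hηG hT hp v]
    have h1 := mfderiv_comp_apply_of_base_eq (I := 𝓡 (n + 1)) (I' := 𝓘(ℝ, ℝ)) (I'' := 𝓘(ℝ, ℝ))
      hFm ht rfl v
    have h2 : ∀ c : ℝ, (mfderiv 𝓘(ℝ, ℝ) 𝓘(ℝ, ℝ) F (orbitCoord G γ J p) c : ℝ)
        = f (orbitCoord G γ J p) * c := fun c => by
      rw [mfderiv_eq_fderiv, hFp.hasFDerivAt.fderiv]
      exact mul_comm c _
    exact h1.trans (h2 _)
  obtain ⟨S, hS, hSorb⟩ := hγ.finite_nonprincipal_orbits hG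
  refine exists_isPotential_of_dense m G hη hG.isOpen_principal hG.dense_principal
    (fun a x hx => smul_mem_orbitType hx a) hS hSorb hΦ fun q => ?_
  by_cases hq : q ∈ orbitType M K
  · exact ⟨_, (hΦ q hq).1.continuousAt.continuousWithinAt⟩
  · obtain ⟨b, -, hend⟩ := hγ.exists_isEnd hG hq
    obtain ⟨l, hl⟩ := exists_tendsto_of_deriv_bounded hγ.ordConnected hF
      (hγ.invariantForm_velocity_bounded hG hη hηG hend)
    exact ⟨l, hl.comp (hγ.tendsto_orbitCoord hG hq hend)⟩

end IsNormalGeodesic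

end GradientType

set_option maxSynthPendingDepth 3

/-! ### The geodesic equation as a smooth second order equation -/

section Spray

variable {E : Type*} [NormedAddCommGroup E] [NormedSpace ℝ E]

/-- The right-hand side of the Euler–Lagrange equation of the energy of the metric `B`. -/
def metricForce (B : E → E →L[ℝ] E →L[ℝ] ℝ) (y v : E) : E →L[ℝ] ℝ :=
  (1 / 2 : ℝ) • ((fderiv ℝ B y).flip v).flip v - fderiv ℝ B y v v

/-- The acceleration of geodesics of the metric `B`. -/
def geodesicSpray (B : E → E →L[ℝ] E →L[ℝ] ℝ) (x : E × E) : E :=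
  (B x.1).inverse (metricForce B x.1 x.2)

theorem metricForce_apply (B : E → E →L[ℝ] E →L[ℝ] ℝ) (y v w : E) :
    metricForce B y v w = (1 / 2) * fderiv ℝ B y w v v - fderiv ℝ B y v v w := rfl

theorem metricForce_neg (B : E → E →L[ℝ] E →L[ℝ] ℝ) (y v : E) :
    metricForce B y (-v) = metricForce B y v := by
  ext w
  simp [metricForce_apply]

/-- The force is quadratic in the velocity. This evenness is what allows geodesics to be reversed
and glued. -/
theorem geodesicSpray_neg (B : E → E →L[ℝ] E →L[ℝ] ℝ) (y v : E) :
    geodesicSpray B (y, -v) = geodesicSpray B (y, v) := by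
  simp only [geodesicSpray, metricForce_neg]

theorem exists_equiv_of_pos [FiniteDimensional ℝ E] {L : E →L[ℝ] E →L[ℝ] ℝ}
    (hL : ∀ v, v ≠ 0 → 0 < L v v) : ∃ e : E ≃L[ℝ] (E →L[ℝ] ℝ), (e : E →L[ℝ] E →L[ℝ] ℝ) = L := by
  have hinj : Function.Injective L.toLinearMap := by
    refine (injective_iff_map_eq_zero _).2 fun v hv => ?_
    by_contra h
    have h1 : L v v = 0 := by
      rw [show L v = 0 from hv]; rfl
    exact (hL v h).ne' h1
  have hdim : Module.finrank ℝ E = Module.finrank ℝ (E →L[ℝ] ℝ) := by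
    rw [← (LinearMap.toContinuousLinearMap : (E →ₗ[ℝ] ℝ) ≃ₗ[ℝ] E →L[ℝ] ℝ).finrank_eq]
    exact (Subspace.dual_finrank_eq (K := ℝ) (V := E)).symm
  have hsurj := (LinearMap.injective_iff_surjective_of_finrank_eq_finrank hdim).1 hinj
  exact ⟨(LinearEquiv.ofBijective L.toLinearMap ⟨hinj, hsurj⟩).toContinuousLinearEquiv, by
    ext; rfl⟩

theorem apply_geodesicSpray [FiniteDimensional ℝ E] {B : E → E →L[ℝ] E →L[ℝ] ℝ} {y : E}
    (hB : ∀ v, v ≠ 0 → 0 < B y v v) (v : E) :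
    B y (geodesicSpray B (y, v)) = metricForce B y v := by
  obtain ⟨e, he⟩ := exists_equiv_of_pos hB
  simp only [geodesicSpray]
  rw [← he, ContinuousLinearMap.inverse_equiv]
  exact e.apply_symm_apply _

theorem eq_geodesicSpray [FiniteDimensional ℝ E] {B : E → E →L[ℝ] E →L[ℝ] ℝ} {y : E}
    (hB : ∀ v, v ≠ 0 → 0 < B y v v) {v a : E} (h : ∀ w, B y a w = metricForce B y v w) :
    a = geodesicSpray B (y, v) := by
  by_contra hne
  refine (hB _ (sub_ne_zero.2 hne)).ne' ?_
  rw [map_sub (B y), sub_apply, apply_geodesicSpray hB, h, sub_self]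

theorem contDiffOn_geodesicSpray [FiniteDimensional ℝ E] {B : E → E →L[ℝ] E →L[ℝ] ℝ} {Ω : Set E}
    (hΩ : IsOpen Ω) (hB : ContDiffOn ℝ ∞ B Ω) (hpos : ∀ y ∈ Ω, ∀ v, v ≠ 0 → 0 < B y v v) :
    ContDiffOn ℝ ∞ (geodesicSpray B) (Ω ×ˢ univ) := by
  have : CompleteSpace E := FiniteDimensional.complete ℝ E
  have hfst : MapsTo (Prod.fst : E × E → E) (Ω ×ˢ univ) Ω := fun x hx => hx.1
  have hB1 : ContDiffOn ℝ ∞ (fun x : E × E => B x.1) (Ω ×ˢ univ) :=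
    hB.comp contDiff_fst.contDiffOn hfst
  have hD1 : ContDiffOn ℝ ∞ (fun x : E × E => fderiv ℝ B x.1) (Ω ×ˢ univ) :=
    (hB.fderiv_of_isOpen hΩ (m := ∞) (by simp)).comp contDiff_fst.contDiffOn hfst
  have hforce : ContDiffOn ℝ ∞ (fun x : E × E => metricForce B x.1 x.2) (Ω ×ˢ univ) := by
    refine contDiffOn_clm_apply.2 fun w => ?_
    simp only [metricForce_apply]
    have hs : ContDiffOn ℝ ∞ (fun x : E × E => x.2) (Ω ×ˢ univ) := contDiff_snd.contDiffOn
    exact (contDiffOn_const.mul (((hD1.clm_apply contDiffOn_const).clm_apply hs).clm_apply hs)).sub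
      (((hD1.clm_apply hs).clm_apply hs).clm_apply contDiffOn_const)
  have hinv : ContDiffOn ℝ ∞ (fun x : E × E => (B x.1).inverse) (Ω ×ˢ univ) := by
    intro x hx
    obtain ⟨e, he⟩ := exists_equiv_of_pos (hpos x.1 hx.1)
    have h1 : ContDiffAt ℝ ∞ (ContinuousLinearMap.inverse : (E →L[ℝ] E →L[ℝ] ℝ) → _) (B x.1) := by
      rw [← he]; exact contDiffAt_map_inverse e
    exact ContDiffAt.comp_contDiffWithinAt x h1 (hB1 x hx)
  exact hinv.clm_apply hforce

/-- Local isometries map solutions of the geodesic equation to solutions. -/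
theorem metricForce_isometry {B : E → E →L[ℝ] E →L[ℝ] ℝ} {φ : E → E} {y : E}
    (hφ : ContDiffAt ℝ ∞ φ y) (hB : DifferentiableAt ℝ B y) (hB' : DifferentiableAt ℝ B (φ y))
    (hsymm : ∀ u v, B (φ y) u v = B (φ y) v u)
    (hiso : ∀ᶠ z in 𝓝 y, ∀ u v, B z u v = B (φ z) (fderiv ℝ φ z u) (fderiv ℝ φ z v))
    {a v : E} (ha : ∀ w, B y a w = metricForce B y v w) (w : E) :
    B (φ y) (fderiv ℝ (fderiv ℝ φ) y v v + fderiv ℝ φ y a) (fderiv ℝ φ y w)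
      = metricForce B (φ y) (fderiv ℝ φ y v) (fderiv ℝ φ y w) := by
  have hφ1 : HasFDerivAt φ (fderiv ℝ φ y) y := (hφ.differentiableAt (by simp)).hasFDerivAt
  have hφ2 : HasFDerivAt (fderiv ℝ φ) (fderiv ℝ (fderiv ℝ φ) y) y :=
    ((hφ.fderiv_right (m := ∞) (by simp)).differentiableAt (by simp)).hasFDerivAt
  -- The isometry identity `hiso`, differentiated in the direction `h`.
  have hder : ∀ h u v : E, fderiv ℝ B y h u v =
      fderiv ℝ B (φ y) (fderiv ℝ φ y h) (fderiv ℝ φ y u) (fderiv ℝ φ y v)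
      + B (φ y) (fderiv ℝ (fderiv ℝ φ) y h u) (fderiv ℝ φ y v)
      + B (φ y) (fderiv ℝ φ y u) (fderiv ℝ (fderiv ℝ φ) y h v) := by
    intro h u v
    have h1 : HasFDerivAt (fun z => B z u v) (((fderiv ℝ B y).flip u).flip v) y := by
      have := (hB.hasFDerivAt.clm_apply (hasFDerivAt_const u y)).clm_apply (hasFDerivAt_const v y)
      refine this.congr_fderiv ?_
      ext h; simp
    have hu : HasFDerivAt (fun z => fderiv ℝ φ z u) ((fderiv ℝ (fderiv ℝ φ) y).flip u) y := by
      refine (hφ2.clm_apply (hasFDerivAt_const u y)).congr_fderiv ?_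
      ext h; simp
    have hv : HasFDerivAt (fun z => fderiv ℝ φ z v) ((fderiv ℝ (fderiv ℝ φ) y).flip v) y := by
      refine (hφ2.clm_apply (hasFDerivAt_const v y)).congr_fderiv ?_
      ext h; simp
    have hBφ : HasFDerivAt (fun z => B (φ z)) ((fderiv ℝ B (φ y)).comp (fderiv ℝ φ y)) y :=
      hB'.hasFDerivAt.comp y hφ1
    have h2 := (hBφ.clm_apply hu).clm_apply hv
    have h3 := h1.unique (h2.congr_of_eventuallyEq (hiso.mono fun z hz => hz u v))
    have h4 := congrArg (fun L => L h) h3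
    simp at h4
    linarith
  have hsy : ∀ u v, fderiv ℝ (fderiv ℝ φ) y u v = fderiv ℝ (fderiv ℝ φ) y v u :=
    fun u v => (hφ.isSymmSndFDerivAt (by simpa using (WithTop.coe_le_coe.2 (le_top (a := (2 : ℕ∞)))))) u v
  have h1 := ha w
  have h0 := hiso.self_of_nhds a w
  rw [metricForce_apply] at h1 ⊢
  rw [hder w v v, hder v v w, hsy w v] at h1
  rw [map_add, add_apply]
  -- By symmetry of `B` and of the second derivative, the two terms containing the second derivative
  -- in the directions `v` and `w` cancel.
  have h5 := hsymm (fderiv ℝ φ y v) (fderiv ℝ (fderiv ℝ φ) y v w)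
  linarith

end Spray

/-! ### Christoffel symbols and the force of the metric -/

section Christoffel

variable {d : ℕ} {M : Type*} [TopologicalSpace M] [ChartedSpace (EuclideanSpace ℝ (Fin d)) M]
  [IsManifold (𝓡 d) ∞ M]

theorem euclidean_eq_sum (v : EuclideanSpace ℝ (Fin d)) :
    v = ∑ i, v i • EuclideanSpace.single i (1 : ℝ) := by
  conv_lhs => rw [← (EuclideanSpace.basisFun (Fin d) ℝ).sum_repr v]
  simp

theorem bilin_eq_sum (L : EuclideanSpace ℝ (Fin d) →L[ℝ] EuclideanSpace ℝ (Fin d) →L[ℝ] ℝ)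
    (v w : EuclideanSpace ℝ (Fin d)) :
    L v w = ∑ i, ∑ j, L (EuclideanSpace.single i 1) (EuclideanSpace.single j 1) * v i * w j := by
  conv_lhs => rw [euclidean_eq_sum v, euclidean_eq_sum w]
  simp only [map_sum, map_smul, sum_apply, smul_apply, smul_eq_mul,
    Finset.mul_sum]
  rw [Finset.sum_comm]
  refine Finset.sum_congr rfl fun i _ => Finset.sum_congr rfl fun j _ => ?_
  ring

theorem metricMatrix_apply (g : Metric d M) (c : M) (y : EuclideanSpace ℝ (Fin d)) (i j : Fin d) :
    metricMatrix g c y i j =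
      chartMetric g c y (EuclideanSpace.single i 1) (EuclideanSpace.single j 1) := rfl

theorem isUnit_metricMatrix (g : Metric d M) (c : M) {y : EuclideanSpace ℝ (Fin d)}
    (hy : y ∈ (extChartAt (𝓡 d) c).target) : IsUnit (metricMatrix g c y) := by
  rw [← Matrix.mulVec_injective_iff_isUnit, ← Matrix.coe_mulVecLin, injective_iff_map_eq_zero]
  intro z hz
  by_contra hne
  have hz0 : WithLp.toLp 2 z ≠ 0 := fun h => hne (by simpa using congrArg WithLp.ofLp h)
  refine (chartMetric_pos g c hy hz0).ne' ?_
  rw [bilin_eq_sum]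
  refine Finset.sum_eq_zero fun i _ => ?_
  have h1 : ∑ j, metricMatrix g c y i j * z j = 0 := congrFun hz i
  have h2 : ∀ j, chartMetric g c y (EuclideanSpace.single i 1) (EuclideanSpace.single j 1) * z i * z j
      = z i * (metricMatrix g c y i j * z j) := fun j => by rw [metricMatrix_apply]; ring
  simp only [h2, ← Finset.mul_sum, h1, mul_zero]

theorem pd_metricMatrix (g : Metric d M) (c : M) {y : EuclideanSpace ℝ (Fin d)}
    (hy : y ∈ (extChartAt (𝓡 d) c).target) (i j l : Fin d) :
    pd i (fun z => metricMatrix g c z j l) y = fderiv ℝ (chartMetric g c) y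
      (EuclideanSpace.single i 1) (EuclideanSpace.single j 1) (EuclideanSpace.single l 1) := by
  have hB : DifferentiableAt ℝ (chartMetric g c) y :=
    ((contDiffOn_chartMetric g c).differentiableOn (by simp)).differentiableAt
      ((isOpen_extChartAt_target c).mem_nhds hy)
  have h := (hB.hasFDerivAt.clm_apply (hasFDerivAt_const (EuclideanSpace.single j 1) y)).clm_apply
    (hasFDerivAt_const (EuclideanSpace.single l (1 : ℝ)) y)
  unfold pd
  rw [show (fun z => metricMatrix g c z j l) = fun z => chartMetric g c z
    (EuclideanSpace.single j 1) (EuclideanSpace.single l 1) from rfl, h.fderiv]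
  simp

/-- The geodesic equation in terms of Christoffel symbols is the Euler–Lagrange equation of the
energy. -/
theorem metricForce_of_christoffel (g : Metric d M) (c : M) {y : EuclideanSpace ℝ (Fin d)}
    (hy : y ∈ (extChartAt (𝓡 d) c).target) {a v : EuclideanSpace ℝ (Fin d)}
    (h : ∀ k, a k + ∑ i, ∑ j, christoffel g c k i j y * v i * v j = 0)
    (w : EuclideanSpace ℝ (Fin d)) :
    chartMetric g c y a w = metricForce (chartMetric g c) y v w := by
  set D := fderiv ℝ (chartMetric g c) y with hD
  set e : Fin d → EuclideanSpace ℝ (Fin d) := fun i => EuclideanSpace.single i 1 with he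
  set T : Fin d → ℝ := fun l => 2 * D v v (e l) - D (e l) v v with hT
  have hsum : ∀ l, ∑ i, ∑ j, (pd i (fun z => metricMatrix g c z j l) y
      + pd j (fun z => metricMatrix g c z i l) y - pd l (fun z => metricMatrix g c z i j) y)
        * v i * v j = T l := by
    intro l
    simp only [pd_metricMatrix g c hy, ← hD]
    have h1 : D v v (e l) = ∑ i, ∑ j, D (e i) (e j) (e l) * v i * v j := by
      have := bilin_eq_sum (((ContinuousLinearMap.apply ℝ ℝ (e l)).compL ℝ _ _ _ |>.comp D)) v v
      simpa using this
    have h2 : D (e l) v v = ∑ i, ∑ j, D (e l) (e i) (e j) * v i * v j := bilin_eq_sum _ _ _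
    have h3 : D v v (e l) = ∑ i, ∑ j, D (e j) (e i) (e l) * v i * v j := by
      rw [h1, Finset.sum_comm]
      refine Finset.sum_congr rfl fun i _ => Finset.sum_congr rfl fun j _ => ?_
      ring
    simp only [hT, two_mul]
    nth_rewrite 1 [h1]
    rw [h3, h2]
    simp only [← Finset.sum_add_distrib, ← Finset.sum_sub_distrib]
    refine Finset.sum_congr rfl fun i _ => Finset.sum_congr rfl fun j _ => ?_
    ring
  have ha : (fun k => a k) = (metricMatrix g c y)⁻¹.mulVec (fun l => -(1 / 2) * T l) := by
    funext k
    have h1 : ∑ i, ∑ j, christoffel g c k i j y * v i * v j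
        = ∑ l, (metricMatrix g c y)⁻¹ k l * ((1 / 2) * T l) := by
      simp only [christoffel, ← hsum, Finset.mul_sum, Finset.sum_mul]
      symm
      rw [Finset.sum_comm]
      refine Finset.sum_congr rfl fun i _ => ?_
      rw [Finset.sum_comm]
      refine Finset.sum_congr rfl fun j _ => Finset.sum_congr rfl fun l _ => ?_
      ring
    have h2 := h k
    rw [h1] at h2
    simp only [Matrix.mulVec, dotProduct]
    rw [eq_neg_of_add_eq_zero_left h2, ← Finset.sum_neg_distrib]
    refine Finset.sum_congr rfl fun l _ => ?_
    ring
  have hM : (metricMatrix g c y).mulVec (fun k => a k) = fun l => -(1 / 2) * T l := by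
    rw [ha, Matrix.mulVec_mulVec, Matrix.mul_nonsing_inv _
      ((Matrix.isUnit_iff_isUnit_det _).1 (isUnit_metricMatrix g c hy)), Matrix.one_mulVec]
  have hl : ∀ l, chartMetric g c y a (e l) = metricForce (chartMetric g c) y v (e l) := by
    intro l
    have h1 : ∑ k, metricMatrix g c y l k * a k = -(1 / 2) * T l := congrFun hM l
    have h2 : chartMetric g c y a (e l) = ∑ k, metricMatrix g c y l k * a k := by
      rw [chartMetric_symm]
      conv_lhs => rw [euclidean_eq_sum a]
      simp only [map_sum, map_smul, smul_eq_mul]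
      refine Finset.sum_congr rfl fun k _ => ?_
      rw [metricMatrix_apply]; ring
    rw [h2, h1, metricForce_apply, ← hD]
    simp only [hT]
    ring
  rw [euclidean_eq_sum w]
  simp only [map_sum, map_smul]
  exact Finset.sum_congr rfl fun l _ => by rw [hl l]

end Christoffel

section ChartAction

variable {d m : ℕ} {M : Type*} [TopologicalSpace M] [ChartedSpace (EuclideanSpace ℝ (Fin d)) M]
  [IsManifold (𝓡 d) ∞ M]
  {G : Type*} [TopologicalSpace G]
  [ChartedSpace (EuclideanSpace ℝ (Fin m)) G] [Group G] [LieGroup (𝓡 m) ∞ G]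
  [MulAction G M] [ContMDiffSMul (𝓡 m) (𝓡 d) ∞ G M]

/-- The tangent spaces of the orbits in the chart centred at `c`. -/
def chartOrbitTangent (m d : ℕ) (G : Type*) [TopologicalSpace G]
    [ChartedSpace (EuclideanSpace ℝ (Fin m)) G] [Group G] {M : Type*} [TopologicalSpace M]
    [ChartedSpace (EuclideanSpace ℝ (Fin d)) M] [MulAction G M] (c : M)
    (y : EuclideanSpace ℝ (Fin d)) : Submodule ℝ (EuclideanSpace ℝ (Fin d)) :=
  Submodule.comap (chartFrame c y).toLinearMap
    (orbitTangent m d G ((extChartAt (𝓡 d) c).symm y) :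
      Submodule ℝ (EuclideanSpace ℝ (Fin d)))

/-- The action of a group element in the chart centred at `c`. -/
def chartSMul (d : ℕ) {G M : Type*} [Group G] [TopologicalSpace M]
    [ChartedSpace (EuclideanSpace ℝ (Fin d)) M] [MulAction G M] (c : M) (a : G)
    (y : EuclideanSpace ℝ (Fin d)) : EuclideanSpace ℝ (Fin d) :=
  extChartAt (𝓡 d) c (a • (extChartAt (𝓡 d) c).symm y)

omit [IsManifold (𝓡 d) ∞ M] in
theorem extChartAt_symm_chartSMul {c : M} {a : G} {y : EuclideanSpace ℝ (Fin d)}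
    (hay : a • (extChartAt (𝓡 d) c).symm y ∈ (extChartAt (𝓡 d) c).source) :
    (extChartAt (𝓡 d) c).symm (chartSMul d c a y) = a • (extChartAt (𝓡 d) c).symm y :=
  (extChartAt (𝓡 d) c).left_inv hay

theorem contMDiffAt_extChartAt_symm {c : M} {y : EuclideanSpace ℝ (Fin d)}
    (hy : y ∈ (extChartAt (𝓡 d) c).target) :
    ContMDiffAt 𝓘(ℝ, EuclideanSpace ℝ (Fin d)) (𝓡 d) ∞ (extChartAt (𝓡 d) c).symm y :=
  (contMDiffOn_extChartAt_symm c).contMDiffAt ((isOpen_extChartAt_target c).mem_nhds hy)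

include m

theorem contDiffAt_chartSMul {c : M} {a : G} {y : EuclideanSpace ℝ (Fin d)}
    (hy : y ∈ (extChartAt (𝓡 d) c).target)
    (hay : a • (extChartAt (𝓡 d) c).symm y ∈ (extChartAt (𝓡 d) c).source) :
    ContDiffAt ℝ ∞ (chartSMul d c a) y := by
  rw [← contMDiffAt_iff_contDiffAt]
  have h1 : ContMDiffAt 𝓘(ℝ, EuclideanSpace ℝ (Fin d)) (𝓡 d) ∞
      (fun y => a • (extChartAt (𝓡 d) c).symm y) y :=
    ((contMDiff_smul_left m a).contMDiffAt).comp y (contMDiffAt_extChartAt_symm hy)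
  exact (contMDiffAt_extChartAt' (by rwa [extChartAt_source] at hay)).comp y h1

theorem eventually_smul_extChartAt_symm_mem {c : M} {a : G} {y : EuclideanSpace ℝ (Fin d)}
    (hy : y ∈ (extChartAt (𝓡 d) c).target)
    (hay : a • (extChartAt (𝓡 d) c).symm y ∈ (extChartAt (𝓡 d) c).source) :
    ∀ᶠ z in 𝓝 y, z ∈ (extChartAt (𝓡 d) c).target ∧
      a • (extChartAt (𝓡 d) c).symm z ∈ (extChartAt (𝓡 d) c).source := by
  refine (eventually_mem_set.2 ((isOpen_extChartAt_target c).mem_nhds hy)).and ?_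
  exact (((contMDiff_smul_left m a).contMDiffAt).comp y
    (contMDiffAt_extChartAt_symm hy)).continuousAt.eventually_mem
    ((isOpen_extChartAt_source c).mem_nhds hay)

theorem chartFrame_fderiv_chartSMul {c : M} {a : G} {y : EuclideanSpace ℝ (Fin d)}
    (hy : y ∈ (extChartAt (𝓡 d) c).target)
    (hay : a • (extChartAt (𝓡 d) c).symm y ∈ (extChartAt (𝓡 d) c).source)
    (u : EuclideanSpace ℝ (Fin d)) :
    chartFrame c (chartSMul d c a y) (fderiv ℝ (chartSMul d c a) y u) =
      (dAct d a ((extChartAt (𝓡 d) c).symm y) (chartFrame c y u : EuclideanSpace ℝ (Fin d)) :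
        EuclideanSpace ℝ (Fin d)) := by
  have hφ := contDiffAt_chartSMul (m := m) hy hay
  have hφ' : MDifferentiableAt 𝓘(ℝ, EuclideanSpace ℝ (Fin d)) 𝓘(ℝ, EuclideanSpace ℝ (Fin d))
    (chartSMul d c a) y := (hφ.differentiableAt (by simp)).mdifferentiableAt
  have ht : chartSMul d c a y ∈ (extChartAt (𝓡 d) c).target := (extChartAt (𝓡 d) c).map_source hay
  have h1 := mfderiv_comp_apply_of_base_eq (I'' := 𝓡 d)
    ((contMDiffAt_extChartAt_symm ht).mdifferentiableAt (by simp)) hφ' rfl u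
  have h2 := mfderiv_comp_apply_of_base_eq (g := fun x : M => a • x)
    ((contMDiff_smul_left m a).mdifferentiable (by simp) _)
    ((contMDiffAt_extChartAt_symm hy).mdifferentiableAt (by simp)) rfl u
  have h3 : (extChartAt (𝓡 d) c).symm ∘ chartSMul d c a
      =ᶠ[𝓝 y] (fun x : M => a • x) ∘ (extChartAt (𝓡 d) c).symm := by
    filter_upwards [eventually_smul_extChartAt_symm_mem (m := m) hy hay] with z hz
    exact extChartAt_symm_chartSMul hz.2
  have h4 := congrArg (fun L : EuclideanSpace ℝ (Fin d) →L[ℝ] EuclideanSpace ℝ (Fin d) => L u)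
    (h3.mfderiv_eq (I := 𝓘(ℝ, EuclideanSpace ℝ (Fin d))) (I' := 𝓡 d))
  rw [mfderiv_eq_fderiv] at h1
  exact h1.symm.trans (h4.trans h2)

theorem chartMetric_chartSMul {g : Metric d M} (hg : IsIsometricAction G g) {c : M} {a : G}
    {y : EuclideanSpace ℝ (Fin d)} (hy : y ∈ (extChartAt (𝓡 d) c).target)
    (hay : a • (extChartAt (𝓡 d) c).symm y ∈ (extChartAt (𝓡 d) c).source)
    (u v : EuclideanSpace ℝ (Fin d)) :
    chartMetric g c y u v = chartMetric g c (chartSMul d c a y)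
      (fderiv ℝ (chartSMul d c a) y u) (fderiv ℝ (chartSMul d c a) y v) := by
  rw [chartMetric_apply, chartMetric_apply, chartFrame_fderiv_chartSMul (m := m) hy hay,
    chartFrame_fderiv_chartSMul (m := m) hy hay]
  have h : ∀ p : M, p = a • (extChartAt (𝓡 d) c).symm y → ∀ x z : EuclideanSpace ℝ (Fin d),
      (g.inner p : EuclideanSpace ℝ (Fin d) →L[ℝ] EuclideanSpace ℝ (Fin d) →L[ℝ] ℝ) x z =
      (g.inner (a • (extChartAt (𝓡 d) c).symm y) :
        EuclideanSpace ℝ (Fin d) →L[ℝ] EuclideanSpace ℝ (Fin d) →L[ℝ] ℝ) x z := by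
    rintro _ rfl x z; rfl
  exact ((h _ (extChartAt_symm_chartSMul hay) _ _).trans (hg a _ _ _)).symm

theorem surjective_fderiv_chartSMul {c : M} {a : G} {y : EuclideanSpace ℝ (Fin d)}
    (hy : y ∈ (extChartAt (𝓡 d) c).target)
    (hay : a • (extChartAt (𝓡 d) c).symm y ∈ (extChartAt (𝓡 d) c).source) :
    Function.Surjective (fderiv ℝ (chartSMul d c a) y) := by
  refine (LinearMap.injective_iff_surjective
    (f := (fderiv ℝ (chartSMul d c a) y).toLinearMap)).1 ?_
  intro u v huv
  have h1 := chartFrame_fderiv_chartSMul (m := m) hy hay u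
  rw [show fderiv ℝ (chartSMul d c a) y u = fderiv ℝ (chartSMul d c a) y v from huv,
    chartFrame_fderiv_chartSMul (m := m) hy hay v] at h1
  exact (chartFrame_bijective c hy).1 ((dActEquiv m a _).injective h1).symm

omit [LieGroup (𝓡 m) ∞ G] in
theorem finrank_chartOrbitTangent {c : M} {y : EuclideanSpace ℝ (Fin d)}
    (hy : y ∈ (extChartAt (𝓡 d) c).target) :
    Module.finrank ℝ (chartOrbitTangent m d G c y) =
      Module.finrank ℝ (orbitTangent m d G ((extChartAt (𝓡 d) c).symm y)) := by
  let e : EuclideanSpace ℝ (Fin d) ≃ₗ[ℝ] EuclideanSpace ℝ (Fin d) :=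
    LinearEquiv.ofBijective (chartFrame c y).toLinearMap (chartFrame_bijective c hy)
  have h1 : chartOrbitTangent m d G c y = Submodule.comap e.toLinearMap
    (orbitTangent m d G ((extChartAt (𝓡 d) c).symm y) :
      Submodule ℝ (EuclideanSpace ℝ (Fin d))) := rfl
  rw [h1]
  exact (Submodule.comap_equiv_eq_map_symm e _) ▸ LinearEquiv.finrank_map_eq e.symm _

theorem exists_mem_chartOrbitTangent {c : M} {a : G} {y : EuclideanSpace ℝ (Fin d)}
    (hy : y ∈ (extChartAt (𝓡 d) c).target)
    (hay : a • (extChartAt (𝓡 d) c).symm y ∈ (extChartAt (𝓡 d) c).source)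
    {τ : EuclideanSpace ℝ (Fin d)} (hτ : τ ∈ chartOrbitTangent m d G c (chartSMul d c a y)) :
    ∃ σ ∈ chartOrbitTangent m d G c y, fderiv ℝ (chartSMul d c a) y σ = τ := by
  set φ := fderiv ℝ (chartSMul d c a) y
  have hmem : ∀ p : M, p = a • (extChartAt (𝓡 d) c).symm y → ∀ x : EuclideanSpace ℝ (Fin d),
      x ∈ (orbitTangent m d G (a • (extChartAt (𝓡 d) c).symm y) :
        Submodule ℝ (EuclideanSpace ℝ (Fin d))) →
      x ∈ (orbitTangent m d G p : Submodule ℝ (EuclideanSpace ℝ (Fin d))) := by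
    rintro _ rfl x hx; exact hx
  have hle : (chartOrbitTangent m d G c y).map φ.toLinearMap ≤
      chartOrbitTangent m d G c (chartSMul d c a y) := by
    rintro _ ⟨σ, hσ, rfl⟩
    refine hmem _ (extChartAt_symm_chartSMul hay) _ ?_
    have := chartFrame_fderiv_chartSMul (m := m) hy hay σ
    rw [show (chartFrame c (chartSMul d c a y)).toLinearMap (φ.toLinearMap σ) = _ from this]
    exact map_dAct_orbitTangent_le a _ ⟨_, hσ, rfl⟩
  have hinj : Function.Injective φ.toLinearMap :=
    LinearMap.injective_iff_surjective.2 (surjective_fderiv_chartSMul (m := m) hy hay)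
  have hfr : Module.finrank ℝ ((chartOrbitTangent m d G c y).map φ.toLinearMap) =
      Module.finrank ℝ (chartOrbitTangent m d G c (chartSMul d c a y)) := by
    have ht : chartSMul d c a y ∈ (extChartAt (𝓡 d) c).target :=
      (extChartAt (𝓡 d) c).map_source hay
    have hbase : ∀ p p' : M, p = p' → Module.finrank ℝ (orbitTangent m d G p) =
        Module.finrank ℝ (orbitTangent m d G p') := by
      rintro _ _ rfl; rfl
    rw [← (Submodule.equivMapOfInjective _ hinj _).finrank_eq, finrank_chartOrbitTangent hy,
      finrank_chartOrbitTangent ht, ← finrank_orbitTangent_smul a]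
    exact hbase _ _ (extChartAt_symm_chartSMul hay).symm
  rw [← Submodule.eq_of_le_of_finrank_eq hle hfr] at hτ
  exact hτ

end ChartAction

section ChartActionMap

variable {d m : ℕ} {M : Type*} [TopologicalSpace M] [ChartedSpace (EuclideanSpace ℝ (Fin d)) M]
  [IsManifold (𝓡 d) ∞ M]
  {G : Type*} [TopologicalSpace G]
  [ChartedSpace (EuclideanSpace ℝ (Fin m)) G] [Group G] [LieGroup (𝓡 m) ∞ G]
  [MulAction G M] [ContMDiffSMul (𝓡 m) (𝓡 d) ∞ G M]

/-- The action map near `(1, c)` in charts. -/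
def chartAction (m d : ℕ) (G : Type*) [TopologicalSpace G]
    [ChartedSpace (EuclideanSpace ℝ (Fin m)) G] [Group G] {M : Type*} [TopologicalSpace M]
    [ChartedSpace (EuclideanSpace ℝ (Fin d)) M] [MulAction G M] (c : M)
    (x : EuclideanSpace ℝ (Fin m) × EuclideanSpace ℝ (Fin d)) : EuclideanSpace ℝ (Fin d) :=
  extChartAt (𝓡 d) c ((extChartAt (𝓡 m) (1 : G)).symm x.1 • (extChartAt (𝓡 d) c).symm x.2)

/-- The domain of the action map in charts. -/
def chartActionDomain (m d : ℕ) (G : Type*) [TopologicalSpace G]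
    [ChartedSpace (EuclideanSpace ℝ (Fin m)) G] [Group G] {M : Type*} [TopologicalSpace M]
    [ChartedSpace (EuclideanSpace ℝ (Fin d)) M] [MulAction G M] (c : M) :
    Set (EuclideanSpace ℝ (Fin m) × EuclideanSpace ℝ (Fin d)) :=
  {x | (x.1 ∈ (extChartAt (𝓡 m) (1 : G)).target ∧ x.2 ∈ (extChartAt (𝓡 d) c).target) ∧
    (extChartAt (𝓡 m) (1 : G)).symm x.1 • (extChartAt (𝓡 d) c).symm x.2
      ∈ (extChartAt (𝓡 d) c).source}

variable {c : M} {u : EuclideanSpace ℝ (Fin m)} {y : EuclideanSpace ℝ (Fin d)}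

theorem contMDiffAt_smul_charts (hu : u ∈ (extChartAt (𝓡 m) (1 : G)).target)
    (hy : y ∈ (extChartAt (𝓡 d) c).target) :
    ContMDiffAt (𝓘(ℝ, EuclideanSpace ℝ (Fin m) × EuclideanSpace ℝ (Fin d))) (𝓡 d) ∞
      (fun x : EuclideanSpace ℝ (Fin m) × EuclideanSpace ℝ (Fin d) =>
        (extChartAt (𝓡 m) (1 : G)).symm x.1 • (extChartAt (𝓡 d) c).symm x.2) (u, y) := by
  have h1 : ContMDiffAt (𝓘(ℝ, EuclideanSpace ℝ (Fin m) × EuclideanSpace ℝ (Fin d))) (𝓡 m) ∞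
      (fun x : EuclideanSpace ℝ (Fin m) × EuclideanSpace ℝ (Fin d) =>
        (extChartAt (𝓡 m) (1 : G)).symm x.1) (u, y) :=
    ContMDiffAt.comp (u, y) (contMDiffAt_extChartAt_symm hu) contDiffAt_fst.contMDiffAt
  have h2 : ContMDiffAt (𝓘(ℝ, EuclideanSpace ℝ (Fin m) × EuclideanSpace ℝ (Fin d))) (𝓡 d) ∞
      (fun x : EuclideanSpace ℝ (Fin m) × EuclideanSpace ℝ (Fin d) =>
        (extChartAt (𝓡 d) c).symm x.2) (u, y) :=
    ContMDiffAt.comp (u, y) (contMDiffAt_extChartAt_symm hy) contDiffAt_snd.contMDiffAt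
  exact h1.smul h2

theorem contDiffAt_chartAction (h : (u, y) ∈ chartActionDomain m d G c) :
    ContDiffAt ℝ ∞ (chartAction m d G c) (u, y) := by
  rw [← contMDiffAt_iff_contDiffAt]
  refine (contMDiffAt_extChartAt' ?_).comp (u, y) (contMDiffAt_smul_charts h.1.1 h.1.2)
  have := h.2
  rwa [extChartAt_source] at this

theorem chartActionDomain_mem_nhds (h : (u, y) ∈ chartActionDomain m d G c) :
    chartActionDomain m d G c ∈ 𝓝 (u, y) := by
  have h1 : ∀ᶠ x in 𝓝 (u, y), x.1 ∈ (extChartAt (𝓡 m) (1 : G)).target :=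
    continuousAt_fst.eventually_mem ((isOpen_extChartAt_target (1 : G)).mem_nhds h.1.1)
  have h2 : ∀ᶠ x in 𝓝 (u, y), x.2 ∈ (extChartAt (𝓡 d) c).target :=
    continuousAt_snd.eventually_mem ((isOpen_extChartAt_target c).mem_nhds h.1.2)
  have h3 := (contMDiffAt_smul_charts (G := G) (c := c) h.1.1 h.1.2).continuousAt.eventually_mem
    ((isOpen_extChartAt_source c).mem_nhds h.2)
  exact (h1.and h2).and h3

theorem one_mem_chartActionDomain (hy : y ∈ (extChartAt (𝓡 d) c).target) :
    (extChartAt (𝓡 m) (1 : G) 1, y) ∈ chartActionDomain m d G c := by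
  refine ⟨⟨mem_extChartAt_target (1 : G), hy⟩, ?_⟩
  simp only [extChartAt_to_inv, one_smul]
  exact (extChartAt (𝓡 d) c).map_target hy

theorem chartAction_one (hy : y ∈ (extChartAt (𝓡 d) c).target) :
    chartAction m d G c (extChartAt (𝓡 m) (1 : G) 1, y) = y := by
  simp only [chartAction, extChartAt_to_inv, one_smul]
  exact (extChartAt (𝓡 d) c).right_inv hy

theorem extChartAt_symm_chartAction (h : (u, y) ∈ chartActionDomain m d G c) :
    (extChartAt (𝓡 d) c).symm (chartAction m d G c (u, y)) =
      (extChartAt (𝓡 m) (1 : G)).symm u • (extChartAt (𝓡 d) c).symm y :=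
  (extChartAt (𝓡 d) c).left_inv h.2

theorem hasFDerivAt_chartAction_left (h : (u, y) ∈ chartActionDomain m d G c) :
    HasFDerivAt (fun v => chartAction m d G c (v, y))
      ((fderiv ℝ (chartAction m d G c) (u, y)).comp (ContinuousLinearMap.inl ℝ _ _)) u := by
  have h1 : HasFDerivAt (chartAction m d G c) (fderiv ℝ (chartAction m d G c) (u, y)) (u, y) :=
    ((contDiffAt_chartAction h).differentiableAt (by simp)).hasFDerivAt
  exact HasFDerivAt.comp (f := fun v => (v, y)) u h1 (hasFDerivAt_prodMk_left u y)

theorem chartFrame_fderiv_chartAction (h : (u, y) ∈ chartActionDomain m d G c)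
    (X : EuclideanSpace ℝ (Fin m)) :
    chartFrame c (chartAction m d G c (u, y)) (fderiv ℝ (chartAction m d G c) (u, y) (X, 0)) =
      (mfderiv 𝓘(ℝ, EuclideanSpace ℝ (Fin m)) (𝓡 d) (fun v : EuclideanSpace ℝ (Fin m) =>
        (extChartAt (𝓡 m) (1 : G)).symm v • (extChartAt (𝓡 d) c).symm y) u X :
          EuclideanSpace ℝ (Fin d)) := by
  have ht : chartAction m d G c (u, y) ∈ (extChartAt (𝓡 d) c).target :=
    (extChartAt (𝓡 d) c).map_source h.2
  have hf := hasFDerivAt_chartAction_left h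
  have h1 := mfderiv_comp_apply_of_base_eq (I'' := 𝓡 d)
    ((contMDiffAt_extChartAt_symm ht).mdifferentiableAt (by simp))
    hf.differentiableAt.mdifferentiableAt rfl X
  have hev : (extChartAt (𝓡 d) c).symm ∘ (fun v => chartAction m d G c (v, y)) =ᶠ[𝓝 u]
      fun v => (extChartAt (𝓡 m) (1 : G)).symm v • (extChartAt (𝓡 d) c).symm y := by
    have hc : ContinuousAt (fun v : EuclideanSpace ℝ (Fin m) => (v, y)) u := by fun_prop
    filter_upwards [hc.eventually_mem (chartActionDomain_mem_nhds h)] with v hv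
    exact extChartAt_symm_chartAction hv
  have h4 := congrArg (fun L : EuclideanSpace ℝ (Fin m) →L[ℝ] EuclideanSpace ℝ (Fin d) => L X)
    (hev.mfderiv_eq (I := 𝓘(ℝ, EuclideanSpace ℝ (Fin m))) (I' := 𝓡 d))
  rw [mfderiv_eq_fderiv, hf.fderiv] at h1
  exact h1.symm.trans h4

theorem fderiv_chartAction_mem (h : (u, y) ∈ chartActionDomain m d G c)
    (X : EuclideanSpace ℝ (Fin m)) :
    fderiv ℝ (chartAction m d G c) (u, y) (X, 0) ∈
      chartOrbitTangent m d G c (chartAction m d G c (u, y)) := by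
  set b : G := (extChartAt (𝓡 m) (1 : G)).symm u with hb
  set z : M := (extChartAt (𝓡 d) c).symm y with hz
  have hmem : ∀ p : M, p = b • z → ∀ x : EuclideanSpace ℝ (Fin d),
      x ∈ (orbitTangent m d G (b • z) : Submodule ℝ (EuclideanSpace ℝ (Fin d))) →
      x ∈ (orbitTangent m d G p : Submodule ℝ (EuclideanSpace ℝ (Fin d))) := by
    rintro _ rfl x hx; exact hx
  refine hmem _ (extChartAt_symm_chartAction h) _ ?_
  have h0 := chartFrame_fderiv_chartAction h X
  rw [show (chartFrame c (chartAction m d G c (u, y))).toLinearMap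
    (fderiv ℝ (chartAction m d G c) (u, y) (X, 0)) = _ from h0]
  have hfun : (fun v : EuclideanSpace ℝ (Fin m) => (extChartAt (𝓡 m) (1 : G)).symm v • z) =
      (fun a : G => a • b • z) ∘ (fun v => (extChartAt (𝓡 m) (1 : G)).symm v * b⁻¹) := by
    ext v; simp [smul_smul]
  have hinner : ContMDiffAt 𝓘(ℝ, EuclideanSpace ℝ (Fin m)) (𝓡 m) ∞
      (fun v => (extChartAt (𝓡 m) (1 : G)).symm v * b⁻¹) u :=
    (contMDiffAt_extChartAt_symm h.1.1).mul contMDiffAt_const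
  have h1 := mfderiv_comp_apply_of_base_eq (g := fun a : G => a • b • z) (y := 1)
    ((contMDiff_orbitMap (b • z)).mdifferentiable (I := 𝓡 m) (I' := 𝓡 d) (by simp) 1)
    (hinner.mdifferentiableAt (by simp)) (by simp [hb]) X
  rw [← hfun] at h1
  exact ⟨_, h1.symm⟩

theorem exists_fderiv_chartAction_one (hy : y ∈ (extChartAt (𝓡 d) c).target)
    {τ : EuclideanSpace ℝ (Fin d)} (hτ : τ ∈ chartOrbitTangent m d G c y) :
    ∃ X, fderiv ℝ (chartAction m d G c) (extChartAt (𝓡 m) (1 : G) 1, y) (X, 0) = τ := by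
  obtain ⟨X₁, hX₁⟩ := hτ
  obtain ⟨X, rfl⟩ := (chartFrame_bijective (1 : G) (mem_extChartAt_target (I := 𝓡 m) (1 : G))).2 X₁
  refine ⟨X, ?_⟩
  have hdom := one_mem_chartActionDomain (m := m) (G := G) hy
  have h0 := chartFrame_fderiv_chartAction hdom X
  rw [chartAction_one hy] at h0
  refine (chartFrame_bijective c hy).1 (h0.trans ?_)
  refine Eq.trans ?_ hX₁
  exact mfderiv_comp_apply_of_base_eq
    (g := fun a : G => a • (extChartAt (𝓡 d) c).symm y)
    (f := (extChartAt (𝓡 m) (1 : G)).symm) (y := 1)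
    ((contMDiff_orbitMap _).mdifferentiable (I := 𝓡 m) (I' := 𝓡 d) (by simp) 1)
    ((contMDiffAt_extChartAt_symm hdom.1.1).mdifferentiableAt (by simp)) (extChartAt_to_inv _) X

theorem fderiv_chartAction_one_right (hy : y ∈ (extChartAt (𝓡 d) c).target)
    (v : EuclideanSpace ℝ (Fin d)) :
    fderiv ℝ (chartAction m d G c) (extChartAt (𝓡 m) (1 : G) 1, y) (0, v) = v := by
  have h1 : HasFDerivAt (fun z => chartAction m d G c (extChartAt (𝓡 m) (1 : G) 1, z))
      ((fderiv ℝ (chartAction m d G c) (extChartAt (𝓡 m) (1 : G) 1, y)).comp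
        (ContinuousLinearMap.inr ℝ _ _)) y :=
    ((contDiffAt_chartAction (one_mem_chartActionDomain hy)).differentiableAt
      (by simp)).hasFDerivAt.comp y (hasFDerivAt_prodMk_right _ y)
  have h2 := h1.unique ((hasFDerivAt_id y).congr_of_eventuallyEq
    (eventually_of_mem ((isOpen_extChartAt_target c).mem_nhds hy) fun z hz => chartAction_one hz))
  exact congrArg (fun L => L v) h2

end ChartActionMap

section Transversal

variable {d m : ℕ} {M : Type*} [TopologicalSpace M] [ChartedSpace (EuclideanSpace ℝ (Fin d)) M]
  [IsManifold (𝓡 d) ∞ M]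
  {G : Type*} [TopologicalSpace G]
  [ChartedSpace (EuclideanSpace ℝ (Fin m)) G] [Group G] [LieGroup (𝓡 m) ∞ G]
  [MulAction G M] [ContMDiffSMul (𝓡 m) (𝓡 d) ∞ G M]

theorem exists_linear_section {E F : Type*} [AddCommGroup E] [Module ℝ E] [AddCommGroup F]
    [Module ℝ F] (D : F →ₗ[ℝ] E) (T : Submodule ℝ E) (hT : ∀ τ ∈ T, ∃ X, D X = τ) :
    ∃ (L : E →ₗ[ℝ] F) (P : E →ₗ[ℝ] E), (∀ v, P v = 0 ↔ v ∈ T) ∧ ∀ v, D (L v) + P v = v := by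
  obtain ⟨Q, hQ⟩ := T.subtype.exists_leftInverse_of_injective (Submodule.ker_subtype T)
  have hQT : ∀ τ : T, Q τ = τ := fun τ => congrArg (fun f => f τ) hQ
  obtain ⟨s, hs⟩ := D.rangeRestrict.exists_rightInverse_of_surjective D.range_rangeRestrict
  have hle : T ≤ LinearMap.range D := fun τ hτ => hT τ hτ
  refine ⟨s ∘ₗ Submodule.inclusion hle ∘ₗ Q, LinearMap.id - T.subtype ∘ₗ Q, fun v => ?_, fun v => ?_⟩
  · simp only [LinearMap.sub_apply, LinearMap.id_apply, LinearMap.comp_apply,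
      Submodule.subtype_apply, sub_eq_zero]
    refine ⟨fun h => h ▸ (Q v).2, fun h => ?_⟩
    rw [hQT ⟨v, h⟩]
  · have h1 : D (s (Submodule.inclusion hle (Q v))) = Q v :=
      congrArg (fun f => (f (Submodule.inclusion hle (Q v)) : E)) hs
    simp [h1]

/-- Near `p` there is a map which is constant on the orbit of `p` near `p`, and whose differential
at `p` has the tangent space of the orbit as its kernel. -/
theorem exists_transversal (m : ℕ) {d : ℕ} {M : Type*} [TopologicalSpace M]
    [ChartedSpace (EuclideanSpace ℝ (Fin d)) M] [IsManifold (𝓡 d) ∞ M]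
    (G : Type*) [TopologicalSpace G]
    [ChartedSpace (EuclideanSpace ℝ (Fin m)) G] [Group G] [LieGroup (𝓡 m) ∞ G]
    [MulAction G M] [ContMDiffSMul (𝓡 m) (𝓡 d) ∞ G M] (p : M) :
    ∃ (Y : EuclideanSpace ℝ (Fin d) → EuclideanSpace ℝ (Fin d))
      (P : EuclideanSpace ℝ (Fin d) →L[ℝ] EuclideanSpace ℝ (Fin d)),
      HasStrictFDerivAt Y P (extChartAt (𝓡 d) p p) ∧
      (∀ v, P v = 0 ↔ v ∈ chartOrbitTangent m d G p (extChartAt (𝓡 d) p p)) ∧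
      ∀ᶠ u in 𝓝 (extChartAt (𝓡 m) (1 : G) 1),
        Y (chartAction m d G p (u, extChartAt (𝓡 d) p p)) = Y (extChartAt (𝓡 d) p p) := by
  set y₀ := extChartAt (𝓡 d) p p with hy₀
  set u₀ := extChartAt (𝓡 m) (1 : G) 1 with hu₀
  set Ψ := chartAction m d G p with hΨ
  set T := chartOrbitTangent m d G p y₀ with hT
  have hy₀t : y₀ ∈ (extChartAt (𝓡 d) p).target := mem_extChartAt_target p
  have hdom : (u₀, y₀) ∈ chartActionDomain m d G p := one_mem_chartActionDomain hy₀t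
  have hone : Ψ (u₀, y₀) = y₀ := chartAction_one hy₀t
  obtain ⟨L, P, hP, hLP⟩ := exists_linear_section
    ((fderiv ℝ Ψ (u₀, y₀)).comp (ContinuousLinearMap.inl ℝ _ _)).toLinearMap T
    (fun τ hτ => exists_fderiv_chartAction_one hy₀t hτ)
  set L' : EuclideanSpace ℝ (Fin d) →L[ℝ] EuclideanSpace ℝ (Fin m) := L.toContinuousLinearMap
  set P' : EuclideanSpace ℝ (Fin d) →L[ℝ] EuclideanSpace ℝ (Fin d) := P.toContinuousLinearMap
  set h : EuclideanSpace ℝ (Fin d) → EuclideanSpace ℝ (Fin m) × EuclideanSpace ℝ (Fin d) :=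
    fun e => (u₀ + L' e, y₀ + P' e) with hh
  have hh0 : h 0 = (u₀, y₀) := by simp [hh]
  have hhs : ContDiff ℝ ∞ h := by fun_prop
  have hhd : ∀ e, HasFDerivAt h (L'.prod P') e := fun e =>
    (L'.hasFDerivAt.const_add u₀).prodMk (P'.hasFDerivAt.const_add y₀)
  set Θ : EuclideanSpace ℝ (Fin d) → EuclideanSpace ℝ (Fin d) := fun e => Ψ (h e) with hΘ
  have hΘ0 : Θ 0 = y₀ := by simp only [hΘ, hh0, hone]
  have hΘs : ∀ e, h e ∈ chartActionDomain m d G p → ContDiffAt ℝ ∞ Θ e := fun e he =>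
    ContDiffAt.comp (g := Ψ) e (contDiffAt_chartAction he) hhs.contDiffAt
  have hΘd : ∀ e, h e ∈ chartActionDomain m d G p → ∀ v,
      fderiv ℝ Θ e v = fderiv ℝ Ψ (h e) (L' v, 0) + fderiv ℝ Ψ (h e) (0, P' v) := by
    intro e he v
    have h1 : HasFDerivAt Ψ (fderiv ℝ Ψ (h e)) (h e) :=
      ((contDiffAt_chartAction he).differentiableAt (by simp)).hasFDerivAt
    have h2 : HasFDerivAt Θ ((fderiv ℝ Ψ (h e)).comp (L'.prod P')) e := h1.comp e (hhd e)
    rw [h2.fderiv, ← map_add]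
    simp
  have hdom0 : h 0 ∈ chartActionDomain m d G p := by rw [hh0]; exact hdom
  have hΘ1 : fderiv ℝ Θ 0 = ContinuousLinearMap.id ℝ _ := by
    ext1 v
    rw [hΘd 0 hdom0, hh0, fderiv_chartAction_one_right hy₀t]
    exact hLP v
  have hstrict : HasStrictFDerivAt Θ ((ContinuousLinearEquiv.refl ℝ (EuclideanSpace ℝ (Fin d)) :
      EuclideanSpace ℝ (Fin d) →L[ℝ] EuclideanSpace ℝ (Fin d))) 0 := by
    have := (hΘs 0 hdom0).hasStrictFDerivAt (by simp)
    rwa [hΘ1] at this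
  set Λ := hstrict.localInverse with hΛ
  have hleft : ∀ᶠ e in 𝓝 0, Λ (Θ e) = e := hstrict.eventually_left_inverse
  have hright : ∀ᶠ y in 𝓝 y₀, Θ (Λ y) = y := hΘ0 ▸ hstrict.eventually_right_inverse
  have hΛd : HasStrictFDerivAt Λ (ContinuousLinearMap.id ℝ (EuclideanSpace ℝ (Fin d))) y₀ := by
    have := hstrict.to_localInverse
    rw [hΘ0] at this
    exact this
  have hΛ0 : Λ y₀ = 0 := by rw [← hΘ0]; exact hstrict.localInverse_apply_image
  have hΛs : ContDiffAt ℝ ∞ Λ y₀ := by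
    have := (hΘs 0 hdom0).to_localInverse (f' := ContinuousLinearEquiv.refl ℝ _)
      hstrict.hasFDerivAt (by simp)
    rw [hΘ0] at this
    exact this
  refine ⟨P' ∘ Λ, P', ?_, hP, ?_⟩
  · exact (P'.hasStrictFDerivAt (x := Λ y₀)).comp y₀ hΛd
  have hf : ∀ᶠ u in 𝓝 u₀, (u, y₀) ∈ chartActionDomain m d G p := by
    have hc : ContinuousAt (fun u : EuclideanSpace ℝ (Fin m) => (u, y₀)) u₀ := by fun_prop
    exact hc.eventually_mem (chartActionDomain_mem_nhds hdom)
  have hft : Tendsto (fun u => Ψ (u, y₀)) (𝓝 u₀) (𝓝 y₀) := by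
    have := (hasFDerivAt_chartAction_left hdom).continuousAt.tendsto
    rwa [← hΨ, hone] at this
  have hΛt : Tendsto Λ (𝓝 y₀) (𝓝 0) := hΛ0 ▸ hΛd.continuousAt.tendsto
  have hΛdiff : ∀ᶠ y in 𝓝 y₀, DifferentiableAt ℝ Λ y := by
    have h1 : ContDiffAt ℝ 1 Λ y₀ := hΛs.of_le (by simp)
    filter_upwards [h1.eventually (by simp)] with y hy using hy.differentiableAt (by simp)
  have hdomΘ : ∀ᶠ e in 𝓝 0, h e ∈ chartActionDomain m d G p :=
    hhs.continuous.continuousAt.eventually_mem (by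
      rw [hh0]; exact chartActionDomain_mem_nhds hdom)
  have hderiv : ∀ᶠ u in 𝓝 u₀, HasFDerivAt (fun u => P' (Λ (Ψ (u, y₀))))
      (0 : EuclideanSpace ℝ (Fin m) →L[ℝ] EuclideanSpace ℝ (Fin d)) u := by
    filter_upwards [hf, hft.eventually hright, hft.eventually hΛdiff,
      hft.eventually (hΛt.eventually hdomΘ),
      hft.eventually (hΛt.eventually hleft.eventually_nhds)] with u hu hΘΛ hd hde hl
    have hf' := hasFDerivAt_chartAction_left hu
    have h1 := P'.hasFDerivAt.comp u (hd.hasFDerivAt.comp u hf')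
    refine h1.congr_fderiv ?_
    ext1 X
    set y := Ψ (u, y₀)
    set e := Λ y
    have hmem : fderiv ℝ Ψ (u, y₀) (X, 0) ∈ chartOrbitTangent m d G p y :=
      fderiv_chartAction_mem hu X
    have hcomp : ∀ v, fderiv ℝ Λ y (fderiv ℝ Θ e v) = v := by
      intro v
      have hd' : HasFDerivAt Λ (fderiv ℝ Λ y) (Θ e) := by rw [hΘΛ]; exact hd.hasFDerivAt
      have h2 := (hd'.comp e ((hΘs e hde).differentiableAt (by simp)).hasFDerivAt).unique
        ((hasFDerivAt_id e).congr_of_eventuallyEq hl)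
      exact congrArg (fun A => A v) h2
    have hle : T.map (fderiv ℝ Θ e).toLinearMap ≤ chartOrbitTangent m d G p y := by
      rintro _ ⟨τ, hτ, rfl⟩
      have hPτ : P' τ = 0 := (hP τ).2 hτ
      have h3 := hΘd e hde τ
      rw [hPτ, show ((0, 0) : EuclideanSpace ℝ (Fin m) × EuclideanSpace ℝ (Fin d)) = 0 from rfl,
        map_zero, add_zero] at h3
      rw [show (fderiv ℝ Θ e).toLinearMap τ = _ from h3, ← hΘΛ]
      exact fderiv_chartAction_mem hde (L' τ)
    have hinj : Function.Injective (fderiv ℝ Θ e).toLinearMap :=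
      Function.LeftInverse.injective hcomp
    have hbase : ∀ p p' : M, p = p' → Module.finrank ℝ (orbitTangent m d G p) =
        Module.finrank ℝ (orbitTangent m d G p') := by
      rintro _ _ rfl; rfl
    have hyt : y ∈ (extChartAt (𝓡 d) p).target := (extChartAt (𝓡 d) p).map_source hu.2
    have hfr : Module.finrank ℝ (T.map (fderiv ℝ Θ e).toLinearMap) =
        Module.finrank ℝ (chartOrbitTangent m d G p y) := by
      rw [← (Submodule.equivMapOfInjective _ hinj _).finrank_eq, hT,
        finrank_chartOrbitTangent hy₀t,
        finrank_chartOrbitTangent hyt,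
        ← finrank_orbitTangent_smul ((extChartAt (𝓡 m) (1 : G)).symm u)]
      exact hbase _ _ (extChartAt_symm_chartAction hu).symm
    rw [← Submodule.eq_of_le_of_finrank_eq hle hfr] at hmem
    obtain ⟨τ, hτ, hτX⟩ := hmem
    have h5 : fderiv ℝ Λ y (fderiv ℝ Ψ (u, y₀) (X, 0)) = τ := by
      rw [← hτX]; exact hcomp τ
    have h6 : P' τ = 0 := (hP τ).2 hτ
    calc P' (fderiv ℝ Λ y (fderiv ℝ Ψ (u, y₀) (X, 0))) = 0 := by rw [h5, h6]
      _ = _ := rfl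
  obtain ⟨r, hr, hball⟩ := Metric.eventually_nhds_iff_ball.1 hderiv
  filter_upwards [Metric.ball_mem_nhds u₀ hr] with u hu
  have h1 := Metric.isOpen_ball.is_const_of_fderiv_eq_zero (𝕜 := ℝ)
    (convex_ball u₀ r).isPreconnected
    (fun z hz => (hball z hz).differentiableAt.differentiableWithinAt)
    (fun z hz => (hball z hz).fderiv) hu (Metric.mem_ball_self hr)
  rw [hone] at h1
  exact h1

end Transversal

theorem hasDerivAt_fderiv_apply {E F : Type*} [NormedAddCommGroup E] [NormedSpace ℝ E]
    [NormedAddCommGroup F] [NormedSpace ℝ F] {φ : E → F} {x x' : ℝ → E} {v a : E} {t : ℝ}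
    (hφ : ContDiffAt ℝ ∞ φ (x t)) (hx : HasDerivAt x v t) (hx' : HasDerivAt x' a t) :
    HasDerivAt (fun s => fderiv ℝ φ (x s) (x' s))
      (fderiv ℝ (fderiv ℝ φ) (x t) v (x' t) + fderiv ℝ φ (x t) a) t := by
  have hD : HasFDerivAt (fderiv ℝ φ) (fderiv ℝ (fderiv ℝ φ) (x t)) (x t) :=
    ((hφ.fderiv_right (m := ∞) (by simp)).differentiableAt (by simp)).hasFDerivAt
  exact (hD.comp_hasDerivAt t hx).clm_apply hx'

theorem tendsto_bilin_apply {X E : Type*} [NormedAddCommGroup E] [NormedSpace ℝ E]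
    {l : Filter X} {B : X → E →L[ℝ] E →L[ℝ] ℝ} {B₀ : E →L[ℝ] E →L[ℝ] ℝ} {v w : X → E} {v₀ w₀ : E}
    (hB : Tendsto B l (𝓝 B₀)) (hv : Tendsto v l (𝓝 v₀)) (hw : Tendsto w l (𝓝 w₀)) :
    Tendsto (fun x => B x (v x) (w x)) l (𝓝 (B₀ v₀ w₀)) := by
  have hc : Continuous fun x : (E →L[ℝ] E →L[ℝ] ℝ) × E × E => x.1 x.2.1 x.2.2 := by fun_prop
  exact (hc.tendsto (B₀, v₀, w₀)).comp (hB.prodMk_nhds (hv.prodMk_nhds hw))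

section NormalRays

variable {d m : ℕ} {M : Type*} [TopologicalSpace M] [ChartedSpace (EuclideanSpace ℝ (Fin d)) M]
  [IsManifold (𝓡 d) ∞ M]
  {G : Type*} [TopologicalSpace G]
  [ChartedSpace (EuclideanSpace ℝ (Fin m)) G] [Group G] [LieGroup (𝓡 m) ∞ G]
  [MulAction G M] [ContMDiffSMul (𝓡 m) (𝓡 d) ∞ G M]
  {g : Metric d M} {p : M} {c : ℝ → M} {x' : ℝ → EuclideanSpace ℝ (Fin d)} {ρ : ℝ}

/-- A unit speed geodesic `c`, defined on `(0, ρ)`, which is orthogonal to the orbits and tends to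
`p` as `t → 0`, in the chart centred at `p`; its velocity in this chart is `x'`. -/
structure IsNormalRay (m : ℕ) {d : ℕ} (G : Type*) [TopologicalSpace G]
    [ChartedSpace (EuclideanSpace ℝ (Fin m)) G] [Group G] {M : Type*} [TopologicalSpace M]
    [ChartedSpace (EuclideanSpace ℝ (Fin d)) M] [IsManifold (𝓡 d) ∞ M] [MulAction G M]
    (g : Metric d M) (p : M) (c : ℝ → M) (x' : ℝ → EuclideanSpace ℝ (Fin d)) (ρ : ℝ) : Prop where
  pos : 0 < ρ
  tendsto : Tendsto c (𝓝[>] 0) (𝓝 p)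
  mem_source : ∀ t ∈ Ioo 0 ρ, c t ∈ (extChartAt (𝓡 d) p).source
  hasDerivAt : ∀ t ∈ Ioo 0 ρ, HasDerivAt (fun s => extChartAt (𝓡 d) p (c s)) (x' t) t
  hasDerivAt_velocity : ∀ t ∈ Ioo 0 ρ,
    HasDerivAt x' (geodesicSpray (chartMetric g p) (extChartAt (𝓡 d) p (c t), x' t)) t
  unit_speed : ∀ t ∈ Ioo 0 ρ, chartMetric g p (extChartAt (𝓡 d) p (c t)) (x' t) (x' t) = 1
  orthogonal : ∀ t ∈ Ioo 0 ρ, ∀ τ ∈ chartOrbitTangent m d G p (extChartAt (𝓡 d) p (c t)),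
    chartMetric g p (extChartAt (𝓡 d) p (c t)) (x' t) τ = 0

theorem contDiffOn_chartSpray (g : Metric d M) (p : M) :
    ContDiffOn ℝ ∞ (geodesicSpray (chartMetric g p)) ((extChartAt (𝓡 d) p).target ×ˢ univ) :=
  contDiffOn_geodesicSpray (isOpen_extChartAt_target p) (contDiffOn_chartMetric g p)
    fun _ hy _ hv => chartMetric_pos g p hy hv

namespace IsNormalRay

variable (h : IsNormalRay m G g p c x' ρ)
include h

theorem eventually_mem : ∀ᶠ t in 𝓝[>] (0 : ℝ), t ∈ Ioo 0 ρ := Ioo_mem_nhdsGT h.pos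

theorem tendsto_chart : Tendsto (fun t => extChartAt (𝓡 d) p (c t)) (𝓝[>] 0)
    (𝓝 (extChartAt (𝓡 d) p p)) :=
  (continuousAt_extChartAt p).tendsto.comp h.tendsto

theorem exists_tendsto_velocity : ∃ w, Tendsto x' (𝓝[>] 0) (𝓝 w) := by
  obtain ⟨δ, hδ, C, hC, hball, hmet⟩ := exists_closedBall_metric_ge g p
  set κ := extChartAt (𝓡 d) p
  have hK : IsCompact (Metric.closedBall (κ p) δ ×ˢ
      Metric.closedBall (0 : EuclideanSpace ℝ (Fin d)) (Real.sqrt (1 / C))) :=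
    (isCompact_closedBall _ _).prod (isCompact_closedBall _ _)
  obtain ⟨R, hR⟩ := hK.exists_bound_of_continuousOn
    ((contDiffOn_chartSpray g p).continuousOn.mono (prod_mono hball (subset_univ _)))
  rw [← nhdsWithin_Ioo_eq_nhdsGT h.pos]
  refine exists_tendsto_of_deriv_bounded ordConnected_Ioo
    (fun t ht => (h.hasDerivAt_velocity t ht).hasDerivWithinAt) ⟨R, ?_⟩
  rw [nhdsWithin_Ioo_eq_nhdsGT h.pos]
  filter_upwards [h.eventually_mem,
    h.tendsto_chart.eventually_mem (Metric.closedBall_mem_nhds _ hδ)] with t ht hx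
  refine hR _ ⟨hx, ?_⟩
  have h1 := hmet _ hx (x' t)
  rw [h.unit_speed t ht] at h1
  rw [mem_closedBall_zero_iff]
  refine Real.le_sqrt_of_sq_le ?_
  rw [le_div_iff₀ hC]
  linarith

theorem tendsto_slope {w : EuclideanSpace ℝ (Fin d)} (hw : Tendsto x' (𝓝[>] 0) (𝓝 w)) :
    Tendsto (fun t => t⁻¹ • (extChartAt (𝓡 d) p (c t) - extChartAt (𝓡 d) p p)) (𝓝[>] 0) (𝓝 w) := by
  set κ := extChartAt (𝓡 d) p
  set f : ℝ → EuclideanSpace ℝ (Fin d) := fun t => if 0 < t then κ (c t) else κ p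
  have hf : ∀ t, 0 < t → f t = κ (c t) := fun t ht => if_pos ht
  have hf0 : f 0 = κ p := if_neg (lt_irrefl _)
  have hd : ∀ t ∈ Ioo 0 ρ, HasDerivAt f (x' t) t := fun t ht =>
    (h.hasDerivAt t ht).congr_of_eventuallyEq
      (eventually_of_mem (Ioi_mem_nhds ht.1) fun s hs => hf s hs)
  have h1 : HasDerivWithinAt f w (Ici 0) 0 := by
    refine hasDerivWithinAt_Ici_of_tendsto_deriv (s := Ioo 0 ρ)
      (fun t ht => (hd t ht).differentiableAt.differentiableWithinAt) ?_ (Ioo_mem_nhdsGT h.pos) ?_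
    · change Tendsto f (𝓝[Ioo 0 ρ] 0) (𝓝 (f 0))
      rw [nhdsWithin_Ioo_eq_nhdsGT h.pos, hf0]
      exact h.tendsto_chart.congr' (eventually_mem_nhdsWithin.mono fun t ht => (hf t ht).symm)
    · exact hw.congr' (h.eventually_mem.mono fun t ht => (hd t ht).deriv.symm)
  have h2 := (hasDerivWithinAt_iff_tendsto_slope.1 h1)
  rw [Ici_sdiff_left] at h2
  refine h2.congr' (eventually_mem_nhdsWithin.mono fun t ht => ?_)
  simp [slope, hf t ht, hf0]

theorem metric_limit_velocity {w : EuclideanSpace ℝ (Fin d)} (hw : Tendsto x' (𝓝[>] 0) (𝓝 w)) :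
    chartMetric g p (extChartAt (𝓡 d) p p) w w = 1 := by
  have hB : ContinuousAt (chartMetric g p) (extChartAt (𝓡 d) p p) :=
    (contDiffOn_chartMetric g p).continuousOn.continuousAt (extChartAt_target_mem_nhds p)
  have h1 := tendsto_bilin_apply (hB.tendsto.comp h.tendsto_chart) hw hw
  refine tendsto_nhds_unique h1 (tendsto_const_nhds.congr' ?_)
  filter_upwards [h.eventually_mem] with t ht using (h.unit_speed t ht).symm

theorem limit_velocity_orthogonal {w : EuclideanSpace ℝ (Fin d)} (hw : Tendsto x' (𝓝[>] 0) (𝓝 w))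
    {τ : EuclideanSpace ℝ (Fin d)}
    (hτ : τ ∈ chartOrbitTangent m d G p (extChartAt (𝓡 d) p p)) :
    chartMetric g p (extChartAt (𝓡 d) p p) w τ = 0 := by
  have ht : extChartAt (𝓡 d) p p ∈ (extChartAt (𝓡 d) p).target := mem_extChartAt_target p
  have hB : ContinuousAt (chartMetric g p) (extChartAt (𝓡 d) p p) :=
    (contDiffOn_chartMetric g p).continuousOn.continuousAt (extChartAt_target_mem_nhds p)
  obtain ⟨X, rfl⟩ := exists_fderiv_chartAction_one ht hτ
  have hD : ContinuousAt (fun y => fderiv ℝ (chartAction m d G p)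
      (extChartAt (𝓡 m) (1 : G) 1, y) (X, 0)) (extChartAt (𝓡 d) p p) := by
    have h1 : ContinuousAt (fderiv ℝ (chartAction m d G p))
        (extChartAt (𝓡 m) (1 : G) 1, extChartAt (𝓡 d) p p) :=
      ((contDiffAt_chartAction (one_mem_chartActionDomain ht)).fderiv_right
        (m := ∞) (by simp)).continuousAt
    have h2 : ContinuousAt (fun y : EuclideanSpace ℝ (Fin d) => (extChartAt (𝓡 m) (1 : G) 1, y))
      (extChartAt (𝓡 d) p p) := by fun_prop
    exact (ContinuousAt.comp (f := fun y : EuclideanSpace ℝ (Fin d) =>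
      (extChartAt (𝓡 m) (1 : G) 1, y)) h1 h2).clm_apply continuousAt_const
  have h1 := tendsto_bilin_apply (hB.tendsto.comp h.tendsto_chart) hw
    (hD.tendsto.comp h.tendsto_chart)
  refine tendsto_nhds_unique h1 (tendsto_const_nhds.congr' ?_)
  filter_upwards [h.eventually_mem] with t ht
  have hyt := (extChartAt (𝓡 d) p).map_source (h.mem_source t ht)
  have h3 := fderiv_chartAction_mem (one_mem_chartActionDomain (m := m) (G := G) hyt) X
  rw [chartAction_one hyt] at h3
  exact (h.orthogonal t ht _ h3).symm

/-- Elements of the isotropy group of `p` map normal rays at `p` to normal rays. -/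
theorem smul (hg : IsIsometricAction G g) {a : G} (ha : a • p = p) :
    ∃ ρ' x'', ρ' ≤ ρ ∧ IsNormalRay m G g p (fun t => a • c t) x'' ρ' := by
  have hcs : ContinuousSMul G M := ContMDiffSMul.continuousSMul (I := 𝓡 m) (I' := 𝓡 d) (n := ∞)
  have hlim : Tendsto (fun t => a • c t) (𝓝[>] 0) (𝓝 p) := by
    have := h.tendsto.const_smul a
    rwa [ha] at this
  have hev := (hlim.eventually_mem (extChartAt_source_mem_nhds (I := 𝓡 d) p)).and h.eventually_mem
  obtain ⟨ρ', hρ', hsub⟩ := (mem_nhdsGT_iff_exists_Ioo_subset).1 hev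
  have hsource : ∀ t ∈ Ioo 0 ρ', c t ∈ (extChartAt (𝓡 d) p).source :=
    fun t ht => h.mem_source t (hsub ht).2
  have htarget : ∀ t ∈ Ioo 0 ρ', extChartAt (𝓡 d) p (c t) ∈ (extChartAt (𝓡 d) p).target :=
    fun t ht => (extChartAt (𝓡 d) p).map_source (hsource t ht)
  have hinv : ∀ t ∈ Ioo 0 ρ', (extChartAt (𝓡 d) p).symm (extChartAt (𝓡 d) p (c t)) = c t :=
    fun t ht => (extChartAt (𝓡 d) p).left_inv (hsource t ht)
  have hact : ∀ t ∈ Ioo 0 ρ', a • (extChartAt (𝓡 d) p).symm (extChartAt (𝓡 d) p (c t)) ∈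
      (extChartAt (𝓡 d) p).source := fun t ht => by rw [hinv t ht]; exact (hsub ht).1
  have hφ : ∀ t ∈ Ioo 0 ρ', extChartAt (𝓡 d) p (a • c t) =
      chartSMul d p a (extChartAt (𝓡 d) p (c t)) := fun t ht => by rw [chartSMul, hinv t ht]
  refine ⟨min ρ' ρ, fun t => fderiv ℝ (chartSMul d p a) (extChartAt (𝓡 d) p (c t)) (x' t),
    min_le_right _ _, lt_min hρ' h.pos, hlim, ?_, ?_, ?_, ?_, ?_⟩
  all_goals
    intro t ht
    have ht1 : t ∈ Ioo 0 ρ' := ⟨ht.1, ht.2.trans_le (min_le_left _ _)⟩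
    have ht2 : t ∈ Ioo 0 ρ := ⟨ht.1, ht.2.trans_le (min_le_right _ _)⟩
    have hs := contDiffAt_chartSMul (m := m) (htarget t ht1) (hact t ht1)
  · exact (hsub ht1).1
  · refine ((hs.differentiableAt (by simp)).hasFDerivAt.comp_hasDerivAt t
      (h.hasDerivAt t ht2)).congr_of_eventuallyEq ?_
    filter_upwards [Ioo_mem_nhds ht1.1 ht1.2] with s hs' using hφ s hs'
  · refine (hasDerivAt_fderiv_apply hs (h.hasDerivAt t ht2)
      (h.hasDerivAt_velocity t ht2)).congr_deriv ?_
    rw [hφ t ht1]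
    have htt : chartSMul d p a (extChartAt (𝓡 d) p (c t)) ∈ (extChartAt (𝓡 d) p).target :=
      (extChartAt (𝓡 d) p).map_source (hact t ht1)
    have hdiff : ∀ y ∈ (extChartAt (𝓡 d) p).target, DifferentiableAt ℝ (chartMetric g p) y :=
      fun y hy => ((contDiffOn_chartMetric g p).differentiableOn (by simp)).differentiableAt
        ((isOpen_extChartAt_target p).mem_nhds hy)
    refine eq_geodesicSpray (fun v hv => chartMetric_pos g p htt hv) fun w => ?_
    obtain ⟨w, rfl⟩ := surjective_fderiv_chartSMul (m := m) (htarget t ht1) (hact t ht1) w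
    refine metricForce_isometry hs (hdiff _ (htarget t ht1)) (hdiff _ htt)
      (chartMetric_symm g p _) ?_ (fun w => ?_) w
    · filter_upwards [eventually_smul_extChartAt_symm_mem (m := m) (htarget t ht1) (hact t ht1)]
        with z hz u v using chartMetric_chartSMul (m := m) hg hz.1 hz.2 u v
    · rw [apply_geodesicSpray fun v hv => chartMetric_pos g p (htarget t ht1) hv]
  · rw [hφ t ht1, ← chartMetric_chartSMul (m := m) hg (htarget t ht1) (hact t ht1)]
    exact h.unit_speed t ht2
  · intro τ hτ
    rw [hφ t ht1] at hτ ⊢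
    obtain ⟨σ, hσ, rfl⟩ := exists_mem_chartOrbitTangent (htarget t ht1) (hact t ht1) hτ
    rw [← chartMetric_chartSMul (m := m) hg (htarget t ht1) (hact t ht1)]
    exact h.orthogonal t ht2 σ hσ

end IsNormalRay

end NormalRays

section OppositeRays

theorem eq_neg_of_orthogonal_combination {E : Type*} [AddCommGroup E] [Module ℝ E]
    {B : E → E → ℝ} (hadd : ∀ u v w, B (u + v) w = B u w + B v w)
    (hsmul : ∀ (r : ℝ) u w, B (r • u) w = r * B u w) (hsymm : ∀ u v, B u v = B v u)
    (hpos : ∀ v, v ≠ 0 → 0 < B v v) {T : Submodule ℝ E} {w w' : E} (hw : B w w = 1)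
    (hw' : B w' w' = 1) (hT : ∀ τ ∈ T, B w τ = 0) (hT' : ∀ τ ∈ T, B w' τ = 0) {α : ℝ}
    (h : α • w + (1 - α) • w' ∈ T) : w' = -w := by
  have h0 : α • w + (1 - α) • w' = 0 := by
    by_contra hne
    refine (hpos _ hne).ne' ?_
    rw [hadd, hsmul, hsmul, hT _ h, hT' _ h]; ring
  have h1 : α • w = (-(1 - α)) • w' := by rw [neg_smul]; exact eq_neg_of_add_eq_zero_left h0
  have h2 : B (α • w) (α • w) = α ^ 2 := by
    rw [hsmul, hsymm, hsmul, hw]; ring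
  have h3 : B (α • w) (α • w) = (1 - α) ^ 2 := by
    rw [h1, hsmul, hsymm, hsmul, hw']; ring
  have h4 : α = 1 / 2 := by nlinarith
  rw [h4] at h1
  have h5 : (1 / 2 : ℝ) • w' = (1 / 2 : ℝ) • (-w) := by
    rw [smul_neg, h1]; norm_num
  exact smul_right_injective E (by norm_num : (1 / 2 : ℝ) ≠ 0) h5

variable {d m : ℕ} {M : Type*} [TopologicalSpace M] [ChartedSpace (EuclideanSpace ℝ (Fin d)) M]
  [IsManifold (𝓡 d) ∞ M]
  {G : Type*} [TopologicalSpace G]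
  [ChartedSpace (EuclideanSpace ℝ (Fin m)) G] [Group G] [LieGroup (𝓡 m) ∞ G]
  [MulAction G M] [ContMDiffSMul (𝓡 m) (𝓡 d) ∞ G M]
  {g : Metric d M} {p : M}

open Asymptotics in
/-- If group elements tending to the identity map points of a normal ray at `p` to points
approaching `p` in the direction `-w`, where `w` is orthogonal to the orbit, then the normal ray
has the initial velocity `-w`. -/
theorem IsNormalRay.limit_velocity_eq_neg {c : ℝ → M} {x' : ℝ → EuclideanSpace ℝ (Fin d)} {ρ : ℝ}
    (h : IsNormalRay m G g p c x' ρ) {w w' : EuclideanSpace ℝ (Fin d)}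
    (hw' : Tendsto x' (𝓝[>] 0) (𝓝 w'))
    (hw : chartMetric g p (extChartAt (𝓡 d) p p) w w = 1)
    (hwT : ∀ τ ∈ chartOrbitTangent m d G p (extChartAt (𝓡 d) p p),
      chartMetric g p (extChartAt (𝓡 d) p p) w τ = 0)
    {ι : Type*} (l : Ultrafilter ι) {b : ι → G} {s t : ι → ℝ} (hb : Tendsto b l (𝓝 1))
    (hs : Tendsto s l (𝓝[>] 0)) (ht : Tendsto t l (𝓝[>] 0))
    (hslope : Tendsto (fun i => (s i)⁻¹ • (extChartAt (𝓡 d) p (b i • c (t i))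
      - extChartAt (𝓡 d) p p)) l (𝓝 (-w))) : w' = -w := by
  obtain ⟨Y, P, hY, hP, hconst⟩ := exists_transversal m (d := d) G p
  have hpt : extChartAt (𝓡 d) p p ∈ (extChartAt (𝓡 d) p).target := mem_extChartAt_target p
  have hone : chartAction m d G p (extChartAt (𝓡 m) (1 : G) 1, extChartAt (𝓡 d) p p) =
    extChartAt (𝓡 d) p p := chartAction_one hpt
  set κ := extChartAt (𝓡 d) p
  set κG := extChartAt (𝓡 m) (1 : G)
  set Ψ := chartAction m d G p with hΨ
  set y : ι → EuclideanSpace ℝ (Fin d) := fun i => κ (c (t i))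
  set z : ι → EuclideanSpace ℝ (Fin d) := fun i => κ (b i • c (t i))
  set u : ι → EuclideanSpace ℝ (Fin m) := fun i => κG (b i)
  set r : ι → ℝ := fun i => s i + t i
  have hs0 : ∀ᶠ i in (l : Filter ι), 0 < s i := hs.eventually_mem self_mem_nhdsWithin
  have ht0 : ∀ᶠ i in (l : Filter ι), 0 < t i := ht.eventually_mem self_mem_nhdsWithin
  have hy : Tendsto y l (𝓝 (κ p)) := h.tendsto_chart.comp ht
  have hu : Tendsto u l (𝓝 (κG 1)) := (continuousAt_extChartAt (1 : G)).tendsto.comp hb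
  have hyslope : Tendsto (fun i => (t i)⁻¹ • (y i - κ p)) l (𝓝 w') :=
    (h.tendsto_slope hw').comp ht
  have hyO : (fun i => y i - κ p) =O[l] r := by
    have h1 : (fun i => y i - κ p) =O[l] t := by
      refine ((isBigO_refl t l).smul (hyslope.isBigO_one ℝ)).congr' ?_ (by simp)
      filter_upwards [ht0] with i hi
      simp [smul_smul, hi.ne']
    refine h1.trans (IsBigO.of_bound 1 ?_)
    filter_upwards [hs0, ht0] with i h1 h2
    rw [Real.norm_of_nonneg h2.le, Real.norm_of_nonneg (add_pos h1 h2).le]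
    linarith
  have hzO' : (fun i => z i - κ p) =O[l] s := by
    refine ((isBigO_refl s l).smul (hslope.isBigO_one ℝ)).congr' ?_ (by simp)
    filter_upwards [hs0] with i hi
    simp [smul_smul, hi.ne', z]
  have hzO : (fun i => z i - κ p) =O[l] r := by
    refine hzO'.trans (IsBigO.of_bound 1 ?_)
    filter_upwards [hs0, ht0] with i h1 h2
    rw [Real.norm_of_nonneg h1.le, Real.norm_of_nonneg (add_pos h1 h2).le]
    linarith
  have hz : Tendsto z l (𝓝 (κ p)) := by
    have h1 : Tendsto (fun i => z i - κ p) l (𝓝 0) :=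
      hzO'.trans_tendsto (hs.mono_right nhdsWithin_le_nhds)
    simpa using h1.add_const (κ p)
  have o1 : (fun i => Y (z i) - Y (κ p) - P (z i - κ p)) =o[l] r :=
    (hY.isLittleO.comp_tendsto (hz.prodMk_nhds tendsto_const_nhds)).trans_isBigO hzO
  have hdom := one_mem_chartActionDomain (m := m) (G := G) hpt
  have hΨs : HasStrictFDerivAt Ψ (fderiv ℝ Ψ (κG 1, κ p)) (κG 1, κ p) :=
    (contDiffAt_chartAction hdom).hasStrictFDerivAt (by simp)
  have hF : HasStrictFDerivAt (fun x => Y (Ψ x)) (P.comp (fderiv ℝ Ψ (κG 1, κ p))) (κG 1, κ p) := by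
    have hY' : HasStrictFDerivAt Y P (Ψ (κG 1, κ p)) := by rw [hone]; exact hY
    exact hY'.comp _ hΨs
  have o2 : (fun i => Y (z i) - Y (κ p) - P (y i - κ p)) =o[l] r := by
    have h1 := hF.isLittleO.comp_tendsto
      ((hu.prodMk_nhds hy).prodMk_nhds (hu.prodMk_nhds (tendsto_const_nhds (x := κ p))))
    have h2 : (fun i => (u i, y i) - (u i, κ p)) =O[l] r := by
      refine IsBigO.trans (IsBigO.of_bound 1 (Eventually.of_forall fun i => ?_)) hyO
      simp [Prod.norm_def]
    refine (h1.trans_isBigO h2).congr' ?_ EventuallyEq.rfl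
    filter_upwards [hu.eventually hconst, hb.eventually_mem (extChartAt_source_mem_nhds (I := 𝓡 m)
      (1 : G)), ht.eventually h.eventually_mem] with i hi hbi hti
    have h3 : Ψ (u i, y i) = z i := by
      simp only [hΨ, chartAction, u, y, z]
      rw [(extChartAt (𝓡 m) (1 : G)).left_inv hbi,
        (extChartAt (𝓡 d) p).left_inv (h.mem_source _ hti)]
    simp only [Function.comp_apply, h3, hi, Prod.mk_sub_mk, sub_self]
    congr 1
    change P (fderiv ℝ Ψ (κG 1, κ p) (0, y i - κ p)) = _
    rw [fderiv_chartAction_one_right hpt]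
  have o3 : (fun i => P (z i - κ p) - P (y i - κ p)) =o[l] r := by
    refine (o2.sub o1).congr' (Eventually.of_forall fun i => ?_) EventuallyEq.rfl
    simp only; abel
  obtain ⟨α, hα⟩ : ∃ α, Tendsto (fun i => s i / r i) l (𝓝 α) := by
    have hmem : Icc (0 : ℝ) 1 ∈ l.map (fun i => s i / r i) := by
      change ∀ᶠ i in (l : Filter ι), s i / r i ∈ Icc (0 : ℝ) 1
      filter_upwards [hs0, ht0] with i h1 h2
      exact ⟨by positivity, (div_le_one (add_pos h1 h2)).2 (by change s i ≤ s i + t i; linarith)⟩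
    obtain ⟨α, -, hle⟩ := isCompact_Icc.ultrafilter_le_nhds (l.map fun i => s i / r i)
      (le_principal_iff.2 hmem)
    exact ⟨α, hle⟩
  have hlim1 : Tendsto (fun i => (r i)⁻¹ • (P (z i - κ p) - P (y i - κ p))) l (𝓝 0) :=
    o3.tendsto_inv_smul_nhds_zero
  have hlim2 : Tendsto (fun i => (r i)⁻¹ • (P (z i - κ p) - P (y i - κ p))) l
      (𝓝 (P (α • (-w) - (1 - α) • w'))) := by
    refine ((P.continuous.tendsto _).comp
      ((hα.smul hslope).sub ((hα.const_sub 1).smul hyslope))).congr' ?_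
    filter_upwards [hs0, ht0] with i h1 h2
    have hr : 0 < r i := add_pos h1 h2
    have h3 : 1 - s i / r i = t i / r i := by
      field_simp; simp only [r]; ring
    have h4 : s i / r i * (s i)⁻¹ = (r i)⁻¹ := by field_simp
    have h5 : t i / r i * (t i)⁻¹ = (r i)⁻¹ := by field_simp
    simp only [Function.comp_apply, h3, smul_smul, h4, h5]
    rw [← map_sub, ← map_smul]
    simp only [z, smul_sub]
  have hPz := tendsto_nhds_unique hlim2 hlim1
  have hmem : α • w + (1 - α) • w' ∈ chartOrbitTangent m d G p (κ p) := by
    rw [← hP]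
    have : α • w + (1 - α) • w' = -(α • (-w) - (1 - α) • w') := by
      rw [smul_neg]; abel
    rw [this, map_neg, hPz, neg_zero]
  exact eq_neg_of_orthogonal_combination (B := fun u v => chartMetric g p (κ p) u v)
    (fun u v w => by simp) (fun r u w => by simp) (chartMetric_symm g p _)
    (fun v hv => chartMetric_pos g p hpt hv) hw (h.metric_limit_velocity hw') hwT
    (fun τ hτ => h.limit_velocity_orthogonal hw' hτ) hmem

end OppositeRays

section Gluing

theorem continuousAt_glue {E : Type*} [TopologicalSpace E] {f f' : ℝ → E} {v : E}
    (hf : Tendsto f (𝓝[>] 0) (𝓝 v)) (hf' : Tendsto f' (𝓝[>] 0) (𝓝 v)) :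
    ContinuousAt (fun t : ℝ => if 0 < t then f t else if t < 0 then f' (-t) else v) 0 := by
  have hneg : Tendsto (fun t : ℝ => -t) (𝓝[<] 0) (𝓝[>] 0) := by
    simpa using tendsto_neg_nhdsLT (a := (0 : ℝ))
  refine continuousAt_iff_continuous_left'_right'.2 ⟨?_, ?_⟩
  · refine Tendsto.congr' (f₁ := fun t => f' (-t)) ?_ (by simpa using! hf'.comp hneg)
    filter_upwards [self_mem_nhdsWithin] with t (ht : t < 0)
    rw [if_neg (not_lt.2 ht.le), if_pos ht]
  · refine Tendsto.congr' (f₁ := f) ?_ (by simpa using hf)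
    filter_upwards [self_mem_nhdsWithin] with t (ht : 0 < t)
    rw [if_pos ht]

variable {d m : ℕ} {M : Type*} [TopologicalSpace M] [ChartedSpace (EuclideanSpace ℝ (Fin d)) M]
  [IsManifold (𝓡 d) ∞ M]
  {G : Type*} [TopologicalSpace G]
  [ChartedSpace (EuclideanSpace ℝ (Fin m)) G] [Group G] [LieGroup (𝓡 m) ∞ G]
  [MulAction G M] [ContMDiffSMul (𝓡 m) (𝓡 d) ∞ G M]
  {g : Metric d M} {p : M}

/-- Two normal rays with opposite initial velocities fit together smoothly. -/
theorem IsNormalRay.contDiffAt_glue {c c₂ : ℝ → M} {x' y' : ℝ → EuclideanSpace ℝ (Fin d)}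
    {ρ ρ₂ : ℝ} (h : IsNormalRay m G g p c x' ρ) (h₂ : IsNormalRay m G g p c₂ y' ρ₂)
    {w : EuclideanSpace ℝ (Fin d)} (hw : Tendsto x' (𝓝[>] 0) (𝓝 w))
    (hw₂ : Tendsto y' (𝓝[>] 0) (𝓝 (-w))) :
    ContDiffAt ℝ ∞ (fun t : ℝ => if 0 < t then extChartAt (𝓡 d) p (c t) else
      if t < 0 then extChartAt (𝓡 d) p (c₂ (-t)) else extChartAt (𝓡 d) p p) 0 := by
  set κ := extChartAt (𝓡 d) p
  set r := min ρ ρ₂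
  have hr : 0 < r := lt_min h.pos h₂.pos
  set x : ℝ → EuclideanSpace ℝ (Fin d) := fun t : ℝ => if 0 < t then κ (c t) else
      if t < 0 then κ (c₂ (-t)) else κ p
  set v : ℝ → EuclideanSpace ℝ (Fin d) := fun t : ℝ => if 0 < t then x' t else
      if t < 0 then -y' (-t) else w
  have hx1 : ∀ t, 0 < t → x t = κ (c t) := fun t ht => if_pos ht
  have hx2 : ∀ t, t < 0 → x t = κ (c₂ (-t)) := fun t ht =>
    (if_neg (not_lt.2 ht.le)).trans (if_pos ht)
  have hv1 : ∀ t, 0 < t → v t = x' t := fun t ht => if_pos ht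
  have hv2 : ∀ t, t < 0 → v t = -y' (-t) := fun t ht =>
    (if_neg (not_lt.2 ht.le)).trans (if_pos ht)
  have hmem1 : ∀ t ∈ Ioo (-r) r, 0 < t → t ∈ Ioo 0 ρ := fun t ht h0 =>
    ⟨h0, ht.2.trans_le (min_le_left _ _)⟩
  have hmem2 : ∀ t ∈ Ioo (-r) r, t < 0 → -t ∈ Ioo 0 ρ₂ := fun t ht h0 =>
    ⟨neg_pos.2 h0, (neg_lt.1 ht.1).trans_le (min_le_right _ _)⟩
  have hsm : ContDiffOn ℝ ∞ x (Ioo (-r) r) := by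
    refine contDiffOn_of_second_order_ne (isOpen_extChartAt_target p) (contDiffOn_chartSpray g p)
      (x' := v) (a := 0) isOpen_Ioo ?_ ?_ ?_
      (continuousAt_glue h.tendsto_chart h₂.tendsto_chart) ?_
    · intro t ht
      rcases lt_trichotomy t 0 with h0 | h0 | h0
      · rw [hx2 t h0]; exact κ.map_source (h₂.mem_source _ (hmem2 t ht h0))
      · have : x t = κ p := by simp [x, h0]
        rw [this]; exact mem_extChartAt_target p
      · rw [hx1 t h0]; exact κ.map_source (h.mem_source _ (hmem1 t ht h0))
    · intro t ht hne
      rcases lt_or_gt_of_ne hne with h0 | h0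
      · rw [hv2 t h0]
        have h1 := (h₂.hasDerivAt _ (hmem2 t ht h0)).scomp t (hasDerivAt_neg t)
        rw [neg_one_smul] at h1
        exact h1.congr_of_eventuallyEq
          (eventually_of_mem (Iio_mem_nhds h0) fun s hs => hx2 s hs)
      · rw [hv1 t h0]
        exact (h.hasDerivAt _ (hmem1 t ht h0)).congr_of_eventuallyEq
          (eventually_of_mem (Ioi_mem_nhds h0) fun s hs => hx1 s hs)
    · intro t ht hne
      rcases lt_or_gt_of_ne hne with h0 | h0
      · rw [hv2 t h0, hx2 t h0, geodesicSpray_neg]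
        have h1 := ((h₂.hasDerivAt_velocity _ (hmem2 t ht h0)).scomp t (hasDerivAt_neg t)).neg
        rw [neg_one_smul, neg_neg] at h1
        exact h1.congr_of_eventuallyEq
          (eventually_of_mem (Iio_mem_nhds h0) fun s hs => hv2 s hs)
      · rw [hv1 t h0, hx1 t h0]
        exact (h.hasDerivAt_velocity _ (hmem1 t ht h0)).congr_of_eventuallyEq
          (eventually_of_mem (Ioi_mem_nhds h0) fun s hs => hv1 s hs)
    · have hw₂' : Tendsto (fun t => -y' t) (𝓝[>] 0) (𝓝 w) := by simpa using hw₂.neg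
      exact continuousAt_glue hw hw₂'
  exact hsm.contDiffAt (Ioo_mem_nhds (neg_lt_zero.2 hr) hr)

end Gluing

section CurveInChart

variable {d : ℕ} {M : Type*} [TopologicalSpace M] [ChartedSpace (EuclideanSpace ℝ (Fin d)) M]
  [IsManifold (𝓡 d) ∞ M] {γ : ℝ → M} {s : ℝ} {c : M}

theorem contDiffAt_extChartAt_curve (hγ : ContMDiffAt 𝓘(ℝ, ℝ) (𝓡 d) ∞ γ s)
    (hs : γ s ∈ (extChartAt (𝓡 d) c).source) :
    ContDiffAt ℝ ∞ (fun t => extChartAt (𝓡 d) c (γ t)) s := by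
  rw [← contMDiffAt_iff_contDiffAt]
  exact (contMDiffAt_extChartAt' (by rwa [extChartAt_source] at hs)).comp s hγ

theorem chartFrame_deriv_curve (hγ : ContMDiffAt 𝓘(ℝ, ℝ) (𝓡 d) ∞ γ s)
    (hs : γ s ∈ (extChartAt (𝓡 d) c).source) :
    chartFrame c (extChartAt (𝓡 d) c (γ s)) (deriv (fun t => extChartAt (𝓡 d) c (γ t)) s) =
      (velocity d γ s : EuclideanSpace ℝ (Fin d)) := by
  have hx := (contDiffAt_extChartAt_curve hγ hs).differentiableAt (by simp)
  have h1 := mfderiv_comp_apply_of_base_eq (I'' := 𝓡 d)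
    ((contMDiffAt_extChartAt_symm ((extChartAt (𝓡 d) c).map_source hs)).mdifferentiableAt (by simp))
    hx.mdifferentiableAt rfl (1 : ℝ)
  have hev : (extChartAt (𝓡 d) c).symm ∘ (fun t => extChartAt (𝓡 d) c (γ t)) =ᶠ[𝓝 s] γ := by
    filter_upwards [hγ.continuousAt.eventually_mem
      ((isOpen_extChartAt_source c).mem_nhds hs)] with t ht
    exact (extChartAt (𝓡 d) c).left_inv ht
  have h4 := congrArg (fun L : ℝ →L[ℝ] EuclideanSpace ℝ (Fin d) => L 1)
    (hev.mfderiv_eq (I := 𝓘(ℝ, ℝ)) (I' := 𝓡 d))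
  rw [mfderiv_eq_fderiv] at h1
  exact h1.symm.trans h4

theorem IsGeodesicOn.hasDerivAt_deriv {g : Metric d M} {J : Set ℝ} (hJ : IsOpen J)
    (hγ : IsGeodesicOn g γ J) (hsJ : s ∈ J) (hs : γ s ∈ (extChartAt (𝓡 d) c).source) :
    HasDerivAt (deriv fun t => extChartAt (𝓡 d) c (γ t))
      (geodesicSpray (chartMetric g c) (extChartAt (𝓡 d) c (γ s),
        deriv (fun t => extChartAt (𝓡 d) c (γ t)) s)) s := by
  have hx := contDiffAt_extChartAt_curve (hγ.smooth.contMDiffAt (hJ.mem_nhds hsJ)) hs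
  have hd : DifferentiableAt ℝ (deriv fun t => extChartAt (𝓡 d) c (γ t)) s := by
    have h1 := ((hx.fderiv_right (m := ∞) (by simp)).clm_apply
      (contDiffAt_const (c := (1 : ℝ)))).differentiableAt (by simp)
    exact h1
  have hy := (extChartAt (𝓡 d) c).map_source hs
  refine hd.hasDerivAt.congr_deriv (eq_geodesicSpray (fun v hv => chartMetric_pos g c hy hv) ?_)
  exact metricForce_of_christoffel g c hy
    (hγ.equation s hsJ c (by rwa [extChartAt_source] at hs))

end CurveInChart

section SpecialOrbit

variable {n m : ℕ}
  {M : Type*} [TopologicalSpace M] [T2Space M]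
  [ChartedSpace (EuclideanSpace ℝ (Fin (n + 1))) M] [IsManifold (𝓡 (n + 1)) ∞ M]
  {G : Type*} [TopologicalSpace G] [CompactSpace G]
  [ChartedSpace (EuclideanSpace ℝ (Fin m)) G] [Group G] [LieGroup (𝓡 m) ∞ G]
  [MulAction G M] [ContMDiffSMul (𝓡 m) (𝓡 (n + 1)) ∞ G M]
  {g : Metric (n + 1) M} {K : Subgroup G} {γ : ℝ → M} {J : Set ℝ}

namespace IsNormalGeodesic

variable (hγ : IsNormalGeodesic m g K γ J)
include hγ

theorem exists_isNormalRay {p : M} {e : ℝ} (he : e ^ 2 = 1) {ρ : ℝ} (hρ : 0 < ρ)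
    (hJ : ∀ t ∈ Ioo 0 ρ, e * t ∈ J) (hp : Tendsto (fun t => γ (e * t)) (𝓝[>] 0) (𝓝 p)) :
    ∃ x' ρ', ρ' ≤ ρ ∧ IsNormalRay m G g p (fun t => γ (e * t)) x' ρ' := by
  have hev := hp.eventually_mem (extChartAt_source_mem_nhds (I := 𝓡 (n + 1)) p)
  obtain ⟨ρ₁, hρ₁, hsub⟩ := (mem_nhdsGT_iff_exists_Ioo_subset).1 hev
  set x : ℝ → EuclideanSpace ℝ (Fin (n + 1)) := fun s => extChartAt (𝓡 (n + 1)) p (γ s)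
  refine ⟨fun t => e • deriv x (e * t), min ρ₁ ρ, min_le_right _ _, lt_min hρ₁ hρ, hp,
    ?_, ?_, ?_, ?_, ?_⟩
  all_goals
    intro t ht
    have hsrc : γ (e * t) ∈ (extChartAt (𝓡 (n + 1)) p).source :=
      hsub ⟨ht.1, ht.2.trans_le (min_le_left _ _)⟩
    have htJ : e * t ∈ J := hJ t ⟨ht.1, ht.2.trans_le (min_le_right _ _)⟩
    have hsm := hγ.contMDiffAt_curve htJ
    have hmul : HasDerivAt (fun t => e * t) e t := by simpa using (hasDerivAt_id t).const_mul e
    have hleft := (extChartAt (𝓡 (n + 1)) p).left_inv hsrc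
    have hfr : chartFrame p (x (e * t)) (deriv x (e * t)) =
      (velocity (n + 1) γ (e * t) : EuclideanSpace ℝ (Fin (n + 1))) :=
      chartFrame_deriv_curve hsm hsrc
  · exact hsrc
  · have hx : HasDerivAt x (deriv x (e * t)) (e * t) :=
      ((contDiffAt_extChartAt_curve hsm hsrc).differentiableAt (by simp)).hasDerivAt
    exact hx.scomp t hmul
  · have h1 := ((hγ.geodesic.hasDerivAt_deriv hγ.isOpen htJ hsrc).scomp t hmul).const_smul e
    refine h1.congr_deriv ?_
    rw [smul_smul, ← sq, he, one_smul]
    rcases eq_or_eq_neg_of_sq_eq_sq e 1 (by rw [he, one_pow]) with h | h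
    · rw [h, one_smul]
    · rw [h, neg_one_smul, geodesicSpray_neg]
  · have hbase : ∀ q q' : M, q = q' → ∀ v : EuclideanSpace ℝ (Fin (n + 1)),
        (g.inner q : EuclideanSpace ℝ (Fin (n + 1)) →L[ℝ]
          EuclideanSpace ℝ (Fin (n + 1)) →L[ℝ] ℝ) v v =
        (g.inner q' : EuclideanSpace ℝ (Fin (n + 1)) →L[ℝ]
          EuclideanSpace ℝ (Fin (n + 1)) →L[ℝ] ℝ) v v := by
      rintro _ _ rfl v; rfl
    have h1 : chartMetric g p (x (e * t)) (deriv x (e * t)) (deriv x (e * t)) = 1 := by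
      rw [chartMetric_apply, hfr]
      exact (hbase _ _ hleft _).trans (hγ.unit_speed _ htJ)
    simp only [map_smul, smul_apply, smul_eq_mul]
    rw [← mul_assoc, ← sq, he, one_mul]
    exact h1
  · intro τ hτ
    have hbase : ∀ q q' : M, q = q' → ∀ v w : EuclideanSpace ℝ (Fin (n + 1)),
        (∀ w ∈ orbitTangent m (n + 1) G q', g.inner q' v w = 0) →
        w ∈ (orbitTangent m (n + 1) G q : Submodule ℝ (EuclideanSpace ℝ (Fin (n + 1)))) →
        (g.inner q : EuclideanSpace ℝ (Fin (n + 1)) →L[ℝ]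
          EuclideanSpace ℝ (Fin (n + 1)) →L[ℝ] ℝ) v w = 0 := by
      rintro _ _ rfl v w hv hw; exact hv w hw
    have h1 : chartMetric g p (x (e * t)) (deriv x (e * t)) τ = 0 := by
      rw [chartMetric_apply, hfr]
      exact hbase _ _ hleft _ _ (hγ.orthogonal _ htJ) hτ
    simp only [map_smul, smul_apply, smul_eq_mul]
    exact mul_eq_zero_of_right _ h1

end IsNormalGeodesic

end SpecialOrbit

section Evenness

variable {n m : ℕ}
  {M : Type*} [TopologicalSpace M] [T2Space M]
  [ChartedSpace (EuclideanSpace ℝ (Fin (n + 1))) M] [IsManifold (𝓡 (n + 1)) ∞ M]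
  {G : Type*} [TopologicalSpace G] [CompactSpace G]
  [ChartedSpace (EuclideanSpace ℝ (Fin m)) G] [Group G] [LieGroup (𝓡 m) ∞ G]
  [MulAction G M] [ContMDiffSMul (𝓡 m) (𝓡 (n + 1)) ∞ G M]
  {g : Metric (n + 1) M} {K : Subgroup G} {γ : ℝ → M} {J : Set ℝ}

/-- A dense set contains points approaching a given point in a given direction. -/
theorem exists_curve_in_dense {d : ℕ} {M : Type*} [TopologicalSpace M]
    [ChartedSpace (EuclideanSpace ℝ (Fin d)) M] {D : Set M} (hD : Dense D) (p : M)
    (w : EuclideanSpace ℝ (Fin d)) :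
    ∃ x : ℝ → M, (∀ᶠ s in 𝓝[>] (0 : ℝ), x s ∈ D) ∧ Tendsto x (𝓝[>] 0) (𝓝 p) ∧
      Tendsto (fun s => s⁻¹ • (extChartAt (𝓡 d) p (x s) - extChartAt (𝓡 d) p p)) (𝓝[>] 0)
        (𝓝 w) := by
  set κ := extChartAt (𝓡 d) p
  have hline : Tendsto (fun s : ℝ => κ p + s • w) (𝓝[>] 0) (𝓝 (κ p)) := by
    have : Continuous fun s : ℝ => κ p + s • w := by fun_prop
    simpa using (this.tendsto 0).mono_left nhdsWithin_le_nhds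
  have hex : ∀ᶠ s in 𝓝[>] (0 : ℝ), ∃ x, x ∈ D ∧ x ∈ κ.source ∧ ‖κ x - (κ p + s • w)‖ ≤ s ^ 2 := by
    filter_upwards [hline.eventually_mem (extChartAt_target_mem_nhds p), self_mem_nhdsWithin]
      with s hs (hs0 : 0 < s)
    have ho : IsOpen (κ.source ∩ κ ⁻¹' Metric.ball (κ p + s • w) (s ^ 2)) :=
      (continuousOn_extChartAt p).isOpen_inter_preimage (isOpen_extChartAt_source p)
        Metric.isOpen_ball
    obtain ⟨x, ⟨hx, hxb⟩, hxD⟩ := hD.inter_open_nonempty _ ho ⟨κ.symm (κ p + s • w),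
      κ.map_target hs, by
        rw [mem_preimage, κ.right_inv hs]; exact Metric.mem_ball_self (by positivity)⟩
    rw [mem_preimage, mem_ball_iff_norm] at hxb
    exact ⟨x, hxD, hx, hxb.le⟩
  have : Nonempty M := ⟨p⟩
  obtain ⟨x, hx⟩ := hex.choice
  have hslope : Tendsto (fun s => s⁻¹ • (κ (x s) - κ p)) (𝓝[>] 0) (𝓝 w) := by
    rw [tendsto_iff_norm_sub_tendsto_zero]
    refine squeeze_zero' (Eventually.of_forall fun s => norm_nonneg _) ?_
      (tendsto_id.mono_left nhdsWithin_le_nhds)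
    filter_upwards [hx, self_mem_nhdsWithin] with s ⟨_, _, h3⟩ (hs0 : 0 < s)
    have h4 : s⁻¹ • (κ (x s) - κ p) - w = s⁻¹ • (κ (x s) - (κ p + s • w)) := by
      rw [← sub_sub, smul_sub s⁻¹ _ (s • w), smul_smul, inv_mul_cancel₀ hs0.ne', one_smul]
    rw [h4, norm_smul, norm_inv, Real.norm_of_nonneg hs0.le, id]
    calc s⁻¹ * ‖κ (x s) - (κ p + s • w)‖ ≤ s⁻¹ * s ^ 2 := by gcongr
      _ = s := by field_simp
  refine ⟨x, hx.mono fun s h => h.1, ?_, hslope⟩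
  have hκx : Tendsto (fun s => κ (x s)) (𝓝[>] 0) (𝓝 (κ p)) := by
    have h1 : Tendsto (fun s : ℝ => s • (s⁻¹ • (κ (x s) - κ p))) (𝓝[>] 0) (𝓝 ((0 : ℝ) • w)) :=
      (tendsto_id.mono_left nhdsWithin_le_nhds).smul hslope
    rw [zero_smul] at h1
    have h2 : Tendsto (fun s => κ (x s) - κ p) (𝓝[>] 0) (𝓝 0) := by
      refine h1.congr' ?_
      filter_upwards [self_mem_nhdsWithin] with s (hs0 : 0 < s)
      rw [smul_smul, mul_inv_cancel₀ hs0.ne', one_smul]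
    simpa using h2.add_const (κ p)
  have h1 := (continuousAt_extChartAt_symm (I := 𝓡 d) p).tendsto.comp hκx
  rw [extChartAt_to_inv] at h1
  exact h1.congr' (hx.mono fun s h => κ.left_inv h.2.1)

namespace IsNormalGeodesic

variable (hγ : IsNormalGeodesic m g K γ J) (hG : IsCohomogeneityOne m g K)
include hγ hG

/-- An element of the isotropy group of a non-principal point reverses the normal geodesic. -/
theorem exists_isotropy_reversing {p : M} (hp : p ∉ orbitType M K) (hend : IsEnd G γ J p 0)
    {e : ℝ} (he : e ^ 2 = 1) (hJ : ∀ t ∈ J, 0 < e * t) {x' : ℝ → EuclideanSpace ℝ (Fin (n + 1))}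
    {ρ : ℝ} (h : IsNormalRay m G g p (fun t => γ (e * t)) x' ρ)
    {w : EuclideanSpace ℝ (Fin (n + 1))} (hw : Tendsto x' (𝓝[>] 0) (𝓝 w)) :
    ∃ a : G, a • p = p ∧ ∀ y' ρ₂, IsNormalRay m G g p (fun t => a • γ (e * t)) y' ρ₂ →
      Tendsto y' (𝓝[>] 0) (𝓝 (-w)) := by
  have hcs : ContinuousSMul G M :=
    ContMDiffSMul.continuousSMul (I := 𝓡 m) (I' := 𝓡 (n + 1)) (n := ∞)
  have hGt : IsTopologicalGroup G := topologicalGroup_of_lieGroup (𝓡 m) ∞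
  obtain ⟨x, hxD, hxp, hxslope⟩ := exists_curve_in_dense hG.dense_principal p (-w)
  have hcoord : Tendsto (fun s => orbitCoord G γ J (x s)) (𝓝[>] 0) (𝓝[J] 0) :=
    (hγ.tendsto_orbitCoord hG hp hend).comp (tendsto_nhdsWithin_iff.2 ⟨hxp, hxD⟩)
  set t : ℝ → ℝ := fun s => e * orbitCoord G γ J (x s) with ht_def
  have ht : Tendsto t (𝓝[>] 0) (𝓝[>] 0) := by
    refine tendsto_nhdsWithin_iff.2 ⟨?_, ?_⟩
    · simpa using (hcoord.mono_right nhdsWithin_le_nhds).const_mul e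
    · exact hxD.mono fun s hs => hJ _ (hγ.orbitCoord_mem hs)
  have het : ∀ s, e * t s = orbitCoord G γ J (x s) := fun s => by
    rw [ht_def, ← mul_assoc, ← sq, he, one_mul]
  obtain ⟨b, hb⟩ := (hxD.mono fun s hs => hγ.exists_smul_curve hs).choice
  set l : Ultrafilter ℝ := Ultrafilter.of (𝓝[>] (0 : ℝ))
  have hl : (l : Filter ℝ) ≤ 𝓝[>] 0 := Ultrafilter.of_le _
  obtain ⟨a, -, ha⟩ := isCompact_univ.ultrafilter_le_nhds (l.map b) (by simp)
  have hba : Tendsto b l (𝓝 a) := ha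
  have hcp : Tendsto (fun s => γ (e * t s)) l (𝓝 p) := h.tendsto.comp (ht.mono_left hl)
  have hap : a • p = p := by
    refine tendsto_nhds_unique (hba.smul hcp) ((hxp.mono_left hl).congr' ?_)
    filter_upwards [hl hb] with s hs
    rw [het]; exact hs.symm
  refine ⟨a, hap, fun y' ρ₂ h₂ => ?_⟩
  obtain ⟨w', hw'⟩ := h₂.exists_tendsto_velocity
  suffices w' = -w by rwa [this] at hw'
  have hb1 : Tendsto (fun s => b s * a⁻¹) l (𝓝 1) := by
    simpa using hba.mul_const a⁻¹
  refine h₂.limit_velocity_eq_neg hw' (h.metric_limit_velocity hw)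
    (fun τ hτ => h.limit_velocity_orthogonal hw hτ) l hb1 (s := id) (t := t)
    (tendsto_id.mono_left hl) (ht.mono_left hl) ((hxslope.mono_left hl).congr' ?_)
  filter_upwards [hl hb] with s hs
  rw [smul_smul, inv_mul_cancel_right, het, hs, id]

theorem exists_sign (h0 : 0 ∈ closure J) (h0J : 0 ∉ J) :
    ∃ e : ℝ, e ^ 2 = 1 ∧ (∀ t ∈ J, 0 < e * t) ∧ ∃ ρ > 0, ∀ t ∈ Ioo 0 ρ, e * t ∈ J := by
  obtain ⟨t₀, ht₀⟩ : J.Nonempty := closure_nonempty_iff.1 ⟨0, h0⟩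
  have hne : t₀ ≠ 0 := fun h => h0J (h ▸ ht₀)
  obtain ⟨e, he, het⟩ : ∃ e : ℝ, e ^ 2 = 1 ∧ 0 < e * t₀ := by
    rcases lt_or_gt_of_ne hne with h | h
    · exact ⟨-1, by norm_num, by linarith⟩
    · exact ⟨1, by norm_num, by linarith⟩
  have hsq : ∀ t : ℝ, e * (e * t) = t := fun t => by rw [← mul_assoc, ← sq, he, one_mul]
  have hcases := eq_or_eq_neg_of_sq_eq_sq e 1 (by rw [he, one_pow])
  have hpos : ∀ t ∈ J, 0 < e * t := by
    intro t ht
    by_contra! hle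
    refine h0J ?_
    rcases hcases with rfl | rfl
    · exact hγ.ordConnected.out ht ht₀ ⟨by linarith, by linarith⟩
    · exact hγ.ordConnected.out ht₀ ht ⟨by linarith, by linarith⟩
  refine ⟨e, he, hpos, e * t₀, het, fun t ht => ?_⟩
  obtain ⟨t₁, ht₁, hd⟩ := Metric.mem_closure_iff.1 h0 t ht.1
  rw [Real.dist_eq, zero_sub, abs_neg] at hd
  have h1 := hpos t₁ ht₁
  have h2 : e * t₁ < t := by
    refine lt_of_le_of_lt (le_abs_self _) ?_
    rcases hcases with rfl | rfl <;> simpa using hd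
  rcases hcases with rfl | rfl
  · exact hγ.ordConnected.out ht₁ ht₀ ⟨by linarith, by linarith [ht.2]⟩
  · exact hγ.ordConnected.out ht₀ ht₁ ⟨by linarith [ht.2], by linarith⟩

/-- Invariant functions are even along normal geodesics at non-principal orbits. -/
theorem isSmoothEven_comp {U : M → ℝ} (hU : ContMDiff (𝓡 (n + 1)) 𝓘(ℝ, ℝ) ∞ U)
    (hinv : ∀ (a : G) (p : M), U (a • p) = U p) (hsp : HasSpecialOrbitAtZero K γ J) :
    IsSmoothEven (U ∘ γ) J := by
  obtain ⟨h0, p, hp, hlim⟩ := hsp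
  have hne : (𝓝[J] (0 : ℝ)).NeBot := mem_closure_iff_nhdsWithin_neBot.1 h0
  have h0J : (0 : ℝ) ∉ J := by
    intro h
    have h1 : Tendsto γ (𝓝[J] 0) (𝓝 (γ 0)) :=
      (hγ.contMDiffAt_curve h).continuousAt.tendsto.mono_left nhdsWithin_le_nhds
    exact hp (tendsto_nhds_unique hlim h1 ▸ hγ.mem_principal 0 h)
  have hend : IsEnd G γ J p 0 :=
    ⟨h0J, h0, (continuous_quot_mk.tendsto p).comp hlim⟩
  obtain ⟨e, he, hpos, ρ, hρ, hρJ⟩ := hγ.exists_sign hG h0 h0J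
  have hsq : ∀ t : ℝ, e * (e * t) = t := fun t => by rw [← mul_assoc, ← sq, he, one_mul]
  have hcases := eq_or_eq_neg_of_sq_eq_sq e 1 (by rw [he, one_pow])
  have hcl : Tendsto (fun t => γ (e * t)) (𝓝[>] 0) (𝓝 p) := by
    refine hlim.comp (tendsto_nhdsWithin_iff.2 ⟨?_, ?_⟩)
    · have : Continuous fun t : ℝ => e * t := by fun_prop
      simpa using (this.tendsto 0).mono_left nhdsWithin_le_nhds
    · filter_upwards [Ioo_mem_nhdsGT hρ] with t ht using hρJ t ht
  obtain ⟨x', ρ₁, hρ₁, h⟩ := hγ.exists_isNormalRay he hρ hρJ hcl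
  obtain ⟨w, hw⟩ := h.exists_tendsto_velocity
  obtain ⟨a, hap, ha⟩ := hγ.exists_isotropy_reversing hG hp hend he hpos h hw
  obtain ⟨ρ₂, y', hρ₂, h₂⟩ := h.smul hG.isometric hap
  have hglue := h.contDiffAt_glue h₂ hw (ha y' ρ₂ h₂)
  have habs : ∀ t ∈ J, e * |t| = t := fun t ht => by
    have h1 := hpos t ht
    rcases hcases with rfl | rfl
    · rw [abs_of_pos (by linarith)]; ring
    · rw [abs_of_neg (by linarith)]; ring
  refine ⟨fun t => if t = 0 then U p else U (γ (e * |t|)), ?_, fun t => by simp, fun t ht => ?_⟩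
  · intro t ht
    refine ContDiffAt.contDiffWithinAt ?_
    by_cases ht0 : t = 0
    · subst ht0
      have hUκ : ContDiffAt ℝ ∞ (fun y => U ((extChartAt (𝓡 (n + 1)) p).symm y))
          (extChartAt (𝓡 (n + 1)) p p) := by
        rw [← contMDiffAt_iff_contDiffAt]
        exact hU.contMDiffAt.comp _ (contMDiffAt_extChartAt_symm (mem_extChartAt_target p))
      have h1 := ContDiffAt.comp (g := fun y => U ((extChartAt (𝓡 (n + 1)) p).symm y)) (0 : ℝ)
        (by simpa using hUκ) hglue
      refine h1.congr_of_eventuallyEq ?_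
      have hmem : Ioo (-ρ₂) ρ₂ ∈ 𝓝 (0 : ℝ) := Ioo_mem_nhds (neg_lt_zero.2 h₂.pos) h₂.pos
      filter_upwards [hmem] with s hs
      simp only [Function.comp_apply]
      rcases lt_trichotomy s 0 with hs0 | hs0 | hs0
      · rw [if_neg hs0.ne, if_neg (not_lt.2 hs0.le), if_pos hs0,
          (extChartAt (𝓡 (n + 1)) p).left_inv
            (h₂.mem_source (-s) ⟨neg_pos.2 hs0, neg_lt.1 hs.1⟩), hinv, abs_of_neg hs0]
      · rw [if_pos hs0, hs0, if_neg (lt_irrefl _), if_neg (lt_irrefl _), extChartAt_to_inv]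
      · rw [if_neg hs0.ne', if_pos hs0, (extChartAt (𝓡 (n + 1)) p).left_inv
          (h.mem_source s ⟨hs0, hs.2.trans_le hρ₂⟩), abs_of_pos hs0]
    · have hmem : e * |t| ∈ J := by
        rcases ht with h1 | h1 | h1
        · rwa [habs t h1]
        · exact absurd h1 ht0
        · rw [← abs_neg, habs _ h1]; exact h1
      have h1 : ContDiffAt ℝ ∞ (fun s : ℝ => U (γ (e * |s|))) t := by
        have h2 : ContDiffAt ℝ ∞ (fun s : ℝ => e * |s|) t :=
          contDiffAt_const.mul (contDiffAt_abs ht0)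
        have h3 : ContDiffAt ℝ ∞ (U ∘ γ) (e * |t|) := by
          rw [← contMDiffAt_iff_contDiffAt]
          exact hU.contMDiffAt.comp _ (hγ.contMDiffAt_curve hmem)
        exact ContDiffAt.comp (g := U ∘ γ) t h3 h2
      refine h1.congr_of_eventuallyEq ?_
      filter_upwards [isOpen_ne.mem_nhds ht0] with s hs
      exact if_neg hs
  · have ht0 : t ≠ 0 := fun h => h0J (h ▸ ht)
    simp only [if_neg ht0, habs t ht, Function.comp_apply]

/-- The differential of an invariant function in terms of the coordinate transverse to the
principal orbits. -/
theorem mvfderiv_of_invariant {U : M → ℝ} (hU : ContMDiff (𝓡 (n + 1)) 𝓘(ℝ, ℝ) ∞ U)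
    (hinv : ∀ (a : G) (p : M), U (a • p) = U p) {p : M} (hp : p ∈ orbitType M K) :
    mvfderiv (𝓡 (n + 1)) U p = deriv (U ∘ γ) (orbitCoord G γ J p) •
      mvfderiv (𝓡 (n + 1)) (orbitCoord G γ J) p := by
  have ht := hγ.mdifferentiableAt_orbitCoord hG hp
  have hs := hγ.orbitCoord_mem hp
  have hu : DifferentiableAt ℝ (U ∘ γ) (orbitCoord G γ J p) := by
    rw [← mdifferentiableAt_iff_differentiableAt]
    exact (hU.mdifferentiable (by simp) _).comp _ (hγ.mdifferentiableAt_curve hs)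
  have hev : (U ∘ γ) ∘ orbitCoord G γ J =ᶠ[𝓝 p] U := by
    filter_upwards [hG.isOpen_principal.mem_nhds hp] with q hq
    obtain ⟨a, ha⟩ := hγ.exists_smul_curve hq
    simp only [Function.comp_apply]
    conv_rhs => rw [← ha, hinv]
  ext v
  have h1 := mfderiv_comp_apply_of_base_eq (I := 𝓡 (n + 1)) (I' := 𝓘(ℝ, ℝ)) (I'' := 𝓘(ℝ, ℝ))
    hu.mdifferentiableAt ht rfl v
  have h2 : ∀ c : ℝ, (mfderiv 𝓘(ℝ, ℝ) 𝓘(ℝ, ℝ) (U ∘ γ) (orbitCoord G γ J p) c : ℝ)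
      = deriv (U ∘ γ) (orbitCoord G γ J p) * c := fun c => by
    rw [mfderiv_eq_fderiv, hu.hasDerivAt.hasFDerivAt.fderiv]
    exact mul_comm c _
  have h3 := congrArg (fun L : EuclideanSpace ℝ (Fin (n + 1)) →L[ℝ] ℝ => L v)
    (hev.mfderiv_eq (I := 𝓡 (n + 1)) (I' := 𝓘(ℝ, ℝ)))
  exact h3.symm.trans (h1.trans (h2 _))

end IsNormalGeodesic

end Evenness

end CohomOne

end

theorem lemma1p5 {n m : ℕ}
    {M : Type*} [TopologicalSpace M] [T2Space M] [SecondCountableTopology M] [ConnectedSpace M]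
    [ChartedSpace (EuclideanSpace ℝ (Fin (n + 1))) M] [IsManifold (𝓡 (n + 1)) ∞ M]
    {G : Type*} [TopologicalSpace G] [T2Space G] [CompactSpace G]
    [ChartedSpace (EuclideanSpace ℝ (Fin m)) G] [Group G] [LieGroup (𝓡 m) ∞ G]
    [MulAction G M] [ContMDiffSMul (𝓡 m) (𝓡 (n + 1)) ∞ G M]
    (g : CohomOne.Metric (n + 1) M) (K : Subgroup G)
    (hG : CohomOne.IsCohomogeneityOne m g K)
    (γ : ℝ → M) (J : Set ℝ) (hγ : CohomOne.IsNormalGeodesic m g K γ J)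
    (ε : ℝ) (η : CohomOne.OneForm (n + 1) M)
    (hη : CohomOne.IsRicciSoliton g ε η) :
    (CohomOne.IsInvariantForm G η →
      (∀ p ∈ CohomOne.orbitType M K, CohomOne.HasNoTrivialSummand m (n + 1) G p) →
      CohomOne.IsGradientRicciSoliton g ε η) ∧
    (∀ U : M → ℝ, CohomOne.IsPotential U η → (∀ (a : G) (p : M), U (a • p) = U p) →
      ∃ u : ℝ → ℝ, ContDiffOn ℝ ∞ u J ∧
        (∀ p ∈ CohomOne.orbitType M K, U p = u (CohomOne.orbitCoord G γ J p)) ∧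
        ContMDiffOn (𝓡 (n + 1)) 𝓘(ℝ, ℝ) ∞ (CohomOne.orbitCoord G γ J)
          (CohomOne.orbitType M K) ∧
        (∀ p ∈ CohomOne.orbitType M K,
          η p = deriv u (CohomOne.orbitCoord G γ J p) •
            mvfderiv (𝓡 (n + 1)) (CohomOne.orbitCoord G γ J) p) ∧
        (CohomOne.HasSpecialOrbitAtZero K γ J → CohomOne.IsSmoothEven u J)) := by
  refine ⟨fun hinv hT => ⟨hη, hγ.exists_isPotential hG hη.smooth hinv hT⟩, fun U hU hinv => ?_⟩
  refine ⟨U ∘ γ, ?_, fun p hp => ?_,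
    fun p hp => (hγ.contMDiffAt_orbitCoord hG hp).contMDiffWithinAt,
    fun p hp => (hU.2 p).trans (hγ.mvfderiv_of_invariant hG hU.1 hinv hp),
    hγ.isSmoothEven_comp hG hU.1 hinv⟩
  · rw [← contMDiffOn_iff_contDiffOn]
    exact hU.1.comp_contMDiffOn hγ.geodesic.smooth
  · obtain ⟨a, ha⟩ := hγ.exists_smul_curve hp
    conv_lhs => rw [← ha, hinv]
    rfl
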